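/- **Setting.** Fix an observation model: $q$ colors; a finite set $T$ of variable types with a probability distribution $\mathcal T$; a prior $\mathbb P_\tau$ on $[q]$ for each $\tau\in T$; and $F$ observation types, the $i$-th having an arity $\mathrm a(i)\ge 1$, a class $\mathrm{Cl}(i)\in T^{\mathrm a(i)}$ and a density $\phi_i:[q]^{\mathrm a(i)}\to[0,\infty)$. In the planted model on $[n]$ the types $\tau(v)\sim\mathcal T$ are independent; given $\tau$, the colors $c(v)\sim\mathbb P_{\tau(v)}$ of the hidden coloring are independent; given $\tau,c$, each potential factor $e=(i,(v_1,\dots,v_{\mathrm a(i)}))$ with distinct $v_j$ and $\tau(v_j)=\mathrm{Cl}(i)_j$ for all $j$ is included in $G$ independently with probability $\min\{1,\phi_i(c(v_1),\dots,c(v_{\mathrm a(i)}))/n^{\mathrm a(i)-1}\}$. Let $\bar\phi_i=\sum_{c}\prod_k\mathbb P_{\mathrm{Cl}(i)_k}(c_k)\,\phi_i(c)$, the sum being over $c\in[q]^{\mathrm a(i)}$, and assume detailed balance: for all $i$, $j$ and all $a$ with $\mathbb P_{\mathrm{Cl}(i)_j}(a)>0$, $\sum_{c:\,c_j=a}\prod_{k\ne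 j}\mathbb P_{\mathrm{Cl}(i)_k}(c_k)\,\phi_i(c)=\bar\phi_i$. Let $\mu_i(c)=\prod_k\mathbb P_{\mathrm{Cl}(i)_k}(c_k)\,\phi_i(c)/\bar\phi_i$, let $\Psi_{i,a|b}(\alpha,\beta)=\Pr_{c\sim\mu_i}[c_a=\alpha\mid c_b=\beta]$ (zero if the condition has probability zero) and $\overline\Psi_{i,a|b}=(I-\mathbb P_{\mathrm{Cl}(i)_a}\mathbf 1^\top)\Psi_{i,a|b}$. Let $H_\tau$ be the diagonal matrix with entry $\mathbb P_{\tau(v)}(c)$ at $(v,c)$ if this is positive and $1$ otherwise, and let $\langle x,y\rangle_H=x^\top H_\tau^{-1}y$ on $\mathbb R^{nq}$, $\|x\|^2=\langle x,x\rangle_H$. The operator $L$ maps a $|T|q\times|T|q$ matrix $X$ to the block-diagonal matrix with $$L(X)[\tau,\tau]=\sum_{i}\ \sum_{a\ne b:\ \mathrm{Cl}(i)_a=\tau}\frac{\bar\phi_i}{\mathcal T(\tau)}\prod_k\mathcal T(\mathrm{Cl}(i)_k)\ \overline\Psi_{i,a|b}\,X[\tau',\tau']\,\overline\Psi_{i,a|b}^{\,*},\qquad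 \tau'=\mathrm{Cl}(i)_b,$$ (zero if $\mathcal T(\tau)=0$), where $*$ is the adjoint for the inner products above; $\lambda_L$ is its spectral radius. The $(u,w)$ block of the matrix $A^{(s)}$ is $$\sum\ \prod_{t=0}^{s-1}\bigl(\mathbf 1[e_t\in G]-\Pr\nolimits_{\mathrm{null}}[e_t]\bigr)\ \overline\Psi_{e_0,v_0|v_1}\cdots\overline\Psi_{e_{s-1},v_{s-1}|v_s},$$ summed over the nonbacktracking walks $u=v_0e_0v_1\cdots e_{s-1}v_s=w$ ($v_t\neq v_{t+1}$ both in $e_t$, and $e_t\ne e_{t+1}$) in the graph of all potential factors $e$ compatible with $\tau$. Here $\overline\Psi_{e,u|w}=\overline\Psi_{i,a|b}$ if $e$ has type $i$ and $u,w$ have positions $a,b$ in it, and $\Pr_{\mathrm{null}}[e]$ is the inclusion probability of $e$ averaged over fresh independent colors of its variables drawn from their priors (so it equals $\bar\phi_i/n^{\mathrm a(i)-1}$ once $n$ is large, if $\mathrm a(i)\ge2$). Let $g\in\mathbb R^{nq}$, $g_{(v,a)}=\mathbf 1[c(v)=a]$, be the color-indicator vector of the hidden coloring. **Theorem.** $A^{(s)}$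 is always self-adjoint for $\langle\cdot,\cdot\rangle_H$. There are constants $\gamma_s>0$ ($s\ge0$), depending only on the model and on $s$, such that $\gamma_{2k}$ and $\gamma_{2k+1}$ converge, as $k\to\infty$, to positive limits, which are equal unless $-\lambda_L$ is an eigenvalue of $L$, and such that for every sequence $s=s(n)\ge 0$ of integers with $s\le\log n/(\log\log n)^2$ for all large $n$: 1. for every $\varepsilon>0$, with probability $1-o(1)$ in the planted model, $$\left|\frac{\langle g,A^{(s)}g\rangle_H}{\|g\|^2}-\gamma_s\lambda_L^s\right|\le\varepsilon\,\gamma_s\lambda_L^s;$$ 2. with probability $1-o(1)$ in the planted model, the largest eigenvalue of $A^{(s)}$ is at least $\lambda_L^s/q$. -/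

import Mathlib

open Filter Topology
open scoped Matrix

noncomputable section

/-- An observation model on `q` colours, with a finite set `T` of variable types and `F`
observation types. Each observation type `i` has a fixed tuple `cls i` of variable types on which
it applies, so its density `dens i` is a function of the colours only. -/
structure ObservationModel (q : ℕ) (T : Type*) [Fintype T] (F : ℕ) where
  /-- distribution of the type of a variable -/
  typeDist : T → ℝ
  typeDist_nonneg : ∀ t, 0 ≤ typeDist t
  typeDist_sum : ∑ t, typeDist t = 1
  /-- prior distribution of the colour of a variable of a given type -/
  prior : T → Fin q → ℝ
  prior_nonneg : ∀ t c, 0 ≤ prior t c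
  prior_sum : ∀ t, ∑ c, prior t c = 1
  /-- arity of an observation type -/
  arity : Fin F → ℕ
  arity_pos : ∀ i, 0 < arity i
  /-- variable types on which an observation type applies -/
  cls : (i : Fin F) → Fin (arity i) → T
  /-- density of an observation type, as a function of the colours -/
  dens : (i : Fin F) → (Fin (arity i) → Fin q) → ℝ
  dens_nonneg : ∀ i c, 0 ≤ dens i c

namespace ObservationModel

variable {q : ℕ} {T : Type*} [Fintype T] {F : ℕ} (M : ObservationModel q T F)

/-! ### Local quantities of the model -/

/-- The average density of observation type `i`. -/
def avgDens (i : Fin F) : ℝ :=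
  ∑ c : Fin (M.arity i) → Fin q, (∏ k, M.prior (M.cls i k) (c k)) * M.dens i c

/-- Detailed balance: fixing the colour of one position to any colour of positive prior
probability does not change the average density. (Equivalently, the uninformative messages are a
fixed point of belief propagation.) -/
def DetailedBalance : Prop :=
  ∀ (i : Fin F) (j : Fin (M.arity i)) (a : Fin q), 0 < M.prior (M.cls i j) a →
    ∑ c : Fin (M.arity i) → Fin q,
      (if c j = a then (∏ k ∈ Finset.univ.erase j, M.prior (M.cls i k) (c k)) * M.dens i c
        else 0) = M.avgDens i

/-- The local colour distribution `μ_i` of an observation of type `i`. -/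
def localDist (i : Fin F) (c : Fin (M.arity i) → Fin q) : ℝ :=
  (∏ k, M.prior (M.cls i k) (c k)) * M.dens i c / M.avgDens i

/-- `Ψ_{i, a ∣ b}(α, β) = Pr_{c ∼ μ_i}[c_a = α ∣ c_b = β]`; a column whose conditioning event
has probability zero is zero. -/
def condMat (i : Fin F) (a b : Fin (M.arity i)) : Matrix (Fin q) (Fin q) ℝ :=
  Matrix.of fun α β =>
    (∑ c : Fin (M.arity i) → Fin q, if c a = α ∧ c b = β then M.localDist i c else 0) /
      (∑ c : Fin (M.arity i) → Fin q, if c b = β then M.localDist i c else 0)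

/-- The centred transition matrix `(I - P_{cls i a} 1ᵀ) Ψ_{i, a ∣ b}`. -/
def transMat (i : Fin F) (a b : Fin (M.arity i)) : Matrix (Fin q) (Fin q) ℝ :=
  (1 - Matrix.vecMulVec (M.prior (M.cls i a)) (fun _ => 1)) * M.condMat i a b

/-- The diagonal of `H` on a variable of type `t`. -/
def hDiag (t : T) (c : Fin q) : ℝ :=
  if 0 < M.prior t c then M.prior t c else 1

/-- The adjoint of `transMat i a b`, as a map from `ℝ^q` with the inner product
`⟨x, y⟩ = xᵀ H⁻¹ y` of type `cls i b` to `ℝ^q` with that of type `cls i a`. -/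
def transMatAdj (i : Fin F) (a b : Fin (M.arity i)) : Matrix (Fin q) (Fin q) ℝ :=
  Matrix.diagonal (M.hDiag (M.cls i b)) * (M.transMat i a b)ᵀ *
    Matrix.diagonal (fun c => (M.hDiag (M.cls i a) c)⁻¹)

/-- The mean of the (asymptotically Poisson) number of observations of type `i` that contain a
given variable of type `t` in a given position of class `t`. (It is `0` if `t` has mass `0`.) -/
def meanDegree (i : Fin F) (t : T) : ℝ :=
  M.avgDens i / M.typeDist t * ∏ k, M.typeDist (M.cls i k)

/-- The `(t, t)` block of a matrix indexed by `T × [q]`. -/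
def diagBlock (X : Matrix (T × Fin q) (T × Fin q) ℝ) (t : T) : Matrix (Fin q) (Fin q) ℝ :=
  X.submatrix (fun c => (t, c)) (fun c => (t, c))

open Classical in
/-- The `(t, t)` block of `L(X)`: the sum, over observation types `i` and pairs of distinct
positions `a, b` with `cls i a = t`, of `meanDegree i t • Θ X[t',t'] Θ^*`, where
`Θ = transMat i a b` and `t' = cls i b`. -/
def influenceBlock (X : Matrix (T × Fin q) (T × Fin q) ℝ) (t : T) : Matrix (Fin q) (Fin q) ℝ :=
  ∑ i, ∑ a, ∑ b, if a ≠ b ∧ M.cls i a = t then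
    M.meanDegree i t • (M.transMat i a b * diagBlock X (M.cls i b) * M.transMatAdj i a b)
    else 0

theorem influenceBlock_add (X Y : Matrix (T × Fin q) (T × Fin q) ℝ) (t : T) :
    M.influenceBlock (X + Y) t = M.influenceBlock X t + M.influenceBlock Y t := by
  have h : ∀ t, diagBlock (X + Y) t = diagBlock X t + diagBlock Y t := fun _ => rfl
  simp only [influenceBlock, ← Finset.sum_add_distrib]
  refine Finset.sum_congr rfl fun i _ => Finset.sum_congr rfl fun a _ =>
    Finset.sum_congr rfl fun b _ => ?_
  split_ifs
  · rw [h, Matrix.mul_add, Matrix.add_mul, smul_add]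
  · rw [add_zero]

theorem influenceBlock_smul (r : ℝ) (X : Matrix (T × Fin q) (T × Fin q) ℝ) (t : T) :
    M.influenceBlock (r • X) t = r • M.influenceBlock X t := by
  have h : ∀ t, diagBlock (r • X) t = r • diagBlock X t := fun _ => rfl
  simp only [influenceBlock, Finset.smul_sum]
  refine Finset.sum_congr rfl fun i _ => Finset.sum_congr rfl fun a _ =>
    Finset.sum_congr rfl fun b _ => ?_
  split_ifs
  · rw [h, Matrix.mul_smul, Matrix.smul_mul, smul_comm]
  · rw [smul_zero]

open Classical in
/-- The two-step quadratic influence operator `L` on `|T|q × |T|q` matrices; the off-diagonal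
blocks of `L(X)` are zero. -/
def influence :
    Matrix (T × Fin q) (T × Fin q) ℝ →ₗ[ℝ] Matrix (T × Fin q) (T × Fin q) ℝ where
  toFun X := Matrix.of fun x y => if x.1 = y.1 then M.influenceBlock X x.1 x.2 y.2 else 0
  map_add' X Y := by
    ext x y
    simp only [Matrix.of_apply, Matrix.add_apply, influenceBlock_add]
    split_ifs <;> simp
  map_smul' r X := by
    ext x y
    simp only [Matrix.of_apply, Matrix.smul_apply, influenceBlock_smul, RingHom.id_apply]
    split_ifs <;> simp

/-- `λ_L`: the spectral radius of `L` (over the complex numbers). -/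
def lamL : ℝ :=
  (spectralRadius ℂ
    (LinearMap.baseChange ℂ M.influence :
      Module.End ℂ (TensorProduct ℝ ℂ (Matrix (T × Fin q) (T × Fin q) ℝ)))).toReal

/-! ### The planted distribution -/

/-- A potential observation on `n` variables: an observation type and a tuple of distinct
variables. -/
abbrev Factor (n : ℕ) : Type := (i : Fin F) × (Fin (M.arity i) ↪ Fin n)

/-- The potential observation `e` is compatible with the variable types `τ`, i.e. it is a
factor of the complete factor graph. -/
def Compatible {n : ℕ} (τ : Fin n → T) (e : M.Factor n) : Prop :=
  ∀ k, τ (e.2 k) = M.cls e.1 k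

/-- The probability with which an observation of type `i` is included when its variables have
colours `c`. (The minimum with `1` is vacuous for large `n` if the arity is at least two.) -/
def inclProb (n : ℕ) (i : Fin F) (c : Fin (M.arity i) → Fin q) : ℝ :=
  min 1 (M.dens i c / (n : ℝ) ^ (M.arity i - 1))

open Classical in
/-- `Pr[e ∈ G ∣ τ, c]` in the planted model. -/
def plantedProb {n : ℕ} (τ : Fin n → T) (c : Fin n → Fin q) (e : M.Factor n) : ℝ :=
  if M.Compatible τ e then M.inclProb n e.1 (fun k => c (e.2 k)) else 0

/-- `Pr[e ∈ G ∣ τ]` in the null model, for a compatible `e`: the colours of its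
variables are drawn afresh from their priors. -/
def nullProb {n : ℕ} (e : M.Factor n) : ℝ :=
  ∑ c : Fin (M.arity e.1) → Fin q, (∏ k, M.prior (M.cls e.1 k) (c k)) * M.inclProb n e.1 c

/-- An outcome of the planted model: variable types, hidden colouring, set of observations. -/
abbrev Outcome (n : ℕ) : Type _ := (Fin n → T) × (Fin n → Fin q) × Finset (M.Factor n)

open Classical in
/-- The probability mass of an outcome in the planted model. -/
def mass {n : ℕ} (ω : M.Outcome n) : ℝ :=
  (∏ v, M.typeDist (ω.1 v)) * (∏ v, M.prior (ω.1 v) (ω.2.1 v)) *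
    ∏ e : M.Factor n,
      if e ∈ ω.2.2 then M.plantedProb ω.1 ω.2.1 e else 1 - M.plantedProb ω.1 ω.2.1 e

open Classical in
/-- The probability of an event in the planted model on `n` variables. -/
def plantedPr (n : ℕ) (A : Set (M.Outcome n)) : ℝ :=
  ∑ ω : M.Outcome n, if ω ∈ A then M.mass ω else 0

/-! ### The centred nonbacktracking power -/

/-- The sequences `v_0, …, v_s` and `e_0, …, e_{s-1}` form a nonbacktracking walk
`v_0 e_0 v_1 … e_{s-1} v_s` in the complete factor graph. -/
def IsNBWalk {n s : ℕ} (τ : Fin n → T) (v : Fin (s + 1) → Fin n) (e : Fin s → M.Factor n) :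
    Prop :=
  (∀ t : Fin s, M.Compatible τ (e t) ∧ v t.castSucc ∈ Set.range (e t).2 ∧
    v t.succ ∈ Set.range (e t).2 ∧ v t.castSucc ≠ v t.succ) ∧
  ∀ t t' : Fin s, (t' : ℕ) = t + 1 → e t ≠ e t'

/-- The matrix `Θ_{i, a ∣ b}` of the step `u → e → w`, where `i` is the type of `e`
and `a`, `b` are the positions of `u`, `w` in `e`. -/
def stepMat {n : ℕ} (e : M.Factor n) (u w : Fin n) : Matrix (Fin q) (Fin q) ℝ :=
  ∑ a, ∑ b, if e.2 a = u ∧ e.2 b = w then M.transMat e.1 a b else 0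

open Classical in
/-- The matrix weight of a walk. -/
def walkWeight {n s : ℕ} (G : Finset (M.Factor n)) (v : Fin (s + 1) → Fin n)
    (e : Fin s → M.Factor n) : Matrix (Fin q) (Fin q) ℝ :=
  (∏ t, ((if e t ∈ G then 1 else 0) - M.nullProb (e t))) •
    (List.ofFn fun t : Fin s => M.stepMat (e t) (v t.castSucc) (v t.succ)).prod

open Classical in
/-- The length-`s` centred nonbacktracking power `A^{(s)}`; its `(u, w)` block is the sum of
the weights of all length-`s` nonbacktracking walks from `u` to `w`. -/
def nbPower {n : ℕ} (s : ℕ) (τ : Fin n → T) (G : Finset (M.Factor n)) :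
    Matrix (Fin n × Fin q) (Fin n × Fin q) ℝ :=
  Matrix.of fun x y =>
    (∑ v : Fin (s + 1) → Fin n, ∑ e : Fin s → M.Factor n,
      if M.IsNBWalk τ v e ∧ v 0 = x.1 ∧ v (Fin.last s) = y.1 then M.walkWeight G v e
      else 0) x.2 y.2

/-- The inner product `⟨x, y⟩_H = xᵀ H_τ⁻¹ y` on `ℝ^{nq}`. -/
def hInner {n : ℕ} (τ : Fin n → T) (x y : Fin n × Fin q → ℝ) : ℝ :=
  ∑ p, x p * (M.hDiag (τ p.1) p.2)⁻¹ * y p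

/-- The colour-indicator vector of a colouring. -/
def colorVec {n : ℕ} (c : Fin n → Fin q) : Fin n × Fin q → ℝ :=
  fun p => if c p.1 = p.2 then 1 else 0

/-- The normalised quadratic form `⟨g, A^{(s)} g⟩_H / ‖g‖²` with `‖g‖² = ⟨g, g⟩_H`. -/
def localStat {n : ℕ} (s : ℕ) (ω : M.Outcome n) : ℝ :=
  M.hInner ω.1 (colorVec ω.2.1) (M.nbPower s ω.1 ω.2.2 *ᵥ colorVec ω.2.1) /
    M.hInner ω.1 (colorVec ω.2.1) (colorVec ω.2.1)

end ObservationModel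

end

/-! Self-adjointness. Detailed balance says that under the local law of an observation every
position has its prior as marginal. Hence `transMat i a b α β` times the prior of `β` is, up to the
factor `avgDens i`, the covariance of two colour indicators, which is symmetric under exchanging the
two positions (`hDiag_inv_mul_transMat`). Reversing every walk then gives the self-adjointness of
`nbPower`.

The operator `L`. The same symmetry makes `influence` symmetric for the positive definite form
`matForm`, so it is diagonalizable over the reals and `lamL` is the largest absolute value of an
eigenvalue. Moreover `L` has Kraus form, a nonnegative combination of maps `Y ↦ Θ Y Θ*`. This
complete positivity gives `|⟨X, L^s X⟩| ≤ C ⟨1, L^s 1⟩` with `C` independent of `s`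
(`abs_matForm_conj_pow_le`). With `J = suppOne`, the identity on labels of positive probability, and
`X` an extremal eigenvector, `⟨J, L^s J⟩` is at least a constant times `lamL ^ s`. The constants are
`γ_s = ⟨J, L^s J⟩ / (⟨J, J⟩ lamL ^ s)`; their even and odd limits are read off the spectral
decomposition, and positivity of the odd limit shows that `lamL` itself, not only its negative, is
an eigenvalue (`gam_properties`).

Mean. For a matrix `B`, attach to each variable the column of `B` at its type and colour, and let
`Q_s` be the quadratic form of `nbPower` at this vector (`quadStat`), a sum over walks. If every
factor of a walk meets the earlier variables only in the current one, the walk is a Markov chain of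
labels and its mean factorizes into one conjugation by a transition matrix per step
(`prodExp_goodWalk`). Summed over walks this yields `n ⟨B, L^s B⟩`, up to the relative error
`O(1/n)` per step of counting embeddings (`abs_meanSum_sub_le`). Any other nonbacktracking walk
contains a defect, a new factor that meets the seen variables a second time; each defect costs a
factor `1/n` (`goodWalk_of_not_defect`, `listSum_newWt_le`).

Variance. Walks on disjoint variable sets are uncorrelated (`plantedExp_walkTerm_mul`). For a
meeting pair, either the second walk starts on the first or it has a defect, so the variance is at
most `n` times a quantity of size `s^{O(s)}` (`variance_quadStat_le`). For `s ≤ log n / (log log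
n)²` such quantities are at most `√n` eventually (`FactorialGrowth.tendsto_div`), and Chebyshev's
inequality gives `Q_s = n ⟨B, L^s B⟩ + o(n lamL ^ s)` with high probability
(`tendsto_plantedPr_quadStat`).

Conclusions when `lamL > 0`. For `B = J` the test vector is the colour indicator `g`, and the
statistic is `Q_s / Q_0`. For `B` an eigenvector of `L` for `lamL`, the Rayleigh quotient `Q_s /
Q_0` is close to `lamL ^ s`, so the largest eigenvalue is at least `lamL ^ s / 2`, and `q ≥ 2`. When
`lamL = 0`, `L` vanishes, hence so do all transition matrices that can occur, and `nbPower` is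
almost surely `0` for `s ≥ 1` and the identity for `s = 0`. -/

noncomputable section

/-! ### Symmetric operators for a positive definite form -/

section SymmetricForm

variable {V : Type*} [AddCommGroup V] [Module ℝ V]

/-- Spectral theorem for an operator that is symmetric for a positive definite bilinear form. -/
theorem exists_orthonormal_eigenbasis [FiniteDimensional ℝ V] (φ : V →ₗ[ℝ] V →ₗ[ℝ] ℝ)
    (hs : ∀ x y, φ x y = φ y x) (hp : ∀ x, x ≠ 0 → 0 < φ x x) (A : V →ₗ[ℝ] V)
    (hA : ∀ x y, φ (A x) y = φ x (A y)) :
    ∃ (b : Module.Basis (Fin (Module.finrank ℝ V)) ℝ V) (μ : Fin (Module.finrank ℝ V) → ℝ),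
      (∀ j, A (b j) = μ j • b j) ∧ ∀ j k, φ (b j) (b k) = if j = k then 1 else 0 := by
  let core : InnerProductSpace.Core ℝ V :=
    { inner := fun x y => φ x y
      conj_inner_symm := fun x y => by simpa using hs y x
      re_inner_nonneg := fun x => by
        by_cases h : x = 0
        · simp [h]
        · simpa using (hp x h).le
      add_left := fun x y z => by simp
      smul_left := fun x y r => by simp
      definite := fun x hx => by
        by_contra h
        exact (hp x h).ne' hx }
  let _ : NormedAddCommGroup V := @InnerProductSpace.Core.toNormedAddCommGroup ℝ V _ _ _ core
  let _ : InnerProductSpace ℝ V := InnerProductSpace.ofCore core.toCore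
  have hi : ∀ x y : V, inner ℝ x y = φ x y := fun x y => rfl
  have hT : A.IsSymmetric := fun x y => by rw [hi, hi]; exact hA x y
  refine ⟨(hT.eigenvectorBasis rfl).toBasis, hT.eigenvalues rfl, fun j => ?_, fun j k => ?_⟩
  · simp [hT.apply_eigenvectorBasis rfl j]
  · rw [← hi]
    simpa using orthonormal_iff_ite.1 (hT.eigenvectorBasis rfl).orthonormal j k

variable {κ : Type*} {φ : V →ₗ[ℝ] V →ₗ[ℝ] ℝ} {A : V →ₗ[ℝ] V}
  {b : Module.Basis κ ℝ V} {μ : κ → ℝ}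

theorem pow_apply_eigenbasis (hb : ∀ j, A (b j) = μ j • b j) (s : ℕ) (j : κ) :
    (A ^ s) (b j) = μ j ^ s • b j := by
  induction s with
  | zero => simp
  | succ s ih => rw [pow_succ', Module.End.mul_apply, ih, map_smul, hb, smul_smul, pow_succ]

theorem form_pow_eq_sum [Fintype κ] [DecidableEq κ] (hb : ∀ j, A (b j) = μ j • b j)
    (ho : ∀ j k, φ (b j) (b k) = if j = k then 1 else 0) (s : ℕ) (x : V) :
    φ x ((A ^ s) x) = ∑ j, b.repr x j ^ 2 * μ j ^ s := by
  conv_lhs => rw [← b.sum_repr x]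
  simp only [map_sum, map_smul, LinearMap.sum_apply, LinearMap.smul_apply, smul_eq_mul,
    pow_apply_eigenbasis hb, ho]
  refine Finset.sum_congr rfl fun j _ => ?_
  simp
  ring

theorem exists_eigenvalue_ge [Fintype κ] [DecidableEq κ] [Nonempty κ] (hb : ∀ j, A (b j) = μ j • b j)
    (ho : ∀ j k, φ (b j) (b k) = if j = k then 1 else 0) :
    ∃ Λ, IsGreatest {r : ℝ | Module.End.HasEigenvalue A r} Λ ∧ ∀ x, φ x (A x) ≤ Λ * φ x x := by
  obtain ⟨j, -, hj⟩ := Finset.exists_max_image Finset.univ μ Finset.univ_nonempty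
  have hrep : ∀ r, Module.End.HasEigenvalue A r → ∃ k, r = μ k := by
    intro r hr
    obtain ⟨x, hx⟩ := hr.exists_hasEigenvector
    have hne : b.repr x ≠ 0 := by simpa using hx.2
    obtain ⟨k, hk⟩ := Finsupp.ne_iff.1 hne
    refine ⟨k, ?_⟩
    have h1 : b.repr (A x) k = r * b.repr x k := by rw [hx.apply_eq_smul]; simp
    have h2 : b.repr (A x) k = μ k * b.repr x k := by
      conv_lhs => rw [← b.sum_repr x]
      simp only [map_sum, map_smul, hb, Module.Basis.repr_self, Finsupp.coe_finsetSum,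
        Finset.sum_apply, Finsupp.smul_apply, Finsupp.single_apply, smul_eq_mul, mul_ite, mul_one,
        mul_zero, Finset.sum_ite_eq', Finset.mem_univ, if_true]
      ring
    exact mul_right_cancel₀ (by simpa using hk) (h1.symm.trans h2)
  refine ⟨μ j, ⟨?_, ?_⟩, fun x => ?_⟩
  · exact Module.End.hasEigenvalue_of_hasEigenvector
      ⟨Module.End.mem_eigenspace_iff.2 (hb j), b.ne_zero j⟩
  · rintro r hr
    obtain ⟨k, rfl⟩ := hrep r hr
    exact hj k (Finset.mem_univ _)
  · have h1 := form_pow_eq_sum hb ho 1 x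
    have h0 := form_pow_eq_sum hb ho 0 x
    simp only [pow_one, pow_zero, Module.End.one_apply, mul_one] at h1 h0
    rw [h1, h0, Finset.mul_sum]
    refine Finset.sum_le_sum fun k _ => ?_
    rw [mul_comm]
    exact mul_le_mul_of_nonneg_right (hj k (Finset.mem_univ _)) (sq_nonneg _)

/-- The complex spectrum of a diagonalizable real operator. -/
theorem spectrum_baseChange_eq [Fintype κ] (hb : ∀ j, A (b j) = μ j • b j) :
    spectrum ℂ (LinearMap.baseChange ℂ A : Module.End ℂ (TensorProduct ℝ ℂ V)) =
      Set.range fun j => (μ j : ℂ) := by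
  classical
  set B := b.baseChange ℂ
  have hB : ∀ j, LinearMap.baseChange ℂ A (B j) = (μ j : ℂ) • B j := by
    intro j
    simp only [B, Module.Basis.baseChange_apply, LinearMap.baseChange_tmul, hb,
      TensorProduct.tmul_smul]
    rw [← algebraMap_smul ℂ (μ j)]; rfl
  ext z
  have : FiniteDimensional ℂ (TensorProduct ℝ ℂ V) := Module.Finite.of_basis B
  rw [← Module.End.hasEigenvalue_iff_mem_spectrum]
  constructor
  · intro hr
    obtain ⟨x, hx⟩ := hr.exists_hasEigenvector
    have hne : B.repr x ≠ 0 := by simpa using hx.2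
    obtain ⟨k, hk⟩ := Finsupp.ne_iff.1 hne
    refine ⟨k, ?_⟩
    have h1 : B.repr (LinearMap.baseChange ℂ A x) k = z * B.repr x k := by
      rw [hx.apply_eq_smul]; simp
    have h2 : B.repr (LinearMap.baseChange ℂ A x) k = μ k * B.repr x k := by
      conv_lhs => rw [← B.sum_repr x]
      simp only [map_sum, map_smul, hB, Module.Basis.repr_self, Finsupp.coe_finsetSum,
        Finset.sum_apply, Finsupp.smul_apply, Finsupp.single_apply, smul_eq_mul, mul_ite, mul_one,
        mul_zero, Finset.sum_ite_eq', Finset.mem_univ, if_true]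
      ring
    exact (mul_right_cancel₀ (by simpa using hk) (h2.symm.trans h1))
  · rintro ⟨j, rfl⟩
    exact Module.End.hasEigenvalue_of_hasEigenvector
      ⟨Module.End.mem_eigenspace_iff.2 (hB j), B.ne_zero j⟩

/-- This turns `lamL`, defined over the complex numbers, into the maximum of the absolute values of
the real eigenvalues. -/
theorem spectralRadius_baseChange [Fintype κ] [Nonempty κ] (hb : ∀ j, A (b j) = μ j • b j) :
    (∀ j, |μ j| ≤ (spectralRadius ℂ
      (LinearMap.baseChange ℂ A : Module.End ℂ (TensorProduct ℝ ℂ V))).toReal) ∧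
    ∃ j, |μ j| = (spectralRadius ℂ
      (LinearMap.baseChange ℂ A : Module.End ℂ (TensorProduct ℝ ℂ V))).toReal := by
  obtain ⟨j, -, hj⟩ := Finset.exists_max_image Finset.univ (fun j => |μ j|) Finset.univ_nonempty
  have h : spectralRadius ℂ (LinearMap.baseChange ℂ A : Module.End ℂ (TensorProduct ℝ ℂ V)) =
      ENNReal.ofReal |μ j| := by
    rw [spectralRadius, spectrum_baseChange_eq hb]
    apply le_antisymm
    · refine iSup₂_le ?_
      rintro _ ⟨k, rfl⟩
      rw [← ENNReal.ofReal_coe_nnreal]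
      apply ENNReal.ofReal_le_ofReal
      simpa using hj k (Finset.mem_univ _)
    · refine le_trans (le_of_eq ?_) (le_iSup₂ (μ j : ℂ) ⟨j, rfl⟩)
      rw [← ENNReal.ofReal_coe_nnreal]
      simp
  rw [h, ENNReal.toReal_ofReal (abs_nonneg _)]
  exact ⟨fun k => hj k (Finset.mem_univ _), j, rfl⟩

/-- Convergence of the normalised moments along even and odd powers. -/
theorem tendsto_sum_mul_pow {κ : Type*} [Fintype κ] (a μ : κ → ℝ) (l : ℝ) (hl : 0 < l)
    (hμ : ∀ j, |μ j| ≤ l) :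
    Tendsto (fun k : ℕ => ∑ j, a j * (μ j / l) ^ (2 * k)) atTop
      (𝓝 (∑ j, a j * ((if μ j = l then 1 else 0) + if μ j = -l then 1 else 0))) ∧
    Tendsto (fun k : ℕ => ∑ j, a j * (μ j / l) ^ (2 * k + 1)) atTop
      (𝓝 (∑ j, a j * ((if μ j = l then 1 else 0) - if μ j = -l then 1 else 0))) := by
  have h2 : Tendsto (fun k : ℕ => 2 * k) atTop atTop :=
    tendsto_atTop_mono (fun k => by simp only [id]; omega) tendsto_id
  have h3 : Tendsto (fun k : ℕ => 2 * k + 1) atTop atTop :=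
    tendsto_atTop_mono (fun k => by simp only [id]; omega) tendsto_id
  -- Only the eigenvalues `±l` survive normalisation; all other ratios have absolute value below
  -- one.
  have hs : ∀ j, μ j ≠ l → μ j ≠ -l → Tendsto (fun k : ℕ => (μ j / l) ^ k) atTop (𝓝 0) := by
    intro j h1 h2
    apply tendsto_pow_atTop_nhds_zero_of_abs_lt_one
    rw [abs_div, abs_of_pos hl, div_lt_one hl]
    refine lt_of_le_of_ne (hμ j) fun h => ?_
    rcases abs_choice (μ j) with h' | h' <;> rw [h'] at h
    · exact h1 h
    · exact h2 (by linarith)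
  constructor <;> refine tendsto_finsetSum _ fun j _ => Tendsto.const_mul _ ?_
  · by_cases h1 : μ j = l
    · have : ¬ l = -l := by intro h; linarith
      simp [h1, hl.ne', this]
    · by_cases h1' : μ j = -l
      · have : ¬ -l = l := by intro h; linarith
        simp [h1', hl.ne', this, pow_mul]
      · simpa [h1, h1', Function.comp_def] using (hs j h1 h1').comp h2
  · by_cases h1 : μ j = l
    · have : ¬ l = -l := by intro h; linarith
      simp [h1, hl.ne', this]
    · by_cases h1' : μ j = -l
      · have : ¬ -l = l := by intro h; linarith
        simp [h1', hl.ne', this, pow_mul, pow_succ]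
      · simpa [h1, h1', Function.comp_def] using (hs j h1 h1').comp h3

end SymmetricForm

/-! ### Sums over functions against a product weight -/

section ProductWeight

variable {ι α : Type*} [Fintype ι] [DecidableEq ι] [Fintype α]

theorem sum_prod_mul_apply (π : ι → α → ℝ) (hπ : ∀ i, ∑ x, π i x = 1) (a : ι) (f : α → ℝ) :
    ∑ σ : ι → α, (∏ i, π i (σ i)) * f (σ a) = ∑ x, π a x * f x := by
  have h : ∀ σ : ι → α, (∏ i, π i (σ i)) * f (σ a) =
      ∏ i, π i (σ i) * if i = a then f (σ i) else 1 := fun σ => by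
    rw [Finset.prod_mul_distrib]; simp
  simp_rw [h]
  rw [← Fintype.prod_sum (fun i x => π i x * if i = a then f x else 1),
    Finset.prod_eq_single a]
  · simp
  · intro i _ hi
    simp [hi, hπ]
  · simp

theorem sum_prod_mul_apply₂ (π : ι → α → ℝ) (hπ : ∀ i, ∑ x, π i x = 1) {a b : ι} (hab : a ≠ b)
    (f g : α → ℝ) :
    ∑ σ : ι → α, (∏ i, π i (σ i)) * (f (σ a) * g (σ b)) =
      (∑ x, π a x * f x) * ∑ x, π b x * g x := by
  have h : ∀ σ : ι → α, (∏ i, π i (σ i)) * (f (σ a) * g (σ b)) =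
      ∏ i, π i (σ i) * ((if i = a then f (σ i) else 1) * if i = b then g (σ i) else 1) :=
    fun σ => by rw [Finset.prod_mul_distrib, Finset.prod_mul_distrib]; simp
  simp_rw [h]
  rw [← Fintype.prod_sum
    (fun i x => π i x * ((if i = a then f x else 1) * if i = b then g x else 1)),
    ← Finset.mul_prod_erase _ _ (Finset.mem_univ a),
    ← Finset.mul_prod_erase _ _ (Finset.mem_erase.2 ⟨hab.symm, Finset.mem_univ b⟩),
    Finset.prod_eq_one, mul_one]
  · simp [hab, hab.symm]
  · intro i hi
    simp only [Finset.mem_erase] at hi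
    simp [hi.1, hi.2.1, hπ]

end ProductWeight

namespace ObservationModel

variable {q : ℕ} {T : Type*} [Fintype T] {F : ℕ} (M : ObservationModel q T F)

/-! ### The centred transition matrices -/

theorem hDiag_pos (t : T) (c : Fin q) : 0 < M.hDiag t c := by
  unfold hDiag
  split_ifs with h
  · exact h
  · exact one_pos

theorem avgDens_nonneg (i : Fin F) : 0 ≤ M.avgDens i :=
  Finset.sum_nonneg fun _ _ =>
    mul_nonneg (Finset.prod_nonneg fun _ _ => M.prior_nonneg _ _) (M.dens_nonneg _ _)

/-- The mass that the density of type `i` gives to a pair of colours at two positions. -/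
def pairMass (i : Fin F) (a b : Fin (M.arity i)) (α β : Fin q) : ℝ :=
  ∑ c : Fin (M.arity i) → Fin q,
    if c a = α ∧ c b = β then (∏ k, M.prior (M.cls i k) (c k)) * M.dens i c else 0

theorem pairMass_comm (i : Fin F) (a b : Fin (M.arity i)) (α β : Fin q) :
    M.pairMass i a b α β = M.pairMass i b a β α := by
  simp only [pairMass, and_comm]

theorem pairMass_nonneg (i : Fin F) (a b : Fin (M.arity i)) (α β : Fin q) :
    0 ≤ M.pairMass i a b α β :=
  Finset.sum_nonneg fun c _ => by
    split_ifs
    · exact mul_nonneg (Finset.prod_nonneg fun _ _ => M.prior_nonneg _ _) (M.dens_nonneg _ _)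
    · exact le_rfl

/-- The one place where the definition of detailed balance is used; everything later rests on this
marginal. Colours of prior zero, which the hypothesis does not cover, contribute zero on both sides.
-/
theorem sum_marginal {M : ObservationModel q T F} (hM : M.DetailedBalance) (i : Fin F)
    (b : Fin (M.arity i)) (β : Fin q) :
    (∑ c : Fin (M.arity i) → Fin q,
      if c b = β then (∏ k, M.prior (M.cls i k) (c k)) * M.dens i c else 0) =
      M.prior (M.cls i b) β * M.avgDens i := by
  have h : ∀ c : Fin (M.arity i) → Fin q,
      (if c b = β then (∏ k, M.prior (M.cls i k) (c k)) * M.dens i c else 0) =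
      M.prior (M.cls i b) β * (if c b = β then
        (∏ k ∈ Finset.univ.erase b, M.prior (M.cls i k) (c k)) * M.dens i c else 0) := by
    intro c
    split_ifs with hc
    · rw [← Finset.mul_prod_erase _ _ (Finset.mem_univ b), hc, mul_assoc]
    · simp
  simp_rw [h]
  rw [← Finset.mul_sum]
  rcases (M.prior_nonneg (M.cls i b) β).eq_or_lt with h0 | h0
  · simp [← h0]
  · rw [hM i b β h0]

theorem sum_pairMass {M : ObservationModel q T F} (hM : M.DetailedBalance) (i : Fin F)
    (a b : Fin (M.arity i)) (β : Fin q) :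
    ∑ α, M.pairMass i a b α β = M.prior (M.cls i b) β * M.avgDens i := by
  rw [← sum_marginal hM]
  simp only [pairMass]
  rw [Finset.sum_comm]
  refine Finset.sum_congr rfl fun c _ => ?_
  simp [ite_and]

theorem pairMass_eq_zero {M : ObservationModel q T F} (hM : M.DetailedBalance) (i : Fin F)
    (a b : Fin (M.arity i)) (α β : Fin q)
    (h : M.prior (M.cls i b) β * M.avgDens i = 0) : M.pairMass i a b α β = 0 := by
  rw [← sum_pairMass hM i a b β] at h
  exact (Finset.sum_eq_zero_iff_of_nonneg fun α _ => M.pairMass_nonneg i a b α β).1 h α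
    (Finset.mem_univ _)

theorem condMat_apply {M : ObservationModel q T F} (hM : M.DetailedBalance) (i : Fin F)
    (a b : Fin (M.arity i)) (α β : Fin q) :
    M.condMat i a b α β =
      M.pairMass i a b α β / (M.prior (M.cls i b) β * M.avgDens i) := by
  have h1 : (∑ c : Fin (M.arity i) → Fin q,
      if c a = α ∧ c b = β then M.localDist i c else 0) =
      M.pairMass i a b α β / M.avgDens i := by
    simp only [pairMass, localDist, Finset.sum_div]
    exact Finset.sum_congr rfl fun c _ => by split_ifs <;> simp
  have h2 : (∑ c : Fin (M.arity i) → Fin q, if c b = β then M.localDist i c else 0) =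
      M.prior (M.cls i b) β * M.avgDens i / M.avgDens i := by
    rw [← sum_marginal hM]
    simp only [localDist, Finset.sum_div]
    exact Finset.sum_congr rfl fun c _ => by split_ifs <;> simp
  rw [condMat, Matrix.of_apply, h1, h2]
  by_cases h : M.avgDens i = 0
  · simp [h]
  · rw [div_div_div_cancel_right₀ h]

theorem transMat_apply {M : ObservationModel q T F} (hM : M.DetailedBalance) (i : Fin F)
    (a b : Fin (M.arity i)) (α β : Fin q) :
    M.transMat i a b α β = (M.pairMass i a b α β -
      M.avgDens i * M.prior (M.cls i a) α * M.prior (M.cls i b) β) /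
        (M.prior (M.cls i b) β * M.avgDens i) := by
  have h : M.transMat i a b α β =
      M.condMat i a b α β - M.prior (M.cls i a) α * ∑ γ, M.condMat i a b γ β := by
    rw [transMat, Matrix.sub_mul, Matrix.one_mul]
    simp [Matrix.mul_apply, Matrix.vecMulVec, Finset.mul_sum]
  rw [h, sub_div]
  simp only [condMat_apply hM, ← Finset.sum_div, sum_pairMass hM]
  rw [← mul_div_assoc]
  congr 2
  ring

/-- The division-free form: the right side is `avgDens i` times the covariance of two colour
indicators under the local law. When the denominator of `transMat` vanishes, so do both terms on the
right. -/
theorem transMat_mul_prior {M : ObservationModel q T F} (hM : M.DetailedBalance) (i : Fin F)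
    (a b : Fin (M.arity i)) (α β : Fin q) :
    M.avgDens i * (M.transMat i a b α β * M.prior (M.cls i b) β) = M.pairMass i a b α β -
      M.avgDens i * M.prior (M.cls i a) α * M.prior (M.cls i b) β := by
  rw [transMat_apply hM]
  by_cases h : M.prior (M.cls i b) β * M.avgDens i = 0
  · rw [pairMass_eq_zero hM _ _ _ _ _ h]
    rw [h, div_zero]
    linear_combination (M.prior (M.cls i a) α) * h
  · field_simp [left_ne_zero_of_mul h, right_ne_zero_of_mul h]

theorem transMat_eq_zero_right {M : ObservationModel q T F} (hM : M.DetailedBalance) {i : Fin F}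
    {a b : Fin (M.arity i)} {α β : Fin q} (h : M.prior (M.cls i b) β = 0) :
    M.transMat i a b α β = 0 := by
  rw [transMat_apply hM, h]; simp

theorem transMat_eq_zero_left {M : ObservationModel q T F} (hM : M.DetailedBalance) {i : Fin F}
    {a b : Fin (M.arity i)} {α β : Fin q} (h : M.prior (M.cls i a) α = 0) :
    M.transMat i a b α β = 0 := by
  rw [transMat_apply hM, pairMass_comm, pairMass_eq_zero hM _ _ _ _ _ (by rw [h, zero_mul]), h]
  simp

theorem transMat_eq_zero_of_avgDens {M : ObservationModel q T F} (hM : M.DetailedBalance)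
    {i : Fin F} (h : M.avgDens i = 0) (a b : Fin (M.arity i)) : M.transMat i a b = 0 := by
  ext α β
  rw [transMat_apply hM, h]; simp

/-- On the support both sides are the covariance divided by both priors, an expression symmetric in
the two positions; off the support both transition entries vanish. All self-adjointness in the file
comes from here. -/
theorem hDiag_inv_mul_transMat {M : ObservationModel q T F} (hM : M.DetailedBalance) (i : Fin F)
    (a b : Fin (M.arity i)) (α β : Fin q) :
    (M.hDiag (M.cls i a) α)⁻¹ * M.transMat i a b α β =
      (M.hDiag (M.cls i b) β)⁻¹ * M.transMat i b a β α := by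
  rcases (M.prior_nonneg (M.cls i a) α).eq_or_lt with ha | ha
  · rw [transMat_eq_zero_left hM ha.symm, transMat_eq_zero_right hM ha.symm]; simp
  rcases (M.prior_nonneg (M.cls i b) β).eq_or_lt with hb | hb
  · rw [transMat_eq_zero_left hM hb.symm, transMat_eq_zero_right hM hb.symm]; simp
  rw [transMat_apply hM, transMat_apply hM, pairMass_comm, hDiag, if_pos ha, hDiag, if_pos hb]
  field_simp

theorem transMatAdj_apply (i : Fin F) (a b : Fin (M.arity i)) (α β : Fin q) :
    M.transMatAdj i a b β α =
      M.hDiag (M.cls i b) β * M.transMat i a b α β * (M.hDiag (M.cls i a) α)⁻¹ := by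
  simp [transMatAdj, Matrix.mul_diagonal, Matrix.diagonal_mul]

/-! ### Self-adjointness of the nonbacktracking powers -/

theorem hDiag_inv_mul_stepMat {M : ObservationModel q T F} (hM : M.DetailedBalance) {n : ℕ}
    {τ : Fin n → T} {e : M.Factor n} (he : M.Compatible τ e) (u w : Fin n) (α β : Fin q) :
    (M.hDiag (τ u) α)⁻¹ * M.stepMat e u w α β =
      (M.hDiag (τ w) β)⁻¹ * M.stepMat e w u β α := by
  simp only [stepMat, Matrix.sum_apply, Finset.mul_sum]
  rw [Finset.sum_comm]
  refine Finset.sum_congr rfl fun b _ => Finset.sum_congr rfl fun a _ => ?_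
  by_cases h : e.2 a = u ∧ e.2 b = w
  · rw [if_pos h, if_pos h.symm, ← h.1, ← h.2, he a, he b]
    exact hDiag_inv_mul_transMat hM _ _ _ _ _
  · rw [if_neg h, if_neg (fun h' => h h'.symm)]
    simp

/-- The product of matrices that are adjoint to each other, in the reverse order. -/
theorem hDiag_inv_mul_prod {M : ObservationModel q T F} {n : ℕ} (τ : Fin n → T) :
    ∀ (s : ℕ) (v : Fin (s + 1) → Fin n) (A B : Fin s → Matrix (Fin q) (Fin q) ℝ),
      (∀ t α β, (M.hDiag (τ (v t.castSucc)) α)⁻¹ * A t α β =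
        (M.hDiag (τ (v t.succ)) β)⁻¹ * B t β α) →
      ∀ α β, (M.hDiag (τ (v 0)) α)⁻¹ * (List.ofFn A).prod α β =
        (M.hDiag (τ (v (Fin.last s))) β)⁻¹ * (List.ofFn fun t => B t.rev).prod β α := by
  intro s
  induction s with
  | zero =>
    intro v A B _ α β
    simp only [List.ofFn_zero, List.prod_nil, Matrix.one_apply]
    by_cases h : α = β
    · simp [h]
    · simp [h, Ne.symm h]
  | succ s ih =>
    intro v A B h α β
    -- Reversal sends the first factor to the end, so the head of one product is matched with the
    -- tail of the other.
    have h2 : (List.ofFn fun t : Fin (s + 1) => B t.rev).prod =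
        (List.ofFn fun t : Fin s => (fun t => B t.succ) t.rev).prod * B 0 := by
      rw [List.ofFn_succ', List.concat_eq_append, List.prod_append]
      simp [Fin.rev_castSucc, Fin.rev_last]
    rw [h2, List.ofFn_succ, List.prod_cons, Matrix.mul_apply, Matrix.mul_apply, Finset.mul_sum,
      Finset.mul_sum]
    refine Finset.sum_congr rfl fun γ _ => ?_
    have h3 := ih (fun t => v t.succ) (fun t => A t.succ) (fun t => B t.succ)
      (fun t α β => by simpa using h t.succ α β) γ β
    have h4 := h 0 α γ
    simp only [Fin.castSucc_zero, Fin.succ_zero_eq_one, Fin.succ_last] at h3 h4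
    rw [← mul_assoc, h4]
    linear_combination (B 0 γ α) * h3

theorem IsNBWalk.rev {M : ObservationModel q T F} {n s : ℕ} {τ : Fin n → T}
    {v : Fin (s + 1) → Fin n} {e : Fin s → M.Factor n} (h : M.IsNBWalk τ v e) :
    M.IsNBWalk τ (v ∘ Fin.rev) (e ∘ Fin.rev) := by
  refine ⟨fun t => ?_, fun t t' htt' => ?_⟩
  · obtain ⟨h1, h2, h3, h4⟩ := h.1 t.rev
    simp only [Function.comp_apply, Fin.rev_castSucc, Fin.rev_succ]
    exact ⟨h1, h3, h2, h4.symm⟩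
  · refine (h.2 t'.rev t.rev ?_).symm
    simp only [Fin.val_rev]
    omega

theorem isNBWalk_rev_iff {M : ObservationModel q T F} {n s : ℕ} {τ : Fin n → T}
    {v : Fin (s + 1) → Fin n} {e : Fin s → M.Factor n} :
    M.IsNBWalk τ (v ∘ Fin.rev) (e ∘ Fin.rev) ↔ M.IsNBWalk τ v e := by
  refine ⟨fun h => ?_, IsNBWalk.rev⟩
  have := h.rev
  simpa [Function.comp_assoc, Function.comp_def] using this

theorem walkWeight_rev {M : ObservationModel q T F} (hM : M.DetailedBalance) {n s : ℕ}
    {τ : Fin n → T} (G : Finset (M.Factor n))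
    {v : Fin (s + 1) → Fin n} {e : Fin s → M.Factor n} (h : M.IsNBWalk τ v e) (α β : Fin q) :
    (M.hDiag (τ (v 0)) α)⁻¹ * M.walkWeight G v e α β =
      (M.hDiag (τ (v (Fin.last s))) β)⁻¹ *
        M.walkWeight G (v ∘ Fin.rev) (e ∘ Fin.rev) β α := by
  classical
  have h1 := hDiag_inv_mul_prod (M := M) τ s v
    (fun t => M.stepMat (e t) (v t.castSucc) (v t.succ))
    (fun t => M.stepMat (e t) (v t.succ) (v t.castSucc))
    (fun t α β => hDiag_inv_mul_stepMat hM (h.1 t).1 _ _ _ _) α β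
  have h2 : ∏ t, ((if e t ∈ G then (1 : ℝ) else 0) - M.nullProb (e t)) =
      ∏ t : Fin s, ((if (e ∘ Fin.rev) t ∈ G then (1 : ℝ) else 0) -
        M.nullProb ((e ∘ Fin.rev) t)) :=
    (Equiv.prod_comp Fin.revPerm
      fun t => ((if e t ∈ G then (1 : ℝ) else 0) - M.nullProb (e t))).symm
  simp only [walkWeight, Matrix.smul_apply, smul_eq_mul, ← h2]
  simp only [Function.comp_apply, Fin.rev_castSucc, Fin.rev_succ]
  linear_combination
    (∏ t, ((if e t ∈ G then (1 : ℝ) else 0) - M.nullProb (e t))) * h1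

/-- Reversal is an involution on nonbacktracking walks that exchanges the endpoints and replaces
each step matrix by its adjoint, while the edge factors do not see the direction. -/
theorem hDiag_inv_mul_nbPower {M : ObservationModel q T F} (hM : M.DetailedBalance) {n s : ℕ}
    (τ : Fin n → T) (G : Finset (M.Factor n)) (x y : Fin n × Fin q) :
    (M.hDiag (τ x.1) x.2)⁻¹ * M.nbPower s τ G x y =
      (M.hDiag (τ y.1) y.2)⁻¹ * M.nbPower s τ G y x := by
  classical
  simp only [nbPower, Matrix.of_apply, Matrix.sum_apply, Finset.mul_sum]
  rw [← Equiv.sum_comp (Equiv.arrowCongr (Fin.revPerm (n := s + 1)) (Equiv.refl (Fin n)))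
    (fun v => ∑ e : Fin s → M.Factor n, (M.hDiag (τ y.1) y.2)⁻¹ *
      (if M.IsNBWalk τ v e ∧ v 0 = y.1 ∧ v (Fin.last s) = x.1 then M.walkWeight G v e
        else 0) y.2 x.2)]
  refine Finset.sum_congr rfl fun v _ => ?_
  rw [← Equiv.sum_comp (Equiv.arrowCongr (Fin.revPerm (n := s)) (Equiv.refl (M.Factor n)))
    (fun e => (M.hDiag (τ y.1) y.2)⁻¹ *
      (if M.IsNBWalk τ _ e ∧ _ = y.1 ∧ _ = x.1 then M.walkWeight G _ e else 0) y.2 x.2)]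
  refine Finset.sum_congr rfl fun e _ => ?_
  have e1 : (Equiv.arrowCongr (Fin.revPerm (n := s + 1)) (Equiv.refl (Fin n))) v = v ∘ Fin.rev :=
    rfl
  have e2 : (Equiv.arrowCongr (Fin.revPerm (n := s)) (Equiv.refl (M.Factor n))) e = e ∘ Fin.rev :=
    rfl
  rw [e1, e2, isNBWalk_rev_iff]
  simp only [Function.comp_apply, Fin.rev_zero, Fin.rev_last]
  by_cases h : M.IsNBWalk τ v e ∧ v 0 = x.1 ∧ v (Fin.last s) = y.1
  · rw [if_pos h, if_pos ⟨h.1, h.2.2, h.2.1⟩, ← h.2.1, ← h.2.2]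
    exact walkWeight_rev hM G h.1 _ _
  · rw [if_neg h, if_neg fun h' => h ⟨h'.1, h'.2.2, h'.2.1⟩]
    simp

theorem hInner_nbPower_mulVec {M : ObservationModel q T F} (hM : M.DetailedBalance) {n s : ℕ}
    (τ : Fin n → T) (G : Finset (M.Factor n)) (x y : Fin n × Fin q → ℝ) :
    M.hInner τ x (M.nbPower s τ G *ᵥ y) = M.hInner τ (M.nbPower s τ G *ᵥ x) y := by
  simp only [hInner, Matrix.mulVec, dotProduct, Finset.mul_sum, Finset.sum_mul]
  rw [Finset.sum_comm]
  refine Finset.sum_congr rfl fun p _ => Finset.sum_congr rfl fun r _ => ?_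
  linear_combination (x r * y p) * hDiag_inv_mul_nbPower hM τ G r p

end ObservationModel

namespace ObservationModel

variable {q : ℕ} {T : Type*} [Fintype T] {F : ℕ} (M : ObservationModel q T F)

/-! ### The influence operator as a symmetric operator -/

/-- The mass of a type, replaced by `1` if it vanishes. -/
def typeWt (t : T) : ℝ := if 0 < M.typeDist t then M.typeDist t else 1

theorem typeWt_pos (t : T) : 0 < M.typeWt t := by
  unfold typeWt
  split_ifs with h
  · exact h
  · exact one_pos

/-- The positive definite form for which the influence operator is symmetric. -/
def matForm : Matrix (T × Fin q) (T × Fin q) ℝ →ₗ[ℝ]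
    Matrix (T × Fin q) (T × Fin q) ℝ →ₗ[ℝ] ℝ :=
  LinearMap.mk₂ ℝ
    (fun X Y => ∑ x, ∑ y, M.typeWt x.1 * (M.hDiag y.1 y.2 / M.hDiag x.1 x.2) * X x y * Y x y)
    (fun X X' Y => by
      simp only [Matrix.add_apply, mul_add, add_mul, Finset.sum_add_distrib])
    (fun r X Y => by
      simp only [Matrix.smul_apply, smul_eq_mul, Finset.mul_sum]
      exact Finset.sum_congr rfl fun x _ => Finset.sum_congr rfl fun y _ => by ring)
    (fun X Y Y' => by
      simp only [Matrix.add_apply, mul_add, Finset.sum_add_distrib])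
    (fun r X Y => by
      simp only [Matrix.smul_apply, smul_eq_mul, Finset.mul_sum]
      exact Finset.sum_congr rfl fun x _ => Finset.sum_congr rfl fun y _ => by ring)

/-- The form is the Hilbert–Schmidt product belonging to the inner product of `H`, weighted by the
mass of the row type. That weight compensates the division by the type mass in `meanDegree`. -/
theorem matForm_apply (X Y : Matrix (T × Fin q) (T × Fin q) ℝ) :
    M.matForm X Y = ∑ x, ∑ y,
      M.typeWt x.1 * (M.hDiag y.1 y.2 / M.hDiag x.1 x.2) * X x y * Y x y := rfl

theorem matForm_weight_pos (x y : T × Fin q) :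
    0 < M.typeWt x.1 * (M.hDiag y.1 y.2 / M.hDiag x.1 x.2) :=
  mul_pos (M.typeWt_pos _) (div_pos (M.hDiag_pos _ _) (M.hDiag_pos _ _))

theorem matForm_comm (X Y : Matrix (T × Fin q) (T × Fin q) ℝ) :
    M.matForm X Y = M.matForm Y X := by
  simp only [matForm_apply]
  exact Finset.sum_congr rfl fun x _ => Finset.sum_congr rfl fun y _ => by ring

theorem matForm_self_pos (X : Matrix (T × Fin q) (T × Fin q) ℝ) (hX : X ≠ 0) :
    0 < M.matForm X X := by
  have hnn : ∀ x y, 0 ≤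
      M.typeWt x.1 * (M.hDiag y.1 y.2 / M.hDiag x.1 x.2) * X x y * X x y := fun x y => by
    rw [mul_assoc]
    exact mul_nonneg (M.matForm_weight_pos x y).le (mul_self_nonneg _)
  obtain ⟨x, y, hxy⟩ : ∃ x y, X x y ≠ 0 := by
    by_contra! h
    exact hX (Matrix.ext h)
  rw [matForm_apply]
  refine Finset.sum_pos' (fun x _ => Finset.sum_nonneg fun y _ => hnn x y)
    ⟨x, Finset.mem_univ _, Finset.sum_pos' (fun y _ => hnn x y) ⟨y, Finset.mem_univ _, ?_⟩⟩
  rw [mul_assoc]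
  exact mul_pos (M.matForm_weight_pos x y) (mul_self_pos.2 hxy)

/-- The adjoint for the inner product of `H`. -/
def blockAdj (A : Matrix (T × Fin q) (T × Fin q) ℝ) : Matrix (T × Fin q) (T × Fin q) ℝ :=
  Matrix.of fun x y => M.hDiag x.1 x.2 * A y x / M.hDiag y.1 y.2

theorem blockAdj_mul (A B : Matrix (T × Fin q) (T × Fin q) ℝ) :
    M.blockAdj (A * B) = M.blockAdj B * M.blockAdj A := by
  ext x y
  simp only [blockAdj, Matrix.of_apply, Matrix.mul_apply, Finset.mul_sum, Finset.sum_div]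
  refine Finset.sum_congr rfl fun z _ => ?_
  have := (M.hDiag_pos z.1 z.2).ne'
  field_simp

theorem blockAdj_one [DecidableEq T] :
    M.blockAdj (1 : Matrix (T × Fin q) (T × Fin q) ℝ) = 1 := by
  ext x y
  simp only [blockAdj, Matrix.of_apply, Matrix.one_apply]
  by_cases h : x = y
  · subst h
    simp [(M.hDiag_pos x.1 x.2).ne']
  · simp [h, Ne.symm h]

/-! ### Complete positivity of the influence operator -/

theorem matForm_conj (X A Y : Matrix (T × Fin q) (T × Fin q) ℝ) :
    M.matForm X (A * Y * M.blockAdj A) = ∑ x, ∑ y, ∑ v, ∑ u,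
      M.typeWt x.1 * (M.hDiag v.1 v.2 / M.hDiag x.1 x.2) * (X x y * Y u v * (A x u * A y v)) := by
  simp only [matForm_apply, Matrix.mul_apply, blockAdj, Matrix.of_apply, Finset.mul_sum,
    Finset.sum_mul]
  refine Finset.sum_congr rfl fun x _ => Finset.sum_congr rfl fun y _ =>
    Finset.sum_congr rfl fun v _ => Finset.sum_congr rfl fun u _ => ?_
  have := (M.hDiag_pos y.1 y.2).ne'
  field_simp

theorem matForm_one_conj_one [DecidableEq T] (A : Matrix (T × Fin q) (T × Fin q) ℝ) :
    M.matForm 1 (A * 1 * M.blockAdj A) = ∑ x, ∑ v,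
      M.typeWt x.1 * (M.hDiag v.1 v.2 / M.hDiag x.1 x.2) * A x v ^ 2 := by
  rw [matForm_conj]
  simp only [Matrix.one_apply]
  refine Finset.sum_congr rfl fun x _ => ?_
  rw [Finset.sum_comm]
  refine Finset.sum_congr rfl fun v _ => ?_
  simp [pow_two]

/-- The left side is a quadratic form in the entries of `A` with bounded coefficients; the right
side is a sum of squares of all these entries with positive weights. What matters for iteration is
that `C` does not depend on `A`. -/
theorem abs_matForm_conj_le [DecidableEq T] (X Y : Matrix (T × Fin q) (T × Fin q) ℝ) :
    ∃ C : ℝ, 0 ≤ C ∧ ∀ A : Matrix (T × Fin q) (T × Fin q) ℝ,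
      |M.matForm X (A * Y * M.blockAdj A)| ≤ C * M.matForm 1 (A * 1 * M.blockAdj A) := by
  set w : T × Fin q → T × Fin q → ℝ := fun x v =>
    M.typeWt x.1 * (M.hDiag v.1 v.2 / M.hDiag x.1 x.2) with hw
  have hwp : ∀ x v, 0 < w x v := M.matForm_weight_pos
  have single : ∀ (f : T × Fin q → T × Fin q → ℝ), (∀ x y, 0 ≤ f x y) → ∀ x y,
      f x y ≤ ∑ x, ∑ y, f x y := fun f hf x y =>
    (Finset.single_le_sum (f := fun y => f x y) (fun y _ => hf x y) (Finset.mem_univ y)).trans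
      (Finset.single_le_sum (f := fun x => ∑ y, f x y)
        (fun x _ => Finset.sum_nonneg fun y _ => hf x y) (Finset.mem_univ x))
  have hw0 : 0 ≤ ∑ x, ∑ y, w x y :=
    Finset.sum_nonneg fun x _ => Finset.sum_nonneg fun y _ => (hwp x y).le
  set D : ℝ := (∑ x, ∑ y, w x y) * ((∑ x, ∑ y, |X x y|) * ∑ x, ∑ y, |Y x y|) with hD
  set c : ℝ := ∑ x, ∑ y, (w x y)⁻¹ with hc
  have hD0 : 0 ≤ D := mul_nonneg hw0 (by positivity)
  have hc0 : 0 ≤ c :=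
    Finset.sum_nonneg fun x _ => Finset.sum_nonneg fun y _ => (inv_pos.2 (hwp x y)).le
  set N : ℝ := (Fintype.card (T × Fin q) : ℝ)
  -- `D` bounds the coefficients, `2 N²` counts how often each squared entry occurs in the fourfold
  -- sum, and `c` passes from plain to weighted squares.
  refine ⟨D * (2 * N ^ 2) * c, by positivity, fun A => ?_⟩
  rw [matForm_one_conj_one, matForm_conj]
  have h1 : ∑ x, ∑ v, A x v ^ 2 ≤ c * ∑ x, ∑ v, w x v * A x v ^ 2 := by
    rw [Finset.mul_sum]
    refine Finset.sum_le_sum fun x _ => ?_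
    rw [Finset.mul_sum]
    refine Finset.sum_le_sum fun v _ => ?_
    have h2 : (w x v)⁻¹ ≤ c :=
      single (fun x y => (w x y)⁻¹) (fun x y => (inv_pos.2 (hwp x y)).le) x v
    calc A x v ^ 2 = (w x v)⁻¹ * (w x v * A x v ^ 2) := by
          rw [inv_mul_cancel_left₀ (hwp x v).ne']
      _ ≤ c * (w x v * A x v ^ 2) :=
          mul_le_mul_of_nonneg_right h2 (mul_nonneg (hwp x v).le (sq_nonneg _))
  have h3 : ∀ x y v u, |w x v * (X x y * Y u v * (A x u * A y v))| ≤
      D * (A x u ^ 2 + A y v ^ 2) := by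
    intro x y v u
    rw [abs_mul, abs_of_pos (hwp x v), abs_mul, abs_mul, hD, mul_assoc (∑ x, ∑ y, w x y)]
    have h4 : |A x u * A y v| ≤ A x u ^ 2 + A y v ^ 2 := by
      rw [abs_le]
      constructor <;> nlinarith [sq_nonneg (A x u + A y v), sq_nonneg (A x u - A y v),
        sq_nonneg (A x u), sq_nonneg (A y v)]
    refine mul_le_mul (single w (fun x y => (hwp x y).le) x v) ?_ (by positivity) hw0
    refine mul_le_mul ?_ h4 (abs_nonneg _) (by positivity)
    exact mul_le_mul (single (fun x y => |X x y|) (fun _ _ => abs_nonneg _) x y)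
      (single (fun x y => |Y x y|) (fun _ _ => abs_nonneg _) u v) (abs_nonneg _) (by positivity)
  have h5 : |∑ x, ∑ y, ∑ v, ∑ u, w x v * (X x y * Y u v * (A x u * A y v))| ≤
      ∑ x, ∑ y, ∑ v, ∑ u, D * (A x u ^ 2 + A y v ^ 2) := by
    refine (Finset.abs_sum_le_sum_abs _ _).trans (Finset.sum_le_sum fun x _ => ?_)
    refine (Finset.abs_sum_le_sum_abs _ _).trans (Finset.sum_le_sum fun y _ => ?_)
    refine (Finset.abs_sum_le_sum_abs _ _).trans (Finset.sum_le_sum fun v _ => ?_)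
    exact (Finset.abs_sum_le_sum_abs _ _).trans (Finset.sum_le_sum fun u _ => h3 x y v u)
  refine h5.trans ?_
  have h6 : ∑ x : T × Fin q, ∑ y : T × Fin q, ∑ v : T × Fin q, ∑ u : T × Fin q,
      D * (A x u ^ 2 + A y v ^ 2) = D * (2 * N ^ 2) * ∑ x, ∑ v, A x v ^ 2 := by
    simp only [← Finset.mul_sum, Finset.sum_add_distrib, Finset.sum_const, Finset.card_univ,
      nsmul_eq_mul]
    ring
  rw [h6, mul_assoc _ c]
  exact mul_le_mul_of_nonneg_left h1 (by positivity)

open Classical in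
/-- The transition matrix of a pair of positions, as a block of a `T × [q]` matrix. -/
def kraus (i : Fin F) (a b : Fin (M.arity i)) : Matrix (T × Fin q) (T × Fin q) ℝ :=
  Matrix.of fun x u =>
    if x.1 = M.cls i a ∧ u.1 = M.cls i b then M.transMat i a b x.2 u.2 else 0

/-- The Kraus form: nonnegative coefficients times conjugations. Both the symmetry and the
positivity of `L` are read off from it. -/
theorem influence_apply (Y : Matrix (T × Fin q) (T × Fin q) ℝ) :
    M.influence Y = ∑ i, ∑ a, ∑ b, if a ≠ b then
      M.meanDegree i (M.cls i a) • (M.kraus i a b * Y * M.blockAdj (M.kraus i a b)) else 0 := by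
  classical
  ext ⟨t, α⟩ ⟨t', β⟩
  have hL : M.influence Y (t, α) (t', β) =
      if t = t' then M.influenceBlock Y t α β else 0 := rfl
  rw [hL]
  by_cases h2 : t = t'
  · subst h2
    rw [if_pos rfl, influenceBlock]
    simp only [Matrix.sum_apply]
    refine Finset.sum_congr rfl fun i _ => Finset.sum_congr rfl fun a _ =>
      Finset.sum_congr rfl fun b _ => ?_
    by_cases hab : a = b
    · simp [hab]
    by_cases h1 : M.cls i a = t
    · subst h1
      simp only [ne_eq, hab, not_false_eq_true, and_self, if_true, Matrix.smul_apply,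
        Matrix.mul_apply, diagBlock, Matrix.submatrix_apply, transMatAdj_apply, true_and,
        smul_eq_mul, blockAdj, kraus, Matrix.of_apply, Fintype.sum_prod_type]
      congr 1
      rw [Finset.sum_eq_single (M.cls i b)]
      · refine Finset.sum_congr rfl fun δ _ => ?_
        rw [Finset.sum_eq_single (M.cls i b)]
        · simp only [if_true]
          ring
        · intro t' _ ht'
          simp [ht']
        · simp
      · intro t' _ ht'
        simp [ht']
      · simp
    · simp [h1, Ne.symm h1, hab, Matrix.mul_apply, kraus, blockAdj]
  · rw [if_neg h2]
    simp only [Matrix.sum_apply]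
    symm
    refine Finset.sum_eq_zero fun i _ => Finset.sum_eq_zero fun a _ =>
      Finset.sum_eq_zero fun b _ => ?_
    split_ifs
    · by_cases h1 : t = M.cls i a
      · subst h1
        simp [Matrix.mul_apply, kraus, blockAdj, Ne.symm h2]
      · simp [Matrix.mul_apply, kraus, blockAdj, h1]
    · rfl

/-- Expanding the outermost `L` in Kraus form only replaces `A` by products `A * kraus i a b`, with
the same nonnegative coefficients on both sides. Since the bound for `s` holds for every `A` with
one constant, it passes to `s + 1` unchanged. -/
theorem abs_matForm_conj_pow_le [DecidableEq T] (X : Matrix (T × Fin q) (T × Fin q) ℝ) :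
    ∃ C : ℝ, 0 ≤ C ∧ ∀ (s : ℕ) (A : Matrix (T × Fin q) (T × Fin q) ℝ),
      |M.matForm X (A * (M.influence ^ s) X * M.blockAdj A)| ≤
        C * M.matForm 1 (A * (M.influence ^ s) 1 * M.blockAdj A) := by
  obtain ⟨C, hC, h⟩ := M.abs_matForm_conj_le X X
  refine ⟨C, hC, fun s => ?_⟩
  induction s with
  | zero => intro A; simpa using h A
  | succ s ih =>
    intro A
    have key : ∀ Z, A * M.influence Z * M.blockAdj A = ∑ i, ∑ a, ∑ b, if a ≠ b then
      M.meanDegree i (M.cls i a) •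
        ((A * M.kraus i a b) * Z * M.blockAdj (A * M.kraus i a b)) else 0 := by
      intro Z
      rw [influence_apply]
      simp only [Finset.mul_sum, Finset.sum_mul]
      refine Finset.sum_congr rfl fun i _ => Finset.sum_congr rfl fun a _ =>
        Finset.sum_congr rfl fun b _ => ?_
      split_ifs
      · rw [blockAdj_mul]
        simp only [Matrix.mul_smul, Matrix.smul_mul, Matrix.mul_assoc]
      · simp
    rw [pow_succ', Module.End.mul_apply, Module.End.mul_apply, key, key]
    simp only [map_sum, Finset.mul_sum]
    refine (Finset.abs_sum_le_sum_abs _ _).trans (Finset.sum_le_sum fun i _ => ?_)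
    refine (Finset.abs_sum_le_sum_abs _ _).trans (Finset.sum_le_sum fun a _ => ?_)
    refine (Finset.abs_sum_le_sum_abs _ _).trans (Finset.sum_le_sum fun b _ => ?_)
    split_ifs
    · have hd : 0 ≤ M.meanDegree i (M.cls i a) :=
        mul_nonneg (div_nonneg (M.avgDens_nonneg i) (M.typeDist_nonneg _))
          (Finset.prod_nonneg fun _ _ => M.typeDist_nonneg _)
      rw [map_smul, map_smul, smul_eq_mul, smul_eq_mul, abs_mul, abs_of_nonneg hd, mul_left_comm]
      exact mul_le_mul_of_nonneg_left (ih _) hd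
    · simp

/-- The product on the right no longer depends on the position `a`; this is what makes `L`
symmetric. If the type has mass zero, both sides vanish. -/
theorem meanDegree_mul_typeWt (i : Fin F) (a : Fin (M.arity i)) :
    M.meanDegree i (M.cls i a) * M.typeWt (M.cls i a) =
      M.avgDens i * ∏ k, M.typeDist (M.cls i k) := by
  rw [meanDegree, typeWt]
  rcases (M.typeDist_nonneg (M.cls i a)).eq_or_lt with h | h
  · rw [Finset.prod_eq_zero (Finset.mem_univ a) h.symm]; simp
  · rw [if_pos h]; field_simp

theorem hDiag_inv_mul_kraus {M : ObservationModel q T F} (hM : M.DetailedBalance) (i : Fin F)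
    (a b : Fin (M.arity i)) (x u : T × Fin q) :
    M.kraus i a b x u * M.hDiag u.1 u.2 = M.kraus i b a u x * M.hDiag x.1 x.2 := by
  obtain ⟨t, α⟩ := x
  obtain ⟨t', β⟩ := u
  simp only [kraus, Matrix.of_apply]
  by_cases h : t = M.cls i a ∧ t' = M.cls i b
  · rw [if_pos h, if_pos h.symm, h.1, h.2]
    have := hDiag_inv_mul_transMat hM i a b α β
    have h1 := (M.hDiag_pos (M.cls i a) α).ne'
    have h2 := (M.hDiag_pos (M.cls i b) β).ne'
    field_simp at this
    linarith
  · rw [if_neg h, if_neg fun h' => h h'.symm]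
    simp

theorem matForm_kraus (i : Fin F) (a b : Fin (M.arity i))
    (X Y : Matrix (T × Fin q) (T × Fin q) ℝ) :
    M.meanDegree i (M.cls i a) *
      M.matForm X (M.kraus i a b * Y * M.blockAdj (M.kraus i a b)) =
    M.avgDens i * (∏ k, M.typeDist (M.cls i k)) * ∑ x, ∑ y, ∑ v, ∑ u,
      X x y * Y u v * (M.kraus i a b x u / M.hDiag x.1 x.2) *
        (M.kraus i a b y v * M.hDiag v.1 v.2) := by
  rw [matForm_conj, ← meanDegree_mul_typeWt M i a]
  simp only [Finset.mul_sum]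
  refine Finset.sum_congr rfl fun x _ => Finset.sum_congr rfl fun y _ =>
    Finset.sum_congr rfl fun v _ => Finset.sum_congr rfl fun u _ => ?_
  by_cases h : x.1 = M.cls i a
  · rw [h]; ring
  · simp [kraus, h]

theorem sum_sum_sum_sum_swap {ι : Type*} [Fintype ι] (f : ι → ι → ι → ι → ℝ) :
    ∑ x, ∑ y, ∑ v, ∑ u, f x y v u = ∑ u, ∑ v, ∑ y, ∑ x, f x y v u := by
  calc ∑ x, ∑ y, ∑ v, ∑ u, f x y v u = ∑ x, ∑ y, ∑ u, ∑ v, f x y v u :=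
        Finset.sum_congr rfl fun x _ => Finset.sum_congr rfl fun y _ => Finset.sum_comm
    _ = ∑ x, ∑ u, ∑ y, ∑ v, f x y v u := Finset.sum_congr rfl fun x _ => Finset.sum_comm
    _ = ∑ u, ∑ x, ∑ y, ∑ v, f x y v u := Finset.sum_comm
    _ = ∑ u, ∑ x, ∑ v, ∑ y, f x y v u :=
        Finset.sum_congr rfl fun x _ => Finset.sum_congr rfl fun y _ => Finset.sum_comm
    _ = ∑ u, ∑ v, ∑ x, ∑ y, f x y v u := Finset.sum_congr rfl fun x _ => Finset.sum_comm
    _ = ∑ u, ∑ v, ∑ y, ∑ x, f x y v u :=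
        Finset.sum_congr rfl fun x _ => Finset.sum_congr rfl fun y _ => Finset.sum_comm

/-- The Kraus term of `(a, b)` in one pairing equals that of `(b, a)` in the other: the weights
agree by `meanDegree_mul_typeWt` and the entries by `hDiag_inv_mul_kraus`. -/
theorem matForm_influence {M : ObservationModel q T F} (hM : M.DetailedBalance)
    (X Y : Matrix (T × Fin q) (T × Fin q) ℝ) :
    M.matForm (M.influence X) Y = M.matForm X (M.influence Y) := by
  rw [matForm_comm, influence_apply, influence_apply]
  simp only [map_sum]
  refine Finset.sum_congr rfl fun i _ => ?_
  -- Exchange the roles of the two positions on one side.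
  rw [Finset.sum_comm]
  refine Finset.sum_congr rfl fun a _ => Finset.sum_congr rfl fun b _ => ?_
  by_cases hab : a = b
  · simp [hab]
  simp only [ne_eq, hab, Ne.symm hab, not_false_eq_true, if_true, map_smul, smul_eq_mul,
    matForm_kraus]
  congr 1
  rw [sum_sum_sum_sum_swap]
  refine Finset.sum_congr rfl fun x _ => Finset.sum_congr rfl fun y _ =>
    Finset.sum_congr rfl fun v _ => Finset.sum_congr rfl fun u _ => ?_
  have e1 := hDiag_inv_mul_kraus hM i b a u x
  have e2 := hDiag_inv_mul_kraus hM i b a v y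
  have h1 := (M.hDiag_pos x.1 x.2).ne'
  have h2 := (M.hDiag_pos u.1 u.2).ne'
  rw [e2]
  have e3 : M.kraus i b a u x / M.hDiag u.1 u.2 = M.kraus i a b x u / M.hDiag x.1 x.2 := by
    field_simp
    linarith
  rw [e3]
  ring

end ObservationModel

namespace ObservationModel

variable {q : ℕ} {T : Type*} [Fintype T] {F : ℕ} (M : ObservationModel q T F)

/-! ### The normalising constants -/

/-- A type of positive mass together with a colour of positive prior probability. -/
def InSupp (x : T × Fin q) : Prop := 0 < M.typeDist x.1 ∧ 0 < M.prior x.1 x.2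

open Classical in
/-- The identity matrix restricted to the support of the model. -/
def suppOne : Matrix (T × Fin q) (T × Fin q) ℝ :=
  Matrix.of fun x y => if x = y ∧ M.InSupp x then 1 else 0

open Classical in
theorem mul_suppOne_apply (A : Matrix (T × Fin q) (T × Fin q) ℝ) (x u : T × Fin q) :
    (A * M.suppOne) x u = if M.InSupp u then A x u else 0 := by
  rw [Matrix.mul_apply, Finset.sum_eq_single u]
  · simp [suppOne]
  · intro v _ hv
    simp [suppOne, hv]
  · simp

theorem exists_inSupp : ∃ x, M.InSupp x := by
  obtain ⟨t, -, ht⟩ : ∃ t ∈ Finset.univ, M.typeDist t ≠ 0 :=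
    Finset.exists_ne_zero_of_sum_ne_zero (by rw [M.typeDist_sum]; exact one_ne_zero)
  obtain ⟨c, -, hc⟩ : ∃ c ∈ Finset.univ, M.prior t c ≠ 0 :=
    Finset.exists_ne_zero_of_sum_ne_zero (by rw [M.prior_sum]; exact one_ne_zero)
  exact ⟨(t, c), (M.typeDist_nonneg t).lt_of_ne' ht, (M.prior_nonneg t c).lt_of_ne' hc⟩

theorem suppOne_ne_zero : M.suppOne ≠ 0 := by
  classical
  obtain ⟨x, hx⟩ := M.exists_inSupp
  intro h
  have := congrFun (congrFun h x) x
  simp [suppOne, hx] at this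

theorem meanDegree_eq_zero {i : Fin F} {t : T} (k : Fin (M.arity i))
    (h : M.typeDist (M.cls i k) = 0) : M.meanDegree i t = 0 := by
  rw [meanDegree, Finset.prod_eq_zero (Finset.mem_univ k) h, mul_zero]

theorem meanDegree_nonneg (i : Fin F) (t : T) : 0 ≤ M.meanDegree i t :=
  mul_nonneg (div_nonneg (M.avgDens_nonneg i) (M.typeDist_nonneg _))
    (Finset.prod_nonneg fun _ _ => M.typeDist_nonneg _)

/-- `L` acts on all types and colours, but labels of probability zero never occur in an outcome;
every weighted Kraus entry that involves such a label vanishes. -/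
theorem meanDegree_mul_kraus_eq_zero {M : ObservationModel q T F} (hM : M.DetailedBalance)
    (i : Fin F) (a b : Fin (M.arity i)) (t : T) (x u : T × Fin q)
    (h : ¬ M.InSupp x ∨ ¬ M.InSupp u) : M.meanDegree i t * M.kraus i a b x u = 0 := by
  obtain ⟨t', α⟩ := x
  obtain ⟨t'', β⟩ := u
  simp only [kraus, Matrix.of_apply]
  split_ifs with h1
  swap
  · simp
  obtain ⟨rfl, rfl⟩ := h1
  simp only [InSupp, not_and_or, not_lt] at h
  rcases h with (h | h) | (h | h)
  · rw [M.meanDegree_eq_zero a (le_antisymm h (M.typeDist_nonneg _)), zero_mul]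
  · rw [transMat_eq_zero_left hM (le_antisymm h (M.prior_nonneg _ _)), mul_zero]
  · rw [M.meanDegree_eq_zero b (le_antisymm h (M.typeDist_nonneg _)), zero_mul]
  · rw [transMat_eq_zero_right hM (le_antisymm h (M.prior_nonneg _ _)), mul_zero]

theorem influence_suppOne [DecidableEq T] {M : ObservationModel q T F} (hM : M.DetailedBalance) :
    M.influence M.suppOne = M.influence 1 := by
  classical
  rw [influence_apply, influence_apply]
  refine Finset.sum_congr rfl fun i _ => Finset.sum_congr rfl fun a _ =>
    Finset.sum_congr rfl fun b _ => ?_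
  split_ifs with hab
  swap
  · rfl
  · rw [← Matrix.smul_mul, ← Matrix.smul_mul, ← Matrix.smul_mul, ← Matrix.smul_mul]
    congr 1
    rw [Matrix.mul_one]
    ext x u
    rw [mul_suppOne_apply, Matrix.smul_apply, smul_eq_mul]
    split_ifs with h
    · rfl
    · rw [meanDegree_mul_kraus_eq_zero hM i a b _ x u (Or.inr h)]

theorem influence_eq_zero_of_not_inSupp {M : ObservationModel q T F} (hM : M.DetailedBalance)
    (X : Matrix (T × Fin q) (T × Fin q) ℝ) {x y : T × Fin q} (hy : ¬ M.InSupp y) :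
    M.influence X x y = 0 := by
  rw [influence_apply]
  simp only [Matrix.sum_apply]
  refine Finset.sum_eq_zero fun i _ => Finset.sum_eq_zero fun a _ =>
    Finset.sum_eq_zero fun b _ => ?_
  split_ifs with hab
  swap
  · rfl
  · rw [← Matrix.mul_smul, Matrix.mul_apply]
    refine Finset.sum_eq_zero fun v _ => ?_
    have := meanDegree_mul_kraus_eq_zero hM i a b (M.cls i a) y v (Or.inl hy)
    simp only [Matrix.smul_apply, blockAdj, Matrix.of_apply, smul_eq_mul]
    linear_combination ((M.kraus i a b * X) x v * M.hDiag v.1 v.2 / M.hDiag y.1 y.2) * this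

theorem nonempty_index (M : ObservationModel q T F) :
    Nonempty (Fin (Module.finrank ℝ (Matrix (T × Fin q) (T × Fin q) ℝ))) := by
  obtain ⟨x, -⟩ := M.exists_inSupp
  have : Nonempty (T × Fin q) := ⟨x⟩
  exact ⟨⟨0, Module.finrank_pos⟩⟩

theorem exists_influence_eigenbasis {M : ObservationModel q T F} (hM : M.DetailedBalance) :
    ∃ (b : Module.Basis (Fin (Module.finrank ℝ (Matrix (T × Fin q) (T × Fin q) ℝ))) ℝ
        (Matrix (T × Fin q) (T × Fin q) ℝ))
      (μ : Fin (Module.finrank ℝ (Matrix (T × Fin q) (T × Fin q) ℝ)) → ℝ),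
      (∀ j, M.influence (b j) = μ j • b j) ∧
      (∀ j k, M.matForm (b j) (b k) = if j = k then 1 else 0) ∧
      (∀ j, |μ j| ≤ M.lamL) ∧ ∃ j, |μ j| = M.lamL := by
  obtain ⟨b, μ, hb, ho⟩ := exists_orthonormal_eigenbasis M.matForm M.matForm_comm
    M.matForm_self_pos M.influence (matForm_influence hM)
  have := M.nonempty_index
  exact ⟨b, μ, hb, ho, spectralRadius_baseChange hb⟩

theorem influence_eq_zero_of_lamL {M : ObservationModel q T F} (hM : M.DetailedBalance)
    (h : M.lamL = 0) : M.influence = 0 := by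
  obtain ⟨b, μ, hb, -, hle, -⟩ := exists_influence_eigenbasis hM
  refine b.ext fun j => ?_
  have h0 : μ j = 0 := abs_eq_zero.1 (le_antisymm (h ▸ hle j) (abs_nonneg _))
  rw [hb, h0, zero_smul, LinearMap.zero_apply]

theorem lamL_nonneg : 0 ≤ M.lamL := ENNReal.toReal_nonneg

/-- One application of `L` forgets the difference between `1` and `suppOne`, and symmetry allows
this on either side of the pairing. For `s = 0` no `L` is available for the replacement. -/
theorem matForm_one_pow [DecidableEq T] {M : ObservationModel q T F} (hM : M.DetailedBalance)
    {s : ℕ} (hs : s ≠ 0) :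
    M.matForm 1 ((M.influence ^ s) 1) = M.matForm M.suppOne ((M.influence ^ s) M.suppOne) := by
  obtain ⟨r, rfl⟩ := Nat.exists_eq_succ_of_ne_zero hs
  have hsym : ∀ (k : ℕ) X Y, M.matForm ((M.influence ^ k) X) Y =
      M.matForm X ((M.influence ^ k) Y) := by
    intro k
    induction k with
    | zero => intro X Y; rfl
    | succ k ih =>
      intro X Y
      rw [pow_succ, Module.End.mul_apply, ih, matForm_influence hM, ← Module.End.mul_apply,
        ((Commute.refl M.influence).pow_right k).eq]
  have h : (M.influence ^ (r + 1)) M.suppOne = (M.influence ^ (r + 1)) 1 := by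
    rw [pow_succ, Module.End.mul_apply, Module.End.mul_apply, influence_suppOne hM]
  rw [Nat.succ_eq_add_one, ← h, ← hsym, ← h, matForm_comm]

/-- The constants `γ_s`. -/
def gam (s : ℕ) : ℝ :=
  M.matForm M.suppOne ((M.influence ^ s) M.suppOne) / (M.matForm M.suppOne M.suppOne * M.lamL ^ s)

/-- Complete positivity, applied to an eigenvector of maximal absolute eigenvalue, bounds `γ_s`
below for `s ≥ 1`. The limits are spectral sums over the eigenvalues `±lamL`, which differ only in
the contribution of `-lamL`. The last clause is a Perron–Frobenius statement, deduced from the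
positivity of the odd limit. -/
theorem gam_properties {M : ObservationModel q T F} (hM : M.DetailedBalance) (hl : 0 < M.lamL) :
    (∃ c, 0 < c ∧ ∀ s, c ≤ M.gam s) ∧
    (∃ γ₀ γ₁ : ℝ, 0 < γ₀ ∧ 0 < γ₁ ∧
      Tendsto (fun k => M.gam (2 * k)) atTop (𝓝 γ₀) ∧
      Tendsto (fun k => M.gam (2 * k + 1)) atTop (𝓝 γ₁) ∧
      (¬ Module.End.HasEigenvalue M.influence (-M.lamL) → γ₀ = γ₁)) ∧
    ∃ V, V ≠ 0 ∧ M.influence V = M.lamL • V := by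
  classical
  obtain ⟨b, μ, hb, ho, hle, j₀, hj₀⟩ := exists_influence_eigenbasis hM
  have hJ : 0 < M.matForm M.suppOne M.suppOne := M.matForm_self_pos _ M.suppOne_ne_zero
  obtain ⟨C, hC, hlow⟩ := M.abs_matForm_conj_pow_le (b j₀)
  -- The previous bound with `A = 1`, using that the pairing of `b j₀` with `L^s (b j₀)` is `μ j₀ ^
  -- s`.
  have hlow' : ∀ s, s ≠ 0 →
      M.lamL ^ s ≤ C * M.matForm M.suppOne ((M.influence ^ s) M.suppOne) := by
    intro s hs
    have h1 := hlow s 1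
    rw [blockAdj_one, Matrix.one_mul, Matrix.mul_one, Matrix.one_mul, Matrix.mul_one,
      matForm_one_pow hM hs, pow_apply_eigenbasis hb, map_smul, ho, if_pos rfl, smul_eq_mul,
      mul_one, abs_pow, hj₀] at h1
    exact h1
  have hC0 : 0 < C := by
    rcases hC.eq_or_lt with h | h
    · have := hlow' 1 one_ne_zero
      rw [← h, zero_mul, pow_one] at this
      exact absurd hl this.not_gt
    · exact h
  set c : ℝ := 1 / (C * M.matForm M.suppOne M.suppOne) with hc
  have hc0 : 0 < c := by positivity
  have hge : ∀ s, s ≠ 0 → c ≤ M.gam s := by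
    intro s hs
    rw [hc, gam, div_le_div_iff₀ (by positivity) (by positivity)]
    nlinarith [hlow' s hs]
  -- The normalised spectral weights of `suppOne`; they are nonnegative.
  set a : Fin _ → ℝ := fun j => b.repr M.suppOne j ^ 2 / M.matForm M.suppOne M.suppOne with ha
  have hgam : ∀ s, M.gam s = ∑ j, a j * (μ j / M.lamL) ^ s := by
    intro s
    rw [gam, form_pow_eq_sum hb ho, Finset.sum_div]
    refine Finset.sum_congr rfl fun j _ => ?_
    rw [ha, div_pow]
    field_simp
  obtain ⟨ht0, ht1⟩ := tendsto_sum_mul_pow a μ M.lamL hl hle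
  simp_rw [← hgam] at ht0 ht1
  have hl0 := ge_of_tendsto ht0 ((eventually_ge_atTop 1).mono fun k hk => hge (2 * k) (by omega))
  have hl1 := ge_of_tendsto ht1 ((eventually_ge_atTop 1).mono fun k _ =>
    hge (2 * k + 1) (by omega))
  -- The lower bound `c` needs `s ≥ 1`, while the constant for `s = 0` is exactly `1`.
  refine ⟨⟨min c 1, lt_min hc0 one_pos, fun s => ?_⟩,
    ⟨_, _, hc0.trans_le hl0, hc0.trans_le hl1, ht0, ht1, fun hne => ?_⟩, ?_⟩
  · by_cases hs : s = 0
    · rw [hs, gam, pow_zero, pow_zero, mul_one, Module.End.one_apply, div_self hJ.ne']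
      exact min_le_right _ _
    · exact (min_le_left _ _).trans (hge s hs)
  · refine Finset.sum_congr rfl fun j _ => ?_
    have : μ j ≠ -M.lamL := by
      intro h
      refine hne (Module.End.hasEigenvalue_of_hasEigenvector (x := b j)
        ⟨Module.End.mem_eigenspace_iff.2 ?_, b.ne_zero j⟩)
      rw [hb, h]
    simp [this]
  -- Without the eigenvalue `lamL`, only `-lamL` would contribute to the odd limit, with a
  -- nonpositive sign.
  · by_contra! hno
    have hμ : ∀ j, μ j ≠ M.lamL := fun j hj => hno (b j) (b.ne_zero j) (by rw [hb, hj])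
    refine absurd (hc0.trans_le hl1) (not_lt.2 (Finset.sum_nonpos fun j _ => ?_))
    have ha0 : 0 ≤ a j := div_nonneg (sq_nonneg _) hJ.le
    rw [if_neg (hμ j)]
    split_ifs <;> nlinarith

/-- Pairing `L 1` with `1` gives a sum of nonnegative terms, each a mean degree times a weighted
Hilbert–Schmidt norm of a Kraus matrix. If `L = 0`, every term vanishes, and positive type masses
leave only `avgDens i = 0` or a zero matrix. -/
theorem transMat_eq_zero_of_influence {M : ObservationModel q T F} (hM : M.DetailedBalance)
    (h : M.influence = 0) {i : Fin F} {a b : Fin (M.arity i)} (hab : a ≠ b)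
    (hT : ∀ k, 0 < M.typeDist (M.cls i k)) : M.transMat i a b = 0 := by
  classical
  have h1 : M.matForm 1 (M.influence 1) = 0 := by rw [h]; simp
  rw [influence_apply] at h1
  simp only [map_sum] at h1
  have hnn : ∀ i a b, 0 ≤ M.matForm 1 (if a ≠ b then
      M.meanDegree i (M.cls i a) • (M.kraus i a b * 1 * M.blockAdj (M.kraus i a b)) else 0) := by
    intro i a b
    split_ifs
    swap
    · simp
    · rw [map_smul, smul_eq_mul, matForm_one_conj_one]
      exact mul_nonneg (M.meanDegree_nonneg _ _) (Finset.sum_nonneg fun x _ =>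
        Finset.sum_nonneg fun v _ => mul_nonneg (M.matForm_weight_pos x v).le (sq_nonneg _))
  have h2 := (Finset.sum_eq_zero_iff_of_nonneg fun i _ => Finset.sum_nonneg fun a _ =>
    Finset.sum_nonneg fun b _ => hnn i a b).1 h1 i (Finset.mem_univ _)
  have h3 := (Finset.sum_eq_zero_iff_of_nonneg fun a _ =>
    Finset.sum_nonneg fun b _ => hnn i a b).1 h2 a (Finset.mem_univ _)
  have h4 := (Finset.sum_eq_zero_iff_of_nonneg fun b _ => hnn i a b).1 h3 b (Finset.mem_univ _)
  rw [if_pos hab, map_smul, smul_eq_mul, matForm_one_conj_one] at h4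
  rcases mul_eq_zero.1 h4 with h5 | h5
  · refine transMat_eq_zero_of_avgDens hM ?_ a b
    rw [meanDegree] at h5
    rcases mul_eq_zero.1 h5 with h6 | h6
    · exact (div_eq_zero_iff.1 h6).resolve_right (hT a).ne'
    · exact absurd h6 (Finset.prod_pos fun k _ => hT k).ne'
  · ext α β
    have h6 := (Finset.sum_eq_zero_iff_of_nonneg fun x _ => Finset.sum_nonneg fun v _ =>
      mul_nonneg (M.matForm_weight_pos x v).le (sq_nonneg _)).1 h5 (M.cls i a, α)
      (Finset.mem_univ _)
    have h7 := (Finset.sum_eq_zero_iff_of_nonneg fun v _ =>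
      mul_nonneg (M.matForm_weight_pos _ v).le (sq_nonneg _)).1 h6 (M.cls i b, β)
      (Finset.mem_univ _)
    have h8 := (mul_eq_zero.1 h7).resolve_left (M.matForm_weight_pos _ _).ne'
    simpa [kraus] using h8

/-- With a single colour the centred transition matrices are zero. This is used to pass from the
factor `1/2` to `1/q` in the eigenvalue bound. -/
theorem two_le_of_lamL_pos {M : ObservationModel q T F} (hM : M.DetailedBalance)
    (hl : 0 < M.lamL) : 2 ≤ q := by
  by_contra hq
  obtain ⟨x, -⟩ := M.exists_inSupp
  have hq1 : q = 1 := by have := x.2.pos; omega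
  subst hq1
  obtain ⟨b, μ, hb, -, hle, j, hj⟩ := exists_influence_eigenbasis hM
  have hpr : ∀ t c, M.prior t c = 1 := by
    intro t c
    have := M.prior_sum t
    rw [Fin.sum_univ_one] at this
    rw [Subsingleton.elim c 0, this]
  have h0 : ∀ i a b, M.kraus i a b = 0 := by
    intro i a b
    ext x u
    simp only [kraus, Matrix.of_apply, Matrix.zero_apply]
    split_ifs
    · have h1 := sum_pairMass hM i a b u.2
      rw [Fin.sum_univ_one, Subsingleton.elim 0 x.2] at h1
      rw [transMat_apply hM, h1]
      simp [hpr]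
    · rfl
  have hL : M.influence (b j) = 0 := by
    rw [influence_apply]
    simp [h0]
  rw [hb] at hL
  have := (smul_eq_zero.1 hL).resolve_right (b.ne_zero j)
  rw [this, abs_zero] at hj
  exact hl.ne hj

end ObservationModel

/-! ### Expectations under finite product measures -/

section ProdExp

variable {ι α : Type*} [Fintype ι] [DecidableEq ι] [Fintype α]

/-- The expectation of a function of independent variables with common law `π`. -/
def prodExp (π : α → ℝ) (f : (ι → α) → ℝ) : ℝ := ∑ σ, (∏ v, π (σ v)) * f σ

theorem prodExp_one {π : α → ℝ} (hπ : ∑ x, π x = 1) :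
    prodExp π (fun _ : ι → α => 1) = 1 := by
  simp [prodExp, ← Fintype.prod_sum (fun (_ : ι) x => π x), hπ]

theorem prodExp_mul_left (π : α → ℝ) (r : ℝ) (f : (ι → α) → ℝ) :
    prodExp π (fun σ => r * f σ) = r * prodExp π f := by
  simp only [prodExp, Finset.mul_sum]
  exact Finset.sum_congr rfl fun σ _ => by ring

theorem prodExp_sum {β : Type*} (s : Finset β) (π : α → ℝ) (f : β → (ι → α) → ℝ) :
    prodExp π (fun σ => ∑ b ∈ s, f b σ) = ∑ b ∈ s, prodExp π (f b) := by
  simp only [prodExp, Finset.mul_sum]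
  exact Finset.sum_comm

theorem prodExp_mono {π : α → ℝ} (hπ : ∀ x, 0 ≤ π x) {f g : (ι → α) → ℝ} (h : ∀ σ, f σ ≤ g σ) :
    prodExp π f ≤ prodExp π g :=
  Finset.sum_le_sum fun σ _ =>
    mul_le_mul_of_nonneg_left (h σ) (Finset.prod_nonneg fun _ _ => hπ _)

theorem prodExp_const {π : α → ℝ} (hπ : ∑ x, π x = 1) (r : ℝ) :
    prodExp π (fun _ : ι → α => r) = r := by
  have := prodExp_mul_left π r (fun _ : ι → α => 1)
  simpa [prodExp_one hπ] using this

theorem prodExp_mul_of_disjoint {π : α → ℝ} (hπ : ∑ x, π x = 1) {f g : (ι → α) → ℝ}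
    {S S' : Set ι} (hf : DependsOn f S) (hg : DependsOn g S') (hd : Disjoint S S') :
    prodExp π (fun σ => f σ * g σ) = prodExp π f * prodExp π g := by
  classical
  -- An arbitrary value with which functions of the coordinates in `S`, or in its complement, are
  -- evaluated on the remaining coordinates.
  obtain ⟨x0, -, -⟩ : ∃ x ∈ Finset.univ, π x ≠ 0 :=
    Finset.exists_ne_zero_of_sum_ne_zero (by rw [hπ]; exact one_ne_zero)
  set ψ := Equiv.piEquivPiSubtypeProd (· ∈ S) (fun _ : ι => α) with hψ
  have hsymm : ∀ x y v, ψ.symm (x, y) v = if h : v ∈ S then x ⟨v, h⟩ else y ⟨v, h⟩ :=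
    fun x y v => rfl
  set f' : ({v // v ∈ S} → α) → ℝ := fun x => f (ψ.symm (x, fun _ => x0)) with hf'
  set g' : ({v // v ∉ S} → α) → ℝ := fun y => g (ψ.symm (fun _ => x0, y)) with hg'
  have ef : ∀ p, f (ψ.symm p) = f' p.1 := fun p => hf fun v hv => by
    rw [hsymm, dif_pos hv, ← Prod.mk.eta (p := p), hsymm, dif_pos hv]
  have eg : ∀ p, g (ψ.symm p) = g' p.2 := fun p => hg fun v hv => by
    have : v ∉ S := fun h => Set.disjoint_left.1 hd h hv
    rw [hsymm, dif_neg this, ← Prod.mk.eta (p := p), hsymm, dif_neg this]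
  have ew : ∀ p : ({v // v ∈ S} → α) × ({v // v ∉ S} → α), ∏ v, π (ψ.symm p v) =
      (∏ v, π (p.1 v)) * ∏ v, π (p.2 v) := by
    intro p
    rw [← Fintype.prod_subtype_mul_prod_subtype (· ∈ S)]
    congr 1
    · refine Finset.prod_congr rfl fun v _ => ?_
      rw [← Prod.mk.eta (p := p), hsymm, dif_pos v.2]
    · refine Finset.prod_congr rfl fun v _ => ?_
      rw [← Prod.mk.eta (p := p), hsymm, dif_neg v.2]
  have key : ∀ (F : ({v // v ∈ S} → α) → ℝ) (G : ({v // v ∉ S} → α) → ℝ),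
      ∑ p : ({v // v ∈ S} → α) × ({v // v ∉ S} → α),
        ((∏ v, π (p.1 v)) * ∏ v, π (p.2 v)) * (F p.1 * G p.2) =
      (∑ x, (∏ v, π (x v)) * F x) * ∑ y, (∏ v, π (y v)) * G y := by
    intro F G
    rw [Finset.sum_mul_sum, Fintype.sum_prod_type]
    exact Finset.sum_congr rfl fun x _ => Finset.sum_congr rfl fun y _ => by ring
  have h1 : ∑ x : {v // v ∈ S} → α, (∏ v, π (x v)) * 1 = 1 := prodExp_one hπ
  have h2 : ∑ x : {v // v ∉ S} → α, (∏ v, π (x v)) * 1 = 1 := prodExp_one hπ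
  have e1 : prodExp π (fun σ => f σ * g σ) =
      (∑ x, (∏ v, π (x v)) * f' x) * ∑ y, (∏ v, π (y v)) * g' y := by
    rw [← key, prodExp, ← Equiv.sum_comp ψ.symm]
    exact Finset.sum_congr rfl fun p _ => by rw [ew, ef, eg]
  have e2 : prodExp π f = (∑ x, (∏ v, π (x v)) * f' x) := by
    rw [← mul_one (∑ x, (∏ v, π (x v)) * f' x), ← h2, ← key, prodExp, ← Equiv.sum_comp ψ.symm]
    exact Finset.sum_congr rfl fun p _ => by rw [ew, ef, mul_one]
  have e3 : prodExp π g = (∑ x, (∏ v, π (x v)) * g' x) := by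
    rw [← one_mul (∑ x, (∏ v, π (x v)) * g' x), ← h1, ← key, prodExp, ← Equiv.sum_comp ψ.symm]
    exact Finset.sum_congr rfl fun p _ => by rw [ew, eg, one_mul]
  rw [e1, e2, e3]

/-- Coordinates outside the range of `e` integrate to one, so the coordinates in the range have
again a product law. -/
theorem prodExp_comp_embedding {κ : Type*} [Fintype κ] [DecidableEq κ] {π : α → ℝ}
    (hπ : ∑ x, π x = 1) (e : κ ↪ ι) (H : (κ → α) → ℝ) :
    prodExp π (fun σ => H (σ ∘ e)) = ∑ x : κ → α, (∏ k, π (x k)) * H x := by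
  classical
  obtain ⟨x0, -, -⟩ : ∃ x ∈ Finset.univ, π x ≠ 0 :=
    Finset.exists_ne_zero_of_sum_ne_zero (by rw [hπ]; exact one_ne_zero)
  have h1 : prodExp π (fun σ => H (σ ∘ e)) = ∑ x : κ → α,
      prodExp π (fun σ => H x * if σ ∘ e = x then 1 else 0) := by
    rw [← prodExp_sum]
    congr 1
    ext σ
    simp
  rw [h1]
  refine Finset.sum_congr rfl fun x _ => ?_
  rw [prodExp_mul_left, mul_comm]
  congr 1
  set x' : ι → α := Function.extend e x fun _ => x0
  have hx' : ∀ k, x' (e k) = x k := fun k => e.injective.extend_apply _ _ _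
  have h2 : ∀ σ : ι → α, (∏ v, π (σ v)) * (if σ ∘ e = x then (1 : ℝ) else 0) =
      ∏ v, π (σ v) * if v ∈ Finset.univ.map e then (if σ v = x' v then 1 else 0) else 1 := by
    intro σ
    rw [Finset.prod_mul_distrib, Finset.prod_ite_mem, Finset.univ_inter, Finset.prod_map,
      Finset.prod_ite_zero]
    simp [funext_iff, hx']
  rw [prodExp]
  simp_rw [h2]
  rw [← Fintype.prod_sum (fun v y => π y * if v ∈ Finset.univ.map e then
    (if y = x' v then (1 : ℝ) else 0) else 1)]
  have h3 : ∀ v, (∑ y, π y * if v ∈ Finset.univ.map e then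
      (if y = x' v then (1 : ℝ) else 0) else 1) =
      if v ∈ Finset.univ.map e then π (x' v) else 1 := by
    intro v
    split_ifs
    · simp
    · simpa using hπ
  simp_rw [h3]
  rw [Finset.prod_ite_mem, Finset.univ_inter, Finset.prod_map]
  simp [hx']

theorem prodExp_apply {π : α → ℝ} (hπ : ∑ x, π x = 1) (v : ι) (f : α → ℝ) :
    prodExp π (fun σ => f (σ v)) = ∑ x, π x * f x :=
  sum_prod_mul_apply (fun _ => π) (fun _ => hπ) v f

/-- Conditional independence given the value at one common coordinate. -/
theorem prodExp_mul_of_inter_subset_singleton [DecidableEq α] {π : α → ℝ} (hπ : ∑ x, π x = 1)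
    {f g : (ι → α) → ℝ} {S S' : Set ι} (hf : DependsOn f S) (hg : DependsOn g S')
    (w : ι) (hw : S ∩ S' ⊆ {w}) (y : α) :
    prodExp π (fun σ => f σ * g σ * if σ w = y then 1 else 0) * π y =
      prodExp π (fun σ => f σ * if σ w = y then 1 else 0) *
        prodExp π (fun σ => g σ * if σ w = y then 1 else 0) := by
  -- Conditioning on `σ w = y` amounts to freezing the coordinate `w` at `y`. The frozen functions
  -- depend on disjoint sets of coordinates. The factor `π y` replaces a division, so `π y = 0`
  -- needs no separate treatment.
  have key : ∀ (h : (ι → α) → ℝ),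
      prodExp π (fun σ => h σ * if σ w = y then 1 else 0) =
        π y * prodExp π (fun σ => h (Function.update σ w y)) := by
    intro h
    have h1 : DependsOn (fun σ : ι → α => h (Function.update σ w y)) {w}ᶜ := by
      intro σ σ' hσ
      dsimp only
      congr 1
      ext v
      by_cases hv : v = w
      · subst hv; simp
      · simp [hv, hσ v hv]
    have h2 : DependsOn (fun σ : ι → α => if σ w = y then (1 : ℝ) else 0) {w} := by
      intro σ σ' hσ
      simp [hσ w rfl]
    have h3 := prodExp_mul_of_disjoint hπ h1 h2 disjoint_compl_left
    rw [prodExp_apply hπ w (fun x => if x = y then (1 : ℝ) else 0)] at h3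
    simp only [mul_ite, mul_one, mul_zero, Finset.sum_ite_eq', Finset.mem_univ, if_true] at h3
    rw [mul_comm, ← h3]
    congr 1
    ext σ
    split_ifs with h4
    · rw [mul_one, ← h4, Function.update_eq_self]
    · rw [mul_zero]
  have hdep : ∀ (h : (ι → α) → ℝ) (S : Set ι), DependsOn h S →
      DependsOn (fun σ : ι → α => h (Function.update σ w y)) (S \ {w}) := by
    intro h S hS σ σ' hσ
    refine hS fun v hv => ?_
    by_cases hvw : v = w
    · subst hvw; simp
    · simp [hvw, hσ v ⟨hv, hvw⟩]
  rw [key (fun σ => f σ * g σ), key f, key g,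
    prodExp_mul_of_disjoint hπ (hdep f S hf) (hdep g S' hg)]
  · ring
  · rw [Set.disjoint_left]
    exact fun v h1 h2 => h1.2 (hw ⟨h1.1, h2.1⟩)

end ProdExp

section BernoulliExp

variable {E : Type*} [Fintype E] [DecidableEq E]

/-- The expectation of a function of a random set that contains each `e` independently with
probability `p e`. -/
def bernExp (p : E → ℝ) (f : Finset E → ℝ) : ℝ :=
  ∑ G : Finset E, (∏ e, if e ∈ G then p e else 1 - p e) * f G

/-- Independence of the inclusions, as the expansion of a product of binomials over subsets. -/
theorem bernExp_prod (p h₁ h₀ : E → ℝ) :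
    bernExp p (fun G => ∏ e, if e ∈ G then h₁ e else h₀ e) =
      ∏ e, (p e * h₁ e + (1 - p e) * h₀ e) := by
  rw [Finset.prod_add, bernExp, Finset.powerset_univ]
  refine Finset.sum_congr rfl fun G _ => ?_
  rw [← Finset.prod_mul_distrib]
  have : ∀ e, ((if e ∈ G then p e else 1 - p e) * if e ∈ G then h₁ e else h₀ e) =
      if e ∈ G then p e * h₁ e else (1 - p e) * h₀ e := fun e => by split_ifs <;> rfl
  simp_rw [this]
  rw [Finset.prod_ite]
  congr 1
  · exact Finset.prod_congr (by ext; simp) fun _ _ => rfl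
  · exact Finset.prod_congr (by ext; simp) fun _ _ => rfl

theorem bernExp_mul_left (p : E → ℝ) (r : ℝ) (f : Finset E → ℝ) :
    bernExp p (fun G => r * f G) = r * bernExp p f := by
  simp only [bernExp, Finset.mul_sum]
  exact Finset.sum_congr rfl fun σ _ => by ring

end BernoulliExp

namespace ObservationModel

variable {q : ℕ} {T : Type*} [Fintype T] {F : ℕ} (M : ObservationModel q T F)

/-! ### Expectations in the planted model -/

/-- The joint law of the type and the colour of a variable. -/
def vertexLaw (x : T × Fin q) : ℝ := M.typeDist x.1 * M.prior x.1 x.2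

theorem vertexLaw_nonneg (x : T × Fin q) : 0 ≤ M.vertexLaw x :=
  mul_nonneg (M.typeDist_nonneg _) (M.prior_nonneg _ _)

theorem vertexLaw_sum : ∑ x, M.vertexLaw x = 1 := by
  simp only [vertexLaw, Fintype.sum_prod_type, ← Finset.mul_sum, M.prior_sum, mul_one,
    M.typeDist_sum]

open Classical in
/-- The expectation of a function of the outcome of the planted model. -/
def plantedExp (n : ℕ) (f : M.Outcome n → ℝ) : ℝ := ∑ ω, M.mass ω * f ω

-- Two-stage sampling: first independent labels, then independent edges given the labels.
open Classical in
theorem plantedExp_eq (n : ℕ) (f : M.Outcome n → ℝ) :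
    M.plantedExp n f = prodExp M.vertexLaw fun σ : Fin n → T × Fin q =>
      bernExp (M.plantedProb (fun v => (σ v).1) (fun v => (σ v).2))
        fun G => f (fun v => (σ v).1, fun v => (σ v).2, G) := by
  rw [plantedExp, prodExp, ← Equiv.sum_comp (Equiv.arrowProdEquivProdArrow (Fin n) _ _).symm]
  simp only [Fintype.sum_prod_type, bernExp, Finset.mul_sum]
  refine Finset.sum_congr rfl fun τ _ => Finset.sum_congr rfl fun c _ =>
    Finset.sum_congr rfl fun G _ => ?_
  simp only [mass, vertexLaw, Equiv.arrowProdEquivProdArrow, Equiv.coe_fn_symm_mk,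
    Finset.prod_mul_distrib]
  ring

theorem inclProb_nonneg (n : ℕ) (i : Fin F) (c : Fin (M.arity i) → Fin q) :
    0 ≤ M.inclProb n i c :=
  le_min zero_le_one (div_nonneg (M.dens_nonneg _ _) (by positivity))

theorem inclProb_le_one (n : ℕ) (i : Fin F) (c : Fin (M.arity i) → Fin q) :
    M.inclProb n i c ≤ 1 := min_le_left _ _

theorem plantedProb_nonneg {n : ℕ} (τ : Fin n → T) (c : Fin n → Fin q) (e : M.Factor n) :
    0 ≤ M.plantedProb τ c e := by
  unfold plantedProb
  split_ifs
  · exact M.inclProb_nonneg _ _ _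
  · exact le_rfl

theorem plantedProb_le_one {n : ℕ} (τ : Fin n → T) (c : Fin n → Fin q) (e : M.Factor n) :
    M.plantedProb τ c e ≤ 1 := by
  unfold plantedProb
  split_ifs
  · exact M.inclProb_le_one _ _ _
  · exact zero_le_one

theorem sum_prior_prod (i : Fin F) :
    ∑ c : Fin (M.arity i) → Fin q, ∏ k, M.prior (M.cls i k) (c k) = 1 := by
  rw [← Fintype.prod_sum (fun k c => M.prior (M.cls i k) c)]
  simp [M.prior_sum]

theorem nullProb_nonneg {n : ℕ} (e : M.Factor n) : 0 ≤ M.nullProb e :=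
  Finset.sum_nonneg fun _ _ => mul_nonneg
    (Finset.prod_nonneg fun _ _ => M.prior_nonneg _ _) (M.inclProb_nonneg _ _ _)

theorem nullProb_le {n : ℕ} (e : M.Factor n) {r : ℝ} (h : ∀ c, M.inclProb n e.1 c ≤ r) :
    M.nullProb e ≤ r := by
  calc M.nullProb e ≤ ∑ c : Fin (M.arity e.1) → Fin q,
        (∏ k, M.prior (M.cls e.1 k) (c k)) * r :=
      Finset.sum_le_sum fun c _ => mul_le_mul_of_nonneg_left (h c)
        (Finset.prod_nonneg fun _ _ => M.prior_nonneg _ _)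
    _ = r := by rw [← Finset.sum_mul, sum_prior_prod, one_mul]

theorem mass_nonneg {n : ℕ} (ω : M.Outcome n) : 0 ≤ M.mass ω := by
  refine mul_nonneg (mul_nonneg (Finset.prod_nonneg fun _ _ => M.typeDist_nonneg _)
    (Finset.prod_nonneg fun _ _ => M.prior_nonneg _ _)) (Finset.prod_nonneg fun e _ => ?_)
  split_ifs
  · exact M.plantedProb_nonneg _ _ _
  · linarith [M.plantedProb_le_one ω.1 ω.2.1 e]

theorem plantedExp_one (n : ℕ) : M.plantedExp n (fun _ => 1) = 1 := by
  classical
  rw [plantedExp_eq]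
  have : ∀ σ : Fin n → T × Fin q,
      bernExp (M.plantedProb (fun v => (σ v).1) (fun v => (σ v).2)) (fun _ => (1 : ℝ)) = 1 := by
    intro σ
    have := bernExp_prod (M.plantedProb (fun v => (σ v).1) (fun v => (σ v).2))
      (fun _ => 1) (fun _ => 1)
    simpa using this
  simp_rw [this]
  exact prodExp_one M.vertexLaw_sum

theorem plantedExp_mono {n : ℕ} {f g : M.Outcome n → ℝ} (h : ∀ ω, f ω ≤ g ω) :
    M.plantedExp n f ≤ M.plantedExp n g :=
  Finset.sum_le_sum fun ω _ => mul_le_mul_of_nonneg_left (h ω) (M.mass_nonneg ω)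

theorem plantedExp_mul_left {n : ℕ} (r : ℝ) (f : M.Outcome n → ℝ) :
    M.plantedExp n (fun ω => r * f ω) = r * M.plantedExp n f := by
  simp only [plantedExp, Finset.mul_sum]
  exact Finset.sum_congr rfl fun σ _ => by ring

theorem plantedExp_add {n : ℕ} (f g : M.Outcome n → ℝ) :
    M.plantedExp n (fun ω => f ω + g ω) = M.plantedExp n f + M.plantedExp n g := by
  simp only [plantedExp, mul_add, Finset.sum_add_distrib]

theorem plantedExp_sum {n : ℕ} {β : Type*} (s : Finset β) (f : β → M.Outcome n → ℝ) :
    M.plantedExp n (fun ω => ∑ b ∈ s, f b ω) = ∑ b ∈ s, M.plantedExp n (f b) := by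
  simp only [plantedExp, Finset.mul_sum]
  exact Finset.sum_comm

open Classical in
theorem plantedPr_eq {n : ℕ} (A : Set (M.Outcome n)) :
    M.plantedPr n A = M.plantedExp n (fun ω => if ω ∈ A then 1 else 0) := by
  simp [plantedPr, plantedExp]

theorem plantedPr_le_one {n : ℕ} (A : Set (M.Outcome n)) : M.plantedPr n A ≤ 1 := by
  classical
  rw [plantedPr_eq]
  exact (M.plantedExp_mono fun ω => by split_ifs <;> norm_num).trans (M.plantedExp_one n).le

theorem plantedPr_mono {n : ℕ} {A B : Set (M.Outcome n)} (h : ∀ ω, 0 < M.mass ω → ω ∈ A → ω ∈ B) :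
    M.plantedPr n A ≤ M.plantedPr n B := by
  classical
  refine Finset.sum_le_sum fun ω _ => ?_
  rcases (M.mass_nonneg ω).eq_or_lt with h0 | h0
  · simp [← h0]
  · by_cases hA : ω ∈ A
    · rw [if_pos hA, if_pos (h ω h0 hA)]
    · rw [if_neg hA]
      split_ifs
      · exact h0.le
      · exact le_rfl

/-- Chebyshev's inequality. -/
theorem one_sub_le_plantedPr {n : ℕ} (f : M.Outcome n → ℝ) (m : ℝ) {δ : ℝ} (hδ : 0 < δ) :
    1 - ((M.plantedExp n (fun ω => f ω * f ω) - M.plantedExp n f * M.plantedExp n f) +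
      (M.plantedExp n f - m) ^ 2) / δ ^ 2 ≤ M.plantedPr n {ω | |f ω - m| ≤ δ} := by
  classical
  -- The second moment about an arbitrary `m` is the variance plus the squared bias.
  have h1 : (M.plantedExp n (fun ω => f ω * f ω) - M.plantedExp n f * M.plantedExp n f) +
      (M.plantedExp n f - m) ^ 2 = M.plantedExp n (fun ω => (f ω - m) ^ 2) := by
    have : ∀ ω, (f ω - m) ^ 2 = f ω * f ω + ((-(2 * m)) * f ω + m ^ 2 * 1) := fun ω => by ring
    simp_rw [this]
    rw [plantedExp_add, plantedExp_add, plantedExp_mul_left, plantedExp_mul_left, plantedExp_one]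
    ring
  rw [h1, plantedPr_eq]
  have h2 : M.plantedExp n (fun _ => 1) ≤ M.plantedExp n (fun ω =>
      (if ω ∈ {ω | |f ω - m| ≤ δ} then 1 else 0) + (1 / δ ^ 2) * (f ω - m) ^ 2) := by
    refine M.plantedExp_mono fun ω => ?_
    split_ifs with h
    · have : 0 ≤ 1 / δ ^ 2 * (f ω - m) ^ 2 := by positivity
      linarith
    · rw [Set.mem_ofPred_eq, not_le] at h
      rw [zero_add, one_div, inv_mul_eq_div, le_div_iff₀ (by positivity), one_mul, ← sq_abs (f ω - m)]
      exact pow_le_pow_left₀ hδ.le h.le 2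
  rw [plantedExp_add, plantedExp_mul_left, plantedExp_one] at h2
  rw [div_eq_inv_mul, ← one_div]
  linarith

/-- Union bound for the intersection of two events of high probability. -/
theorem plantedPr_inter_ge {n : ℕ} (A B : Set (M.Outcome n)) :
    M.plantedPr n A + M.plantedPr n B - 1 ≤ M.plantedPr n (A ∩ B) := by
  classical
  have h := M.plantedExp_mono (n := n) (f := fun ω =>
    (if ω ∈ A then 1 else 0) + if ω ∈ B then (1 : ℝ) else 0)
    (g := fun ω => @ite _ (ω ∈ A ∩ B) (Classical.propDecidable _) 1 0 + 1) (fun ω => by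
      by_cases hA : ω ∈ A <;> by_cases hB : ω ∈ B <;> simp [hA, hB])
  rw [plantedExp_add, plantedExp_add, plantedExp_one, ← plantedPr_eq, ← plantedPr_eq,
    ← plantedPr_eq] at h
  linarith

end ObservationModel

/-! ### Sums over lists of given length -/

section ListSum

variable {α : Type*} [Fintype α] {β : Type*} [AddCommMonoid β]

/-- The sum of a function over all lists of length `m`. -/
def listSum (m : ℕ) (G : List α → β) : β := ∑ f : Fin m → α, G (List.ofFn f)

theorem listSum_zero (G : List α → β) : listSum 0 G = G [] := by
  simp [listSum]

theorem listSum_succ (m : ℕ) (G : List α → β) :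
    listSum (m + 1) G = ∑ a, listSum m fun l => G (a :: l) := by
  rw [listSum, ← Equiv.sum_comp (Fin.consEquiv fun _ => α), Fintype.sum_prod_type]
  refine Finset.sum_congr rfl fun a _ => Finset.sum_congr rfl fun f _ => ?_
  simp [List.ofFn_succ, Fin.consEquiv]

theorem listSum_mono {m : ℕ} {G G' : List α → ℝ} (h : ∀ l, l.length = m → G l ≤ G' l) :
    listSum m G ≤ listSum m G' :=
  Finset.sum_le_sum fun f _ => h _ (by simp)

theorem listSum_mul_left (m : ℕ) (r : ℝ) (G : List α → ℝ) :
    listSum m (fun l => r * G l) = r * listSum m G :=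
  (Finset.mul_sum _ _ _).symm

theorem listSum_add (m : ℕ) (G G' : List α → β) :
    listSum m (fun l => G l + G' l) = listSum m G + listSum m G' :=
  Finset.sum_add_distrib

variable {σ : Type*} (w : σ → α → ℝ) (next : σ → α → σ) (bad : σ → α → Prop)

/-- The weight of a list of steps, each step being weighted according to the current state. -/
def seqWeight : σ → List α → ℝ
  | _, [] => 1
  | x, a :: l => w x a * seqWeight (next x a) l

/-- A list of steps contains a bad step. -/
def SeqBad : σ → List α → Prop
  | _, [] => False
  | x, a :: l => bad x a ∨ SeqBad (next x a) l

-- A transfer-matrix estimate: each step contributes total weight at most `R`, each bad step at most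
-- `r`, and a union bound over the position of a bad step gives the factor `m`. The index of `Inv`
-- is the number of remaining steps, so that bounds on the growing state can be kept in it.
open Classical in
theorem listSum_seqWeight_le (Inv : ℕ → σ → Prop) {R r : ℝ} (hR : 1 ≤ R) (hr : 0 ≤ r)
    (hw : ∀ x a, 0 ≤ w x a) (hInv : ∀ m x a, Inv (m + 1) x → Inv m (next x a))
    (h1 : ∀ m x, Inv (m + 1) x → ∑ a, w x a ≤ R)
    (h2 : ∀ m x, Inv (m + 1) x → (∑ a, if bad x a then w x a else 0) ≤ r) :
    ∀ m x, Inv m x → listSum m (seqWeight w next x) ≤ R ^ m ∧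
      listSum m (fun l => if SeqBad next bad x l then seqWeight w next x l else 0) ≤
        m * (R ^ m * r) := by
  have hW : ∀ l x, 0 ≤ seqWeight w next x l := by
    intro l
    induction l with
    | nil => intro x; exact zero_le_one
    | cons a l ih => intro x; exact mul_nonneg (hw x a) (ih _)
  have hR0 : 0 ≤ R := zero_le_one.trans hR
  intro m
  induction m with
  | zero => intro x _; simp [listSum_zero, seqWeight, SeqBad]
  | succ m ih =>
    intro x hx
    have hih := fun a => ih (next x a) (hInv m x a hx)
    constructor
    · rw [listSum_succ]
      simp only [seqWeight, listSum_mul_left]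
      calc ∑ a, w x a * listSum m (seqWeight w next (next x a))
          ≤ ∑ a, w x a * R ^ m :=
            Finset.sum_le_sum fun a _ => mul_le_mul_of_nonneg_left (hih a).1 (hw x a)
        _ ≤ R * R ^ m := by
            rw [← Finset.sum_mul]
            exact mul_le_mul_of_nonneg_right (h1 m x hx) (by positivity)
        _ = R ^ (m + 1) := (pow_succ' R m).symm
    · rw [listSum_succ]
      calc ∑ a, listSum m (fun l => if SeqBad next bad x (a :: l) then
              seqWeight w next x (a :: l) else 0)
          -- Either the first step is bad or a later one is; the cases may overlap, hence an
          -- inequality.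
          ≤ ∑ a, ((if bad x a then w x a else 0) * listSum m (seqWeight w next (next x a)) +
              w x a * listSum m (fun l => if SeqBad next bad (next x a) l then
                seqWeight w next (next x a) l else 0)) := by
            refine Finset.sum_le_sum fun a _ => ?_
            rw [← listSum_mul_left, ← listSum_mul_left, ← listSum_add]
            refine listSum_mono fun l _ => ?_
            have h3 := mul_nonneg (hw x a) (hW l (next x a))
            simp only [SeqBad, seqWeight]
            by_cases hb : bad x a <;> by_cases hb' : SeqBad next bad (next x a) l <;>
              simp [hb, hb', h3]
        _ ≤ ∑ a, ((if bad x a then w x a else 0) * R ^ m + w x a * (m * (R ^ m * r))) := by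
            refine Finset.sum_le_sum fun a _ => add_le_add
              (mul_le_mul_of_nonneg_left (hih a).1 ?_)
              (mul_le_mul_of_nonneg_left (hih a).2 (hw x a))
            split_ifs
            · exact hw x a
            · exact le_rfl
        _ ≤ r * R ^ m + R * (m * (R ^ m * r)) := by
            rw [Finset.sum_add_distrib, ← Finset.sum_mul, ← Finset.sum_mul]
            exact add_le_add (mul_le_mul_of_nonneg_right (h2 m x hx) (by positivity))
              (mul_le_mul_of_nonneg_right (h1 m x hx) (by positivity))
        _ ≤ (m + 1 : ℕ) * (R ^ (m + 1) * r) := by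
            have : r * R ^ m ≤ R ^ (m + 1) * r := by
              rw [mul_comm]
              exact mul_le_mul_of_nonneg_right (pow_le_pow_right₀ hR (Nat.le_succ m)) hr
            push_cast
            rw [pow_succ] at *
            nlinarith

end ListSum

/-! ### Counting embeddings -/

section Embeddings

theorem card_embedding_fiber_le {m n : ℕ} (a : Fin m) (v : Fin n) :
    (Finset.univ.filter fun f : Fin m ↪ Fin n => f a = v).card ≤ n ^ (m - 1) := by
  classical
  calc (Finset.univ.filter fun f : Fin m ↪ Fin n => f a = v).card
      ≤ (Fintype.piFinset fun k => if k = a then {v} else (Finset.univ : Finset (Fin n))).card :=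
        Finset.card_le_card_of_injOn (fun f : Fin m ↪ Fin n => (f : Fin m → Fin n))
          (fun f hf => by
            simp only [Finset.coe_filter, Finset.mem_univ, true_and, Set.mem_ofPred_eq] at hf
            simp only [Finset.mem_coe, Fintype.mem_piFinset]
            intro k
            by_cases hk : k = a
            · simp [hk, hf]
            · simp [hk])
          (fun f _ g _ h => DFunLike.coe_injective h)
    _ = n ^ (m - 1) := by
        rw [Fintype.card_piFinset, ← Finset.mul_prod_erase _ _ (Finset.mem_univ a),
          Finset.prod_congr rfl (g := fun _ => n)]
        · simp [Finset.card_erase_of_mem]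
        · intro k hk
          simp [Finset.ne_of_mem_erase hk]

theorem card_embedding_fiber₂_le {m n : ℕ} {a b : Fin m} (hab : a ≠ b) (v u : Fin n) :
    (Finset.univ.filter fun f : Fin m ↪ Fin n => f a = v ∧ f b = u).card ≤ n ^ (m - 2) := by
  classical
  calc (Finset.univ.filter fun f : Fin m ↪ Fin n => f a = v ∧ f b = u).card
      ≤ (Fintype.piFinset fun k => if k = a then {v} else if k = b then {u} else
          (Finset.univ : Finset (Fin n))).card :=
        Finset.card_le_card_of_injOn (fun f : Fin m ↪ Fin n => (f : Fin m → Fin n))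
          (fun f hf => by
            simp only [Finset.coe_filter, Finset.mem_univ, true_and, Set.mem_ofPred_eq] at hf
            simp only [Finset.mem_coe, Fintype.mem_piFinset]
            intro k
            by_cases hk : k = a
            · simp [hk, hf.1]
            · by_cases hk' : k = b
              · simp [hk', hf.2, hab.symm]
              · simp [hk, hk'])
          (fun f _ g _ h => DFunLike.coe_injective h)
    _ = n ^ (m - 2) := by
        rw [Fintype.card_piFinset, ← Finset.mul_prod_erase _ _ (Finset.mem_univ a),
          ← Finset.mul_prod_erase _ _ (Finset.mem_erase.2 ⟨hab.symm, Finset.mem_univ b⟩),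
          Finset.prod_congr rfl (g := fun _ => n)]
        · simp [Finset.card_erase_of_mem, hab.symm, Nat.sub_sub]
        · intro k hk
          simp only [Finset.mem_erase] at hk
          simp [hk.1, hk.2.1]

/-- Composing with transpositions of the target shows that all `n` fibres have the same size, and
together they contain all embeddings. -/
theorem card_embedding_fiber {m n : ℕ} (a : Fin (m + 1)) (v : Fin n) :
    (Finset.univ.filter fun f : Fin (m + 1) ↪ Fin n => f a = v).card =
      (n - 1).descFactorial m := by
  classical
  have hsym : ∀ u : Fin n, (Finset.univ.filter fun f : Fin (m + 1) ↪ Fin n => f a = u).card =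
      (Finset.univ.filter fun f : Fin (m + 1) ↪ Fin n => f a = v).card := by
    intro u
    refine Finset.card_bij' (fun f _ => f.trans (Equiv.swap u v).toEmbedding)
      (fun f _ => f.trans (Equiv.swap u v).toEmbedding) ?_ ?_ ?_ ?_
    · intro f hf
      simp only [Finset.mem_filter, Finset.mem_univ, true_and] at hf
      simp [hf]
    · intro f hf
      simp only [Finset.mem_filter, Finset.mem_univ, true_and] at hf
      simp [hf]
    · intro f _
      ext k
      simp
    · intro f _
      ext k
      simp
  have h1 : ∑ u : Fin n, (Finset.univ.filter fun f : Fin (m + 1) ↪ Fin n => f a = u).card =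
      n.descFactorial (m + 1) := by
    rw [← Finset.card_eq_sum_card_fiberwise (fun _ _ => Finset.mem_coe.2 (Finset.mem_univ _)),
      Finset.card_univ, Fintype.card_embedding_eq]
    simp
  simp_rw [hsym] at h1
  have hn : 0 < n := v.pos
  obtain ⟨k, rfl⟩ := Nat.exists_eq_succ_of_ne_zero hn.ne'
  rw [Finset.sum_const, Finset.card_univ, Fintype.card_fin, smul_eq_mul] at h1
  refine Nat.eq_of_mul_eq_mul_left (Nat.succ_pos k) (h1.trans ?_)
  exact Nat.succ_descFactorial_succ k m

theorem abs_card_embedding_fiber_div_sub_one_le {m n : ℕ} (a : Fin m) (v : Fin n) (hn : m ≤ n) :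
    |((Finset.univ.filter fun f : Fin m ↪ Fin n => f a = v).card : ℝ) / (n : ℝ) ^ (m - 1) - 1| ≤
      (m : ℝ) ^ 2 / n := by
  have hn0 : (0 : ℝ) < n := by exact_mod_cast v.pos
  obtain ⟨m, rfl⟩ := Nat.exists_eq_succ_of_ne_zero a.pos.ne'
  have h1 := card_embedding_fiber_le a v
  have h2 := card_embedding_fiber (m := m) a v
  have h3 : ((n - m : ℕ) : ℝ) ^ m ≤
      (Finset.univ.filter fun f : Fin (m + 1) ↪ Fin n => f a = v).card := by
    rw [h2]
    have := Nat.pow_sub_le_descFactorial (n - 1) m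
    have e : n - 1 + 1 - m = n - m := by have := v.pos; omega
    rw [e] at this
    exact_mod_cast this
  simp only [Nat.succ_eq_add_one, Nat.add_sub_cancel] at h1 ⊢
  rw [abs_le]
  constructor
  -- Bernoulli's inequality; after the substitution `m` is the arity minus one.
  · have h4 : 1 - (m : ℝ) ^ 2 / n ≤ (1 - m / n) ^ m := by
      have := one_add_mul_le_pow (a := -(m / n : ℝ)) (by
        have : (m : ℝ) / n ≤ 1 := by
          rw [div_le_one hn0]
          exact_mod_cast (by omega : m ≤ n)
        linarith) m
      calc 1 - (m : ℝ) ^ 2 / n = 1 + m * -(m / n : ℝ) := by ring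
        _ ≤ _ := this
        _ = _ := by ring
    have h5 : (1 - m / n : ℝ) ^ m = ((n - m : ℕ) : ℝ) ^ m / n ^ m := by
      rw [Nat.cast_sub (by omega), ← div_pow, sub_div, div_self hn0.ne']
    have h6 : ((n - m : ℕ) : ℝ) ^ m / n ^ m ≤
        (Finset.univ.filter fun f : Fin (m + 1) ↪ Fin n => f a = v).card / (n : ℝ) ^ m := by
      gcongr
    have h7 : (m : ℝ) ^ 2 / n ≤ ((m + 1 : ℕ) : ℝ) ^ 2 / n := by
      gcongr
      omega
    linarith
  · have : ((Finset.univ.filter fun f : Fin (m + 1) ↪ Fin n => f a = v).card : ℝ) / (n : ℝ) ^ m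
        ≤ 1 := by
      rw [div_le_one (by positivity)]
      exact_mod_cast h1
    have : 0 ≤ ((m + 1 : ℕ) : ℝ) ^ 2 / n := by positivity
    linarith

end Embeddings

namespace ObservationModel

variable {q : ℕ} {T : Type*} [Fintype T] {F : ℕ} (M : ObservationModel q T F)

/-! ### Walks as lists of steps -/

/-- The variables of a potential observation. -/
def verts {n : ℕ} (e : M.Factor n) : Finset (Fin n) := Finset.univ.map e.2

theorem mem_verts {M : ObservationModel q T F} {n : ℕ} {e : M.Factor n} {v : Fin n} :
    v ∈ M.verts e ↔ ∃ k, e.2 k = v := by simp [verts]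

/-- A list of pairs (factor, next variable) is a walk from `v`. -/
def IsWalk {n : ℕ} : Fin n → List (M.Factor n × Fin n) → Prop
  | _, [] => True
  | v, a :: l => (v ∈ M.verts a.1 ∧ a.2 ∈ M.verts a.1 ∧ v ≠ a.2) ∧ IsWalk a.2 l

/-- Consecutive factors are distinct. -/
def IsNB {n : ℕ} (l : List (M.Factor n × Fin n)) : Prop := l.IsChain fun a b => a.1 ≠ b.1

/-- The variables of the factors of a walk and its starting point. -/
def walkVerts {n : ℕ} : Fin n → List (M.Factor n × Fin n) → Finset (Fin n)
  | v, [] => {v}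
  | v, a :: l => insert v (M.verts a.1 ∪ walkVerts a.2 l)

/-- Every factor of the walk meets the variables that precede it only in its current variable. -/
def GoodWalk {n : ℕ} : Finset (Fin n) → Fin n → List (M.Factor n × Fin n) → Prop
  | _, _, [] => True
  | S, v, a :: l => (∀ u ∈ M.verts a.1, u ∈ S → u = v) ∧ GoodWalk (S ∪ M.verts a.1) a.2 l

theorem mem_walkVerts_self {n : ℕ} (v : Fin n) (l : List (M.Factor n × Fin n)) :
    v ∈ M.walkVerts v l := by
  cases l <;> simp [walkVerts]

theorem verts_subset_walkVerts {n : ℕ} : ∀ (l : List (M.Factor n × Fin n)) (v : Fin n),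
    ∀ a ∈ l, M.verts a.1 ⊆ M.walkVerts v l := by
  intro l
  induction l with
  | nil => simp
  | cons b l ih =>
    intro v a ha
    rcases List.mem_cons.1 ha with rfl | ha
    · intro u hu
      simp [walkVerts, hu]
    · intro u hu
      simp [walkVerts, ih b.2 a ha hu]

open Classical in
/-- The variables and factors seen so far and the current variable of a walk. -/
def nextState {n : ℕ} (x : Finset (Fin n) × Finset (M.Factor n) × Fin n)
    (a : M.Factor n × Fin n) : Finset (Fin n) × Finset (M.Factor n) × Fin n :=
  (x.1 ∪ M.verts a.1, insert a.1 x.2.1, a.2)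

/-- The next factor is new and meets the variables seen so far in a second variable. -/
def IsDefect {n : ℕ} (x : Finset (Fin n) × Finset (M.Factor n) × Fin n)
    (a : M.Factor n × Fin n) : Prop :=
  a.1 ∉ x.2.1 ∧ ∃ u ∈ M.verts a.1, u ∈ x.1 ∧ u ≠ x.2.2

/-- Invariant: seen factors lie inside `S`, and a seen factor that contains the current variable is
not the next one. So the next factor is new, and without a defect it meets `S` only in `v`. Its exit
variable is then outside `S`, so the only seen factor containing it is the one just used, and
nonbacktracking forbids repeating that one. -/
theorem goodWalk_of_not_defect {M : ObservationModel q T F} {n : ℕ} :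
    ∀ (l : List (M.Factor n × Fin n)) (S : Finset (Fin n)) (E : Finset (M.Factor n)) (v : Fin n),
      M.IsWalk v l → M.IsNB l → (∀ e ∈ E, M.verts e ⊆ S) →
      (∀ e ∈ E, v ∈ M.verts e → ∀ a ∈ l.head?, e ≠ a.1) →
      ¬ SeqBad M.nextState M.IsDefect (S, E, v) l → M.GoodWalk S v l := by
  classical
  intro l
  induction l with
  | nil => intros; trivial
  | cons a l ih =>
    intro S E v hw hnb hE hv hd
    simp only [SeqBad, not_or, IsDefect, not_and, not_exists] at hd
    have haE : a.1 ∉ E := fun h => hv a.1 h hw.1.1 a (by simp) rfl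
    have hS : ∀ u ∈ M.verts a.1, u ∈ S → u = v := fun u hu huS => by
      by_contra h
      exact hd.1 haE u hu huS h
    refine ⟨hS, ih _ (insert a.1 E) a.2 hw.2 (List.IsChain.tail hnb) ?_ ?_ ?_⟩
    · intro e he
      rcases Finset.mem_insert.1 he with rfl | he
      · exact Finset.subset_union_right
      · exact (hE e he).trans Finset.subset_union_left
    · intro e he hae b hb
      rcases Finset.mem_insert.1 he with rfl | he
      · exact (List.isChain_cons.1 hnb).1 b hb
      · exact absurd (hS a.2 hw.1.2.1 (hE e he hae)).symm hw.1.2.2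
    · convert hd.2 using 2
      rw [nextState]

/-- The exit variable of each factor is fresh; consequently no factor of a good walk can repeat. -/
theorem exists_notMem_of_goodWalk {M : ObservationModel q T F} {n : ℕ} :
    ∀ (l : List (M.Factor n × Fin n)) (S : Finset (Fin n)) (v : Fin n),
      M.IsWalk v l → M.GoodWalk S v l → ∀ a ∈ l, ∃ u ∈ M.verts a.1, u ∉ S := by
  intro l
  induction l with
  | nil => simp
  | cons b l ih =>
    intro S v hw hg a ha
    rcases List.mem_cons.1 ha with rfl | ha
    · exact ⟨a.2, hw.1.2.1, fun h => hw.1.2.2 (hg.1 _ hw.1.2.1 h).symm⟩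
    · obtain ⟨u, hu, huS⟩ := ih _ _ hw.2 hg.2 a ha
      exact ⟨u, hu, fun h => huS (Finset.mem_union_left _ h)⟩

theorem nodup_of_goodWalk {M : ObservationModel q T F} {n : ℕ} :
    ∀ (l : List (M.Factor n × Fin n)) (S : Finset (Fin n)) (v : Fin n),
      M.IsWalk v l → M.GoodWalk S v l → (l.map Prod.fst).Nodup := by
  intro l
  induction l with
  | nil => simp
  | cons b l ih =>
    intro S v hw hg
    rw [List.map_cons, List.nodup_cons]
    refine ⟨fun h => ?_, ih _ _ hw.2 hg.2⟩
    obtain ⟨a, ha, hab⟩ := List.mem_map.1 h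
    obtain ⟨u, hu, huS⟩ := exists_notMem_of_goodWalk l _ _ hw.2 hg.2 a ha
    exact huS (Finset.mem_union_right _ (hab ▸ hu))

/-- The future of a good walk touches its past only in the current variable, the source of
conditional independence. -/
theorem walkVerts_inter_of_goodWalk {M : ObservationModel q T F} {n : ℕ} :
    ∀ (l : List (M.Factor n × Fin n)) (S : Finset (Fin n)) (v : Fin n),
      M.IsWalk v l → M.GoodWalk S v l → ∀ u ∈ M.walkVerts v l, u ∈ S → u = v := by
  intro l
  induction l with
  | nil => intro S v _ _ u hu _; simpa [walkVerts] using hu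
  | cons b l ih =>
    intro S v hw hg u hu huS
    rw [walkVerts, Finset.mem_insert, Finset.mem_union] at hu
    rcases hu with rfl | hu | hu
    · rfl
    · exact hg.1 u hu huS
    · have := ih _ _ hw.2 hg.2 u hu (Finset.mem_union_left _ huS)
      subst this
      exact hg.1 _ hw.1.2.1 huS

/-- The first factor that touches `S₀` is a defect. It is new, since a seen factor either lies in
`S₀`, hence misses the current variable, or is disjoint from `S₀`; and its variable in `S₀` is not
the current one. -/
theorem seqBad_of_meets {M : ObservationModel q T F} {n : ℕ} (S₀ : Finset (Fin n)) :
    ∀ (l : List (M.Factor n × Fin n)) (S : Finset (Fin n)) (E : Finset (M.Factor n)) (v : Fin n),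
      M.IsWalk v l → S₀ ⊆ S → v ∉ S₀ →
      (∀ e ∈ E, M.verts e ⊆ S₀ ∨ Disjoint (M.verts e) S₀) →
      (∃ u ∈ M.walkVerts v l, u ∈ S₀) → SeqBad M.nextState M.IsDefect (S, E, v) l := by
  classical
  intro l
  induction l with
  | nil =>
    rintro S E v _ _ hv _ ⟨u, hu, huS⟩
    rw [walkVerts, Finset.mem_singleton] at hu
    exact absurd (hu ▸ huS) hv
  | cons b l ih =>
    rintro S E v hw hS hv hE ⟨u, hu, huS⟩
    by_cases hb : ∃ u' ∈ M.verts b.1, u' ∈ S₀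
    · obtain ⟨u', hu', hu'S⟩ := hb
      refine Or.inl ⟨fun hbE => ?_, u', hu', hS hu'S, fun h => hv ((show u' = v from h) ▸ hu'S)⟩
      rcases hE _ hbE with h | h
      · exact hv (h hw.1.1)
      · exact Finset.disjoint_left.1 h hu' hu'S
    · push Not at hb
      refine Or.inr (ih _ _ _ hw.2 (hS.trans Finset.subset_union_left) (hb _ hw.1.2.1) ?_ ?_)
      · intro e he
        rcases Finset.mem_insert.1 he with rfl | he
        · exact Or.inr (Finset.disjoint_left.2 hb)
        · exact hE e he
      · rw [walkVerts, Finset.mem_insert, Finset.mem_union] at hu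
        rcases hu with rfl | hu | hu
        · exact absurd huS hv
        · exact absurd huS (hb u hu)
        · exact ⟨u, hu, huS⟩

/-! ### Weighted counts of walks -/

/-- The order of magnitude of the inclusion probability of a potential observation. -/
def factorWt (D : ℝ) {n : ℕ} (e : M.Factor n) : ℝ := D / (n : ℝ) ^ (M.arity e.1 - 1)

theorem factorWt_nonneg {D : ℝ} (hD : 0 ≤ D) {n : ℕ} (e : M.Factor n) : 0 ≤ M.factorWt D e :=
  div_nonneg hD (by positivity)

open Classical in
/-- Weight of a step of a walk in which the factors that were seen before are free. -/
def newWt (D : ℝ) {n : ℕ} (x : Finset (Fin n) × Finset (M.Factor n) × Fin n)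
    (a : M.Factor n × Fin n) : ℝ :=
  if x.2.2 ∈ M.verts a.1 ∧ a.2 ∈ M.verts a.1 ∧ x.2.2 ≠ a.2 then
    if a.1 ∈ x.2.1 then 1 else M.factorWt D a.1 else 0

open Classical in
/-- Weight of a step of a walk. -/
def fullWt (D : ℝ) {n : ℕ} (x : Finset (Fin n) × Finset (M.Factor n) × Fin n)
    (a : M.Factor n × Fin n) : ℝ :=
  if x.2.2 ∈ M.verts a.1 ∧ a.2 ∈ M.verts a.1 ∧ x.2.2 ≠ a.2 then M.factorWt D a.1 else 0

-- Each distinct factor outside `E` is paid for once, as in the bound for moments of edge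
-- indicators, where repeated occurrences cost nothing more.
open Classical in
theorem seqWeight_newWt (D : ℝ) {n : ℕ} : ∀ (l : List (M.Factor n × Fin n))
    (S : Finset (Fin n)) (E : Finset (M.Factor n)) (v : Fin n),
      seqWeight (M.newWt D) M.nextState (S, E, v) l =
        if M.IsWalk v l then ∏ e ∈ (l.map Prod.fst).toFinset \ E, M.factorWt D e else 0 := by
  intro l
  induction l with
  | nil => intros; simp [seqWeight, IsWalk]
  | cons a l ih =>
    intro S E v
    rw [seqWeight, nextState, ih, newWt]
    by_cases h1 : v ∈ M.verts a.1 ∧ a.2 ∈ M.verts a.1 ∧ v ≠ a.2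
    swap
    · simp [IsWalk, h1]
    by_cases h2 : M.IsWalk a.2 l
    swap
    · simp [IsWalk, h2]
    have h12 : M.IsWalk v (a :: l) := ⟨h1, h2⟩
    rw [if_pos h1, if_pos h2, if_pos h12, List.map_cons, List.toFinset_cons]
    by_cases h3 : a.1 ∈ E
    · rw [if_pos h3, one_mul, Finset.insert_sdiff_of_mem _ h3, Finset.insert_eq_of_mem h3]
    · rw [if_neg h3, Finset.insert_sdiff_of_notMem _ h3, Finset.sdiff_insert,
        ← Finset.insert_erase (s := insert a.1 ((l.map Prod.fst).toFinset \ E))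
          (Finset.mem_insert_self _ _), Finset.prod_insert (Finset.notMem_erase _ _)]
      congr 2
      ext x
      simp only [Finset.mem_erase, Finset.mem_insert]
      tauto

open Classical in
theorem seqWeight_fullWt (D : ℝ) {n : ℕ} : ∀ (l : List (M.Factor n × Fin n))
    (S : Finset (Fin n)) (E : Finset (M.Factor n)) (v : Fin n),
      seqWeight (M.fullWt D) M.nextState (S, E, v) l =
        if M.IsWalk v l then (l.map fun a => M.factorWt D a.1).prod else 0 := by
  intro l
  induction l with
  | nil => intros; simp [seqWeight, IsWalk]
  | cons a l ih =>
    intro S E v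
    rw [seqWeight, nextState, ih, fullWt]
    simp only [IsWalk]
    by_cases h1 : v ∈ M.verts a.1 ∧ a.2 ∈ M.verts a.1 ∧ v ≠ a.2
    swap
    · simp [h1]
    by_cases h2 : M.IsWalk a.2 l <;> simp [h1, h2]

-- Fixing one position leaves at most `n^(arity - 1)` embeddings, which cancels the denominator of
-- the weight.
open Classical in
theorem sum_factorWt_incident_le {D : ℝ} (hD : 0 ≤ D) {n : ℕ} (v : Fin n) :
    (∑ e : M.Factor n, if v ∈ M.verts e then M.factorWt D e else 0) ≤
      D * ∑ i, (M.arity i : ℝ) := by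
  have hn : (0 : ℝ) < n := by exact_mod_cast v.pos
  rw [Fintype.sum_sigma, Finset.mul_sum]
  refine Finset.sum_le_sum fun i _ => ?_
  calc _ ≤ ∑ f : Fin (M.arity i) ↪ Fin n, ∑ a : Fin (M.arity i),
        if f a = v then D / (n : ℝ) ^ (M.arity i - 1) else 0 := by
        refine Finset.sum_le_sum fun f _ => ?_
        split_ifs with h
        · obtain ⟨k, hk⟩ := mem_verts.1 h
          refine le_trans (le_of_eq ?_) (Finset.single_le_sum (fun a _ => ?_) (Finset.mem_univ k))
          · rw [if_pos hk]; rfl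
          · split_ifs <;> positivity
        · exact Finset.sum_nonneg fun a _ => by split_ifs <;> positivity
    _ = ∑ a : Fin (M.arity i), ((Finset.univ.filter fun f : Fin (M.arity i) ↪ Fin n =>
          f a = v).card : ℝ) * (D / (n : ℝ) ^ (M.arity i - 1)) := by
        rw [Finset.sum_comm]
        refine Finset.sum_congr rfl fun a _ => ?_
        rw [← Finset.sum_filter, Finset.sum_const, nsmul_eq_mul]
    _ ≤ ∑ a : Fin (M.arity i), D := by
        refine Finset.sum_le_sum fun a _ => ?_
        rw [mul_div_assoc', div_le_iff₀ (by positivity), mul_comm]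
        refine mul_le_mul_of_nonneg_left ?_ hD
        exact_mod_cast card_embedding_fiber_le a v
    _ = D * M.arity i := by simp [mul_comm]

-- A second variable prescribed in `S` leaves only `n^(arity - 2)` embeddings; this is where the
-- gain of `1/n` for a defect originates.
open Classical in
theorem sum_factorWt_incident₂_le {D : ℝ} (hD : 0 ≤ D) {n : ℕ} (v : Fin n)
    (S : Finset (Fin n)) :
    (∑ e : M.Factor n, if v ∈ M.verts e ∧ ∃ u ∈ M.verts e, u ∈ S ∧ u ≠ v then
      M.factorWt D e else 0) ≤ D * (∑ i, (M.arity i : ℝ) ^ 2) * S.card / n := by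
  have hn : (0 : ℝ) < n := by exact_mod_cast v.pos
  have hDn : 0 ≤ D / n := by positivity
  have e1 : D * (∑ i, (M.arity i : ℝ) ^ 2) * S.card / n =
      ∑ i, (M.arity i : ℝ) ^ 2 * (S.card * (D / n)) := by
    rw [← Finset.sum_mul]
    ring
  rw [Fintype.sum_sigma, e1]
  refine Finset.sum_le_sum fun i _ => ?_
  calc _ ≤ ∑ f : Fin (M.arity i) ↪ Fin n, ∑ a : Fin (M.arity i), ∑ b : Fin (M.arity i),
        ∑ u ∈ S, if a ≠ b ∧ f a = v ∧ f b = u then D / (n : ℝ) ^ (M.arity i - 1) else 0 := by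
        have hnn : ∀ (f : Fin (M.arity i) ↪ Fin n) (a b : Fin (M.arity i)) (u : Fin n),
            0 ≤ if a ≠ b ∧ f a = v ∧ f b = u then D / (n : ℝ) ^ (M.arity i - 1) else 0 := by
          intro f a b u
          split_ifs <;> positivity
        refine Finset.sum_le_sum fun f _ => ?_
        split_ifs with h
        · obtain ⟨hv, u, hu, huS, huv⟩ := h
          obtain ⟨k, hk⟩ := mem_verts.1 hv
          obtain ⟨k', hk'⟩ := mem_verts.1 hu
          have hkk : k ≠ k' := by
            rintro rfl
            exact huv (hk'.symm.trans hk)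
          refine le_trans ?_ (Finset.single_le_sum (fun a _ => Finset.sum_nonneg fun b _ =>
            Finset.sum_nonneg fun u _ => hnn f a b u) (Finset.mem_univ k))
          refine le_trans ?_ (Finset.single_le_sum (fun b _ =>
            Finset.sum_nonneg fun u _ => hnn f k b u) (Finset.mem_univ k'))
          refine le_trans (le_of_eq ?_) (Finset.single_le_sum (fun u _ => hnn f k k' u) huS)
          rw [if_pos ⟨hkk, hk, hk'⟩]; rfl
        · exact Finset.sum_nonneg fun a _ => Finset.sum_nonneg fun b _ =>
            Finset.sum_nonneg fun u _ => hnn f a b u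
    _ = ∑ a : Fin (M.arity i), ∑ b : Fin (M.arity i), ∑ u ∈ S,
          ∑ f : Fin (M.arity i) ↪ Fin n,
            if a ≠ b ∧ f a = v ∧ f b = u then D / (n : ℝ) ^ (M.arity i - 1) else 0 := by
        rw [Finset.sum_comm]
        refine Finset.sum_congr rfl fun a _ => ?_
        rw [Finset.sum_comm]
        refine Finset.sum_congr rfl fun b _ => ?_
        rw [Finset.sum_comm]
    _ ≤ ∑ a : Fin (M.arity i), ∑ b : Fin (M.arity i), ∑ u ∈ S, D / n := by
        refine Finset.sum_le_sum fun a _ => Finset.sum_le_sum fun b _ =>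
          Finset.sum_le_sum fun u _ => ?_
        by_cases hab : a = b
        · simp [hab, hDn]
        simp only [ne_eq, hab, not_false_eq_true, true_and]
        rw [← Finset.sum_filter, Finset.sum_const, nsmul_eq_mul]
        have h2 : 2 ≤ M.arity i := by
          have ha := a.2
          have hb := b.2
          have : (a : ℕ) ≠ b := fun h => hab (Fin.ext h)
          omega
        have h3 : ((Finset.univ.filter fun f : Fin (M.arity i) ↪ Fin n =>
            f a = v ∧ f b = u).card : ℝ) ≤ (n : ℝ) ^ (M.arity i - 2) := by
          exact_mod_cast card_embedding_fiber₂_le hab v u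
        have h4 : (n : ℝ) ^ (M.arity i - 1) = n ^ (M.arity i - 2) * n := by
          rw [← pow_succ]
          congr 1
          omega
        calc _ ≤ (n : ℝ) ^ (M.arity i - 2) * (D / (n : ℝ) ^ (M.arity i - 1)) :=
              mul_le_mul_of_nonneg_right h3 (by positivity)
          _ = D / n := by
              rw [h4]
              field_simp
    _ = _ := by
        simp only [Finset.sum_const, Finset.card_univ, Fintype.card_fin, nsmul_eq_mul]
        ring

/-- The sum of the arities. -/
def aritySum : ℝ := ∑ i, (M.arity i : ℝ)

theorem card_verts_le {n : ℕ} (e : M.Factor n) : ((M.verts e).card : ℝ) ≤ M.aritySum := by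
  rw [verts, Finset.card_map, Finset.card_univ, Fintype.card_fin, aritySum]
  exact Finset.single_le_sum (f := fun i => (M.arity i : ℝ)) (fun _ _ => Nat.cast_nonneg _)
    (Finset.mem_univ e.1)

theorem aritySum_nonneg : 0 ≤ M.aritySum := Finset.sum_nonneg fun _ _ => Nat.cast_nonneg _

/-- Bound for the weighted number of continuations of a walk. -/
def stepBound (D N : ℝ) : ℝ := M.aritySum * (N + D * M.aritySum) + 1

/-- Bound for the weighted number of continuations that close a cycle, times `n`. -/
def defectBound (D N : ℝ) : ℝ := M.aritySum * (D * (∑ i, (M.arity i : ℝ) ^ 2) * N)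

open Classical in
theorem sum_steps_le {n : ℕ} (f : M.Factor n → ℝ) (hf : ∀ e, 0 ≤ f e) (v : Fin n) :
    (∑ a : M.Factor n × Fin n, if v ∈ M.verts a.1 ∧ a.2 ∈ M.verts a.1 ∧ v ≠ a.2 then f a.1
      else 0) ≤ M.aritySum * ∑ e, if v ∈ M.verts e then f e else 0 := by
  rw [Fintype.sum_prod_type, Finset.mul_sum]
  refine Finset.sum_le_sum fun e _ => ?_
  dsimp only
  by_cases hv : v ∈ M.verts e
  · rw [if_pos hv]
    calc _ ≤ ∑ w : Fin n, if w ∈ M.verts e then f e else 0 := by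
          refine Finset.sum_le_sum fun w _ => ?_
          by_cases h : w ∈ M.verts e
          · rw [if_pos h]
            split_ifs
            · exact le_rfl
            · exact hf e
          · simp [h]
      _ = (M.verts e).card * f e := by simp
      _ ≤ _ := mul_le_mul_of_nonneg_right (M.card_verts_le e) (hf e)
  · simp [hv]

/-- The sets of seen factors and variables stay of size at most `N` for `m` more steps. -/
def StateBound (N : ℝ) {n : ℕ} (m : ℕ)
    (x : Finset (Fin n) × Finset (M.Factor n) × Fin n) : Prop :=
  (x.2.1.card : ℝ) + m ≤ N ∧ (x.1.card : ℝ) + M.aritySum * m ≤ N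

theorem StateBound.next {M : ObservationModel q T F} {N : ℝ} {n m : ℕ}
    {x : Finset (Fin n) × Finset (M.Factor n) × Fin n} (h : M.StateBound N (m + 1) x)
    (a : M.Factor n × Fin n) : M.StateBound N m (M.nextState x a) := by
  classical
  obtain ⟨h1, h2⟩ := h
  push_cast at h1 h2
  constructor
  · have : (((M.nextState x a).2.1.card : ℕ) : ℝ) ≤ x.2.1.card + 1 := by
      exact_mod_cast Finset.card_insert_le _ _
    linarith
  · have : (((M.nextState x a).1.card : ℕ) : ℝ) ≤ x.1.card + (M.verts a.1).card := by
      exact_mod_cast Finset.card_union_le _ _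
    have h3 := M.card_verts_le a.1
    linarith

open Classical in
theorem sum_defect_le {D : ℝ} (hD : 0 ≤ D) {N : ℝ} {n : ℕ} (S : Finset (Fin n))
    (hS : (S.card : ℝ) ≤ N) (v : Fin n) :
    (∑ a : M.Factor n × Fin n, if v ∈ M.verts a.1 ∧ a.2 ∈ M.verts a.1 ∧ v ≠ a.2 then
      (if ∃ u ∈ M.verts a.1, u ∈ S ∧ u ≠ v then M.factorWt D a.1 else 0) else 0) ≤
      M.defectBound D N / n := by
  refine (M.sum_steps_le (fun e => if ∃ u ∈ M.verts e, u ∈ S ∧ u ≠ v then M.factorWt D e else 0)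
    (fun e => by split_ifs <;> [exact M.factorWt_nonneg hD e; exact le_rfl]) v).trans ?_
  simp only [← ite_and]
  rw [defectBound, mul_div_assoc]
  refine mul_le_mul_of_nonneg_left ((M.sum_factorWt_incident₂_le hD v S).trans ?_)
    M.aritySum_nonneg
  have : 0 ≤ ∑ i, (M.arity i : ℝ) ^ 2 := by positivity
  gcongr

theorem stepBound_ge_one {D N : ℝ} (hD : 0 ≤ D) (hN : 0 ≤ N) : 1 ≤ M.stepBound D N := by
  have := M.aritySum_nonneg
  have : 0 ≤ M.aritySum * (N + D * M.aritySum) := by positivity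
  rw [stepBound]
  linarith

theorem defectBound_nonneg {D N : ℝ} (hD : 0 ≤ D) (hN : 0 ≤ N) : 0 ≤ M.defectBound D N := by
  have := M.aritySum_nonneg
  rw [defectBound]
  positivity

-- The next factor is either one of at most `N` seen factors, of weight one, or a new one, of total
-- weight at most `D * aritySum`; the next variable has at most `aritySum` choices. Defects are
-- controlled by the count with a second prescribed variable.
open Classical in
theorem listSum_newWt_le {D : ℝ} (hD : 0 ≤ D) {N : ℝ} (hN : 0 ≤ N) {n m : ℕ}
    {x : Finset (Fin n) × Finset (M.Factor n) × Fin n} (h : M.StateBound N m x) :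
    listSum m (seqWeight (M.newWt D) M.nextState x) ≤ M.stepBound D N ^ m ∧
    listSum m (fun l => if SeqBad M.nextState M.IsDefect x l then
      seqWeight (M.newWt D) M.nextState x l else 0) ≤
        m * (M.stepBound D N ^ m * (M.defectBound D N / n)) := by
  refine listSum_seqWeight_le _ _ _ (M.StateBound N) (M.stepBound_ge_one hD hN)
    (div_nonneg (M.defectBound_nonneg hD hN) (Nat.cast_nonneg _)) ?_
    (fun m x a hx => hx.next a) ?_ ?_ m x h
  · intro x a
    rw [newWt]
    split_ifs
    · exact zero_le_one
    · exact M.factorWt_nonneg hD _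
    · exact le_rfl
  · rintro m ⟨S, E, v⟩ ⟨hx, -⟩
    refine (M.sum_steps_le (fun e => if e ∈ E then 1 else M.factorWt D e)
      (fun e => by split_ifs <;> [exact zero_le_one; exact M.factorWt_nonneg hD e]) v).trans ?_
    rw [stepBound]
    refine le_add_of_le_of_nonneg (mul_le_mul_of_nonneg_left ?_ M.aritySum_nonneg) zero_le_one
    calc _ ≤ ∑ e, ((if e ∈ E then (1 : ℝ) else 0) +
          if v ∈ M.verts e then M.factorWt D e else 0) := by
          refine Finset.sum_le_sum fun e _ => ?_
          have := M.factorWt_nonneg hD e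
          split_ifs <;> linarith
      _ ≤ E.card + D * M.aritySum := by
          rw [Finset.sum_add_distrib]
          refine add_le_add (by simp) (M.sum_factorWt_incident_le hD v)
      _ ≤ N + D * M.aritySum := by
          have : (0 : ℝ) ≤ (m + 1 : ℕ) := Nat.cast_nonneg _
          simp only at hx
          linarith
  · rintro m ⟨S, E, v⟩ ⟨-, hx⟩
    have hS : (S.card : ℝ) ≤ N := by
      have : 0 ≤ M.aritySum * (m + 1 : ℕ) := mul_nonneg M.aritySum_nonneg (Nat.cast_nonneg _)
      simp only at hx
      linarith
    refine le_trans (Finset.sum_le_sum fun a _ => ?_) (M.sum_defect_le hD S hS v)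
    simp only [IsDefect, newWt]
    have := M.factorWt_nonneg hD a.1
    split_ifs <;> first | exact le_rfl | exact this | tauto |
      (rename_i h1 _ _ h2; exact absurd h1.2 h2)

-- Here repeated factors are paid for each time, so any second meeting with the seen variables, by a
-- new or an old factor, already costs `1/n`. This also covers backtracking walks.
open Classical in
theorem listSum_fullWt_le {D : ℝ} (hD : 0 ≤ D) {N : ℝ} (hN : 0 ≤ N) {n m : ℕ}
    {x : Finset (Fin n) × Finset (M.Factor n) × Fin n} (h : M.StateBound N m x) :
    listSum m (fun l => if SeqBad M.nextState
        (fun x a => ∃ u ∈ M.verts a.1, u ∈ x.1 ∧ u ≠ x.2.2) x l then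
      seqWeight (M.fullWt D) M.nextState x l else 0) ≤
        m * (M.stepBound D N ^ m * (M.defectBound D N / n)) := by
  refine (listSum_seqWeight_le _ _ _ (M.StateBound N) (M.stepBound_ge_one hD hN)
    (div_nonneg (M.defectBound_nonneg hD hN) (Nat.cast_nonneg _)) ?_
    (fun m x a hx => hx.next a) ?_ ?_ m x h).2
  · intro x a
    rw [fullWt]
    split_ifs
    · exact M.factorWt_nonneg hD _
    · exact le_rfl
  · rintro m ⟨S, E, v⟩ ⟨hx, -⟩
    refine (M.sum_steps_le (M.factorWt D) (M.factorWt_nonneg hD) v).trans ?_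
    rw [stepBound]
    refine le_add_of_le_of_nonneg (mul_le_mul_of_nonneg_left ?_ M.aritySum_nonneg) zero_le_one
    exact (M.sum_factorWt_incident_le hD v).trans (le_add_of_nonneg_left hN)
  · rintro m ⟨S, E, v⟩ ⟨-, hx⟩
    have hS : (S.card : ℝ) ≤ N := by
      have : 0 ≤ M.aritySum * (m + 1 : ℕ) := mul_nonneg M.aritySum_nonneg (Nat.cast_nonneg _)
      simp only at hx
      linarith
    refine le_trans (Finset.sum_le_sum fun a _ => ?_) (M.sum_defect_le hD S hS v)
    simp only [fullWt]
    have := M.factorWt_nonneg hD a.1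
    split_ifs <;> exact le_rfl

theorem goodWalk_iff_not_seqBad {M : ObservationModel q T F} {n : ℕ} :
    ∀ (l : List (M.Factor n × Fin n)) (S : Finset (Fin n)) (E : Finset (M.Factor n)) (v : Fin n),
      ¬ SeqBad M.nextState (fun x a => ∃ u ∈ M.verts a.1, u ∈ x.1 ∧ u ≠ x.2.2) (S, E, v) l ↔
        M.GoodWalk S v l := by
  classical
  intro l
  induction l with
  | nil => intros; simp [SeqBad, GoodWalk]
  | cons a l ih =>
    intro S E v
    rw [SeqBad, not_or, nextState, ih, GoodWalk]
    refine and_congr_left fun _ => ?_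
    push Not
    rfl

end ObservationModel

namespace ObservationModel

variable {q : ℕ} {T : Type*} [Fintype T] {F : ℕ} (M : ObservationModel q T F)

/-! ### The mean of a walk without defects -/

theorem typeDist_mul_meanDegree (i : Fin F) (a : Fin (M.arity i)) :
    M.typeDist (M.cls i a) * M.meanDegree i (M.cls i a) =
      M.avgDens i * ∏ k, M.typeDist (M.cls i k) := by
  rw [meanDegree]
  by_cases h : M.typeDist (M.cls i a) = 0
  · rw [Finset.prod_eq_zero (Finset.mem_univ a) h]; simp
  · field_simp

theorem sum_positions {n : ℕ} (e : M.Factor n) {a b : Fin (M.arity e.1)} {v w : Fin n}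
    (ha : e.2 a = v) (hb : e.2 b = w) {β : Type*} [AddCommMonoid β]
    (f : Fin (M.arity e.1) → Fin (M.arity e.1) → β) :
    (∑ a, ∑ b, if e.2 a = v ∧ e.2 b = w then f a b else 0) = f a b := by
  subst ha hb
  simp [ite_and]

theorem stepMat_eq {n : ℕ} (e : M.Factor n) {a b : Fin (M.arity e.1)} {v w : Fin n}
    (ha : e.2 a = v) (hb : e.2 b = w) : M.stepMat e v w = M.transMat e.1 a b :=
  M.sum_positions e ha hb _

/-- For the factors of walks, the minimum in the inclusion probability is vacuous. -/
def Sparse (n : ℕ) : Prop :=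
  ∀ i c, 2 ≤ M.arity i → M.inclProb n i c = M.dens i c / (n : ℝ) ^ (M.arity i - 1)

/-- The link between edges and transition matrices: with the colours at two positions fixed, the
averaged inclusion probability is the pair mass and the averaged null probability its product
version, so the difference is the covariance of `transMat_mul_prior`. -/
theorem sum_prior_inclProb {M : ObservationModel q T F} (hM : M.DetailedBalance) {n : ℕ}
    (hn : M.Sparse n) (e : M.Factor n) {a b : Fin (M.arity e.1)} (hab : a ≠ b) (α β : Fin q) :
    (∑ c : Fin (M.arity e.1) → Fin q, (∏ k, M.prior (M.cls e.1 k) (c k)) *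
      ((M.inclProb n e.1 c - M.nullProb e) * if c a = α ∧ c b = β then 1 else 0)) =
    M.avgDens e.1 * (M.transMat e.1 a b α β * M.prior (M.cls e.1 b) β) /
      (n : ℝ) ^ (M.arity e.1 - 1) := by
  have h2 : 2 ≤ M.arity e.1 := by
    have ha := a.2
    have hb := b.2
    have : (a : ℕ) ≠ b := fun h => hab (Fin.ext h)
    omega
  have hnull : M.nullProb e = M.avgDens e.1 / (n : ℝ) ^ (M.arity e.1 - 1) := by
    rw [nullProb, avgDens, Finset.sum_div]
    refine Finset.sum_congr rfl fun c _ => ?_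
    rw [hn _ _ h2, mul_div_assoc]
  rw [transMat_mul_prior hM, hnull, sub_div, pairMass, Finset.sum_div]
  have hP := sum_prod_mul_apply₂ (fun k => M.prior (M.cls e.1 k)) (fun k => M.prior_sum _) hab
    (fun x => if x = α then 1 else 0) (fun x => if x = β then 1 else 0)
  simp only [mul_ite, mul_one, mul_zero, Finset.sum_ite_eq', Finset.mem_univ, if_true] at hP
  rw [mul_assoc, ← hP, Finset.mul_sum, Finset.sum_div, ← Finset.sum_sub_distrib]
  refine Finset.sum_congr rfl fun c _ => ?_
  rw [hn _ _ h2]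
  by_cases h1 : c a = α <;> by_cases h3 : c b = β <;> simp [h1, h3]
  ring

open Classical in
/-- The centred inclusion probability of a factor, zero if it is not compatible. -/
def centredProb {n : ℕ} (σ : Fin n → T × Fin q) (e : M.Factor n) : ℝ :=
  if M.Compatible (fun v => (σ v).1) e then
    M.inclProb n e.1 (fun k => (σ (e.2 k)).2) - M.nullProb e else 0

theorem dependsOn_centredProb {n : ℕ} (e : M.Factor n) :
    DependsOn (fun σ : Fin n → T × Fin q => M.centredProb σ e) (M.verts e) := by
  intro σ σ' h
  have h' : ∀ k, σ (e.2 k) = σ' (e.2 k) := fun k => h _ (by simp [verts])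
  have hc : M.Compatible (fun v => (σ v).1) e ↔ M.Compatible (fun v => (σ' v).1) e := by
    simp only [Compatible, h']
  simp only [centredProb]
  by_cases h1 : M.Compatible (fun v => (σ v).1) e
  · rw [if_pos h1, if_pos (hc.1 h1)]
    simp only [h']
  · rw [if_neg h1, if_neg fun h2 => h1 (hc.2 h2)]

-- Compatibility selects a single assignment of types to the positions, which contributes the
-- product of the type masses; the colours are then averaged as in `sum_prior_inclProb`.
open Classical in
theorem prodExp_centredProb {M : ObservationModel q T F} (hM : M.DetailedBalance) {n : ℕ}
    (hn : M.Sparse n) (e : M.Factor n) {a b : Fin (M.arity e.1)} (hab : a ≠ b)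
    (x y : T × Fin q) :
    prodExp M.vertexLaw (fun σ : Fin n → T × Fin q => (M.centredProb σ e *
      if σ (e.2 a) = x then 1 else 0) * if σ (e.2 b) = y then 1 else 0) =
    if M.cls e.1 a = x.1 ∧ M.cls e.1 b = y.1 then
      M.avgDens e.1 * (∏ k, M.typeDist (M.cls e.1 k)) *
        (M.transMat e.1 a b x.2 y.2 * M.prior (M.cls e.1 b) y.2) / (n : ℝ) ^ (M.arity e.1 - 1)
    else 0 := by
  have h1 := prodExp_comp_embedding M.vertexLaw_sum e.2 (fun κ : Fin (M.arity e.1) → T × Fin q =>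
    ((if ∀ k, (κ k).1 = M.cls e.1 k then
      M.inclProb n e.1 (fun k => (κ k).2) - M.nullProb e else 0) *
      if κ a = x then 1 else 0) * if κ b = y then 1 else 0)
  have h2 : prodExp M.vertexLaw (fun σ : Fin n → T × Fin q => (M.centredProb σ e *
      if σ (e.2 a) = x then 1 else 0) * if σ (e.2 b) = y then 1 else 0) =
      prodExp M.vertexLaw (fun σ : Fin n → T × Fin q =>
      ((if ∀ k, ((σ ∘ e.2) k).1 = M.cls e.1 k then
      M.inclProb n e.1 (fun k => ((σ ∘ e.2) k).2) - M.nullProb e else 0) *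
      if (σ ∘ e.2) a = x then 1 else 0) * if (σ ∘ e.2) b = y then 1 else 0) := by
    congr 1
    ext σ
    congr 2
    exact if_congr Iff.rfl rfl rfl
  rw [h2, h1, ← Equiv.sum_comp (Equiv.arrowProdEquivProdArrow (Fin (M.arity e.1)) _ _).symm,
    Fintype.sum_prod_type, Finset.sum_eq_single (M.cls e.1)]
  · simp only [Equiv.arrowProdEquivProdArrow, Equiv.coe_fn_symm_mk, implies_true, if_true,
      vertexLaw, Finset.prod_mul_distrib]
    split_ifs with h
    · rw [mul_comm (M.avgDens e.1), mul_assoc (∏ k, M.typeDist (M.cls e.1 k)),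
        mul_div_assoc, ← sum_prior_inclProb hM hn e hab, Finset.mul_sum]
      refine Finset.sum_congr rfl fun c _ => ?_
      have e1 : ((M.cls e.1 a, c a) = x) ↔ c a = x.2 := by
        rw [Prod.ext_iff]; simp [h.1]
      have e2 : ((M.cls e.1 b, c b) = y) ↔ c b = y.2 := by
        rw [Prod.ext_iff]; simp [h.2]
      simp only [e1, e2]
      by_cases h3 : c a = x.2 <;> by_cases h4 : c b = y.2 <;> simp [h3, h4, mul_assoc]
    · refine Finset.sum_eq_zero fun c _ => ?_
      rw [not_and_or] at h
      rcases h with h | h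
      · have : ¬ (M.cls e.1 a, c a) = x := fun h' => h (congrArg Prod.fst h')
        simp [this]
      · have : ¬ (M.cls e.1 b, c b) = y := fun h' => h (congrArg Prod.fst h')
        simp [this]
  · intro τ _ hτ
    refine Finset.sum_eq_zero fun c _ => ?_
    have : ¬ ∀ k, τ k = M.cls e.1 k := fun h => hτ (funext h)
    simp [Equiv.arrowProdEquivProdArrow, this]
  · simp

variable (B : Matrix (T × Fin q) (T × Fin q) ℝ)

/-- The vector obtained by transporting the colour of the endpoint of a walk to its start. -/
def pathVec {n : ℕ} (σ : Fin n → T × Fin q) : Fin n → List (M.Factor n × Fin n) → Fin q → ℝ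
  | v, [] => fun β => B ((σ v).1, β) (σ v)
  | v, a :: l => fun β => ∑ β', M.stepMat a.1 v a.2 β β' * pathVec σ a.2 l β'

theorem dependsOn_pathVec {n : ℕ} : ∀ (l : List (M.Factor n × Fin n)) (v : Fin n) (β : Fin q),
    DependsOn (fun σ : Fin n → T × Fin q => M.pathVec B σ v l β) (M.walkVerts v l) := by
  intro l
  induction l with
  | nil =>
    intro v β σ σ' h
    simp only [pathVec, h v (by simp [walkVerts])]
  | cons a l ih =>
    intro v β σ σ' h
    simp only [pathVec]
    refine Finset.sum_congr rfl fun β' _ => ?_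
    congr 1
    exact ih a.2 β' fun u hu => h u (by
      rw [Finset.mem_coe] at hu
      simp [walkVerts, hu])

/-- The conditional mean of the contribution of a walk, given the type and the colour of its
start. -/
def pathMean {n : ℕ} : Fin n → List (M.Factor n × Fin n) → T → Fin q → Fin q → ℝ
  | _, [] => fun t β α => B (t, β) (t, α)
  | v, s :: l => fun t β α => ∑ a, ∑ b, if s.1.2 a = v ∧ s.1.2 b = s.2 then
      (open Classical in if M.cls s.1.1 a = t then
        M.meanDegree s.1.1 t / (n : ℝ) ^ (M.arity s.1.1 - 1) *
          ∑ γ, ∑ δ, M.transMat s.1.1 a b β γ * pathMean s.2 l (M.cls s.1.1 b) γ δ *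
            M.transMatAdj s.1.1 a b δ α else 0)
      else 0

theorem dependsOn_centredProd {n : ℕ} : ∀ (l : List (M.Factor n × Fin n)) (v : Fin n),
    DependsOn (fun σ : Fin n → T × Fin q => (l.map fun s => M.centredProb σ s.1).prod)
      (M.walkVerts v l) := by
  intro l v σ σ' h
  dsimp only
  congr 1
  refine List.map_congr_left fun s hs => M.dependsOn_centredProb s.1 fun u hu => h u ?_
  exact M.verts_subset_walkVerts l v s hs hu

theorem prodExp_eq_zero_of_vertexLaw {n : ℕ} [DecidableEq (T × Fin q)]
    (f : (Fin n → T × Fin q) → ℝ) (w : Fin n)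
    {y : T × Fin q} (hy : M.vertexLaw y = 0) :
    prodExp M.vertexLaw (fun σ => f σ * if σ w = y then 1 else 0) = 0 := by
  refine Finset.sum_eq_zero fun σ _ => ?_
  dsimp only
  split_ifs with h
  · rw [Finset.prod_eq_zero (Finset.mem_univ w) (by rw [h, hy]), zero_mul]
  · simp

-- The Markov property along a good walk. The first factor shares only `s.2` with the rest, so given
-- the label there the two parts are independent. Each step acts by a transition matrix on the left,
-- from `pathVec`, and by its adjoint on the right, from the change of the conditioning label by
-- Bayes' rule.
open Classical in
theorem prodExp_goodWalk {M : ObservationModel q T F} (hM : M.DetailedBalance) {n : ℕ}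
    (hn : M.Sparse n) : ∀ (l : List (M.Factor n × Fin n)) (S : Finset (Fin n)) (v : Fin n),
      M.IsWalk v l → M.GoodWalk S v l → v ∈ S → ∀ (x : T × Fin q) (β : Fin q),
      prodExp M.vertexLaw (fun σ : Fin n → T × Fin q =>
        ((l.map fun s => M.centredProb σ s.1).prod * M.pathVec B σ v l β) *
          if σ v = x then 1 else 0) = M.vertexLaw x * M.pathMean B v l x.1 β x.2 := by
  intro l
  induction l with
  | nil =>
    intro S v _ _ _ x β
    simp only [List.map_nil, List.prod_nil, one_mul, pathVec, pathMean]
    rw [prodExp_apply M.vertexLaw_sum v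
      (fun y => B (y.1, β) y * if y = x then 1 else 0)]
    simp
  | cons s l ih =>
    intro S v hw hg hv x β
    obtain ⟨⟨hvs, hws, hne⟩, hw'⟩ := hw
    obtain ⟨a, ha⟩ := mem_verts.1 hvs
    obtain ⟨b, hb⟩ := mem_verts.1 hws
    have hab : a ≠ b := fun h => hne (by rw [← ha, ← hb, h])
    set f : (Fin n → T × Fin q) → ℝ := fun σ =>
      M.centredProb σ s.1 * if σ (s.1.2 a) = x then 1 else 0 with hf
    set g : Fin q → (Fin n → T × Fin q) → ℝ := fun β' σ =>
      (l.map fun s => M.centredProb σ s.1).prod * M.pathVec B σ s.2 l β' with hg'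
    have hsplit : ∀ σ : Fin n → T × Fin q,
        (((s :: l).map fun s => M.centredProb σ s.1).prod * M.pathVec B σ v (s :: l) β) *
          (if σ v = x then 1 else 0) =
        ∑ β', ∑ y, M.transMat s.1.1 a b β β' *
          (f σ * g β' σ * if σ s.2 = y then 1 else 0) := by
      intro σ
      simp only [List.map_cons, List.prod_cons, pathVec, M.stepMat_eq s.1 ha hb, hf, hg', ha]
      simp only [mul_ite, mul_one, mul_zero, Finset.sum_ite_eq, Finset.mem_univ, if_true]
      split_ifs
      · rw [Finset.mul_sum]
        exact Finset.sum_congr rfl fun _ _ => by ring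
      · simp
    have hfd : DependsOn f (M.verts s.1 : Set (Fin n)) := by
      intro σ σ' h
      have h1 := M.dependsOn_centredProb s.1 h
      have h2 := h (s.1.2 a) (by simp [verts])
      simp only [hf]
      simp only at h1
      rw [h1, h2]
    have hgd : ∀ β', DependsOn (g β') (M.walkVerts s.2 l : Set (Fin n)) := by
      intro β' σ σ' h
      have h1 := M.dependsOn_centredProd l s.2 h
      have h2 := M.dependsOn_pathVec B l s.2 β' h
      simp only [hg']
      simp only at h1 h2
      rw [h1, h2]
    have hinter : (M.verts s.1 : Set (Fin n)) ∩ (M.walkVerts s.2 l : Set (Fin n)) ⊆ {s.2} := by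
      rintro u ⟨hu1, hu2⟩
      exact walkVerts_inter_of_goodWalk l _ _ hw' hg.2 u hu2 (Finset.mem_union_right _ hu1)
    have hkey : ∀ β' y, prodExp M.vertexLaw
        (fun σ => f σ * g β' σ * if σ s.2 = y then 1 else 0) =
        prodExp M.vertexLaw (fun σ => f σ * if σ s.2 = y then 1 else 0) *
          M.pathMean B s.2 l y.1 β' y.2 := by
      intro β' y
      have h1 := prodExp_mul_of_inter_subset_singleton M.vertexLaw_sum hfd (hgd β') s.2 hinter y
      rw [ih _ s.2 hw' hg.2 (Finset.mem_union_right _ hws) y β'] at h1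
      -- The conditional independence carries a factor `vertexLaw y`; labels of probability zero are
      -- handled before cancelling it.
      by_cases hy : M.vertexLaw y = 0
      · rw [M.prodExp_eq_zero_of_vertexLaw _ _ hy, M.prodExp_eq_zero_of_vertexLaw f _ hy, zero_mul]
      · refine mul_right_cancel₀ hy (h1.trans ?_)
        ring
    simp_rw [hsplit]
    rw [prodExp_sum]
    simp_rw [prodExp_sum, prodExp_mul_left, hkey, ← hb, hf]
    simp_rw [prodExp_centredProb hM hn s.1 hab]
    rw [pathMean]
    dsimp only
    rw [← hb, M.sum_positions s.1 ha rfl]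
    by_cases hx : M.cls s.1.1 a = x.1
    · rw [if_pos hx, ← mul_assoc, Finset.mul_sum]
      refine Finset.sum_congr rfl fun γ _ => ?_
      rw [Fintype.sum_prod_type, Finset.sum_eq_single (M.cls s.1.1 b), Finset.mul_sum]
      · refine Finset.sum_congr rfl fun δ _ => ?_
        rw [if_pos ⟨hx, rfl⟩, transMatAdj_apply, ← M.typeDist_mul_meanDegree s.1.1 a, ← hx,
          vertexLaw, ← hx, hb]
        -- A nonzero entry forces both priors to be positive, so `hDiag` is the prior and the
        -- adjoint supplies exactly the ratio of priors required.
        by_cases h0 : M.transMat s.1.1 a b x.2 δ = 0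
        · simp [h0]
        have h1 : 0 < M.prior (M.cls s.1.1 a) x.2 := lt_of_le_of_ne (M.prior_nonneg _ _)
          fun h => h0 (transMat_eq_zero_left hM h.symm)
        have h2 : 0 < M.prior (M.cls s.1.1 b) δ := lt_of_le_of_ne (M.prior_nonneg _ _)
          fun h => h0 (transMat_eq_zero_right hM h.symm)
        rw [hDiag, if_pos h2, hDiag, if_pos h1]
        field_simp
      · intro t _ ht
        refine Finset.sum_eq_zero fun δ _ => ?_
        rw [if_neg fun h => ht h.2.symm]
        simp
      · simp
    · rw [if_neg hx, mul_zero]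
      refine Finset.sum_eq_zero fun γ _ => Finset.sum_eq_zero fun y _ => ?_
      rw [if_neg fun h => hx h.1]
      simp

end ObservationModel

namespace ObservationModel

variable {q : ℕ} {T : Type*} [Fintype T] {F : ℕ} (M : ObservationModel q T F)

/-! ### The quadratic form as a sum over walks -/

variable (B : Matrix (T × Fin q) (T × Fin q) ℝ)

/-- The test vector whose block at `v` is the column of `B` at the type and colour of `v`. -/
def testVec {n : ℕ} (σ : Fin n → T × Fin q) : Fin n × Fin q → ℝ :=
  fun p => B ((σ p.1).1, p.2) (σ p.1)

/-- The types and colours of an outcome. -/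
def labels {n : ℕ} (ω : M.Outcome n) : Fin n → T × Fin q := fun v => (ω.1 v, ω.2.1 v)

/-- The quadratic form of the centred nonbacktracking power at the test vector. -/
def quadStat {n : ℕ} (s : ℕ) (ω : M.Outcome n) : ℝ :=
  M.hInner ω.1 (testVec B (M.labels ω)) (M.nbPower s ω.1 ω.2.2 *ᵥ testVec B (M.labels ω))

open Classical in
/-- The product of the centred edge indicators along a walk. -/
def edgeProd {n : ℕ} (G : Finset (M.Factor n)) (l : List (M.Factor n × Fin n)) : ℝ :=
  (l.map fun a => (if a.1 ∈ G then 1 else 0) - M.nullProb a.1).prod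

/-- The contribution of a walk apart from its edge indicators. -/
def walkForm {n : ℕ} (σ : Fin n → T × Fin q) (v : Fin n) (l : List (M.Factor n × Fin n)) : ℝ :=
  ∑ β, B ((σ v).1, β) (σ v) * (M.hDiag (σ v).1 β)⁻¹ * M.pathVec B σ v l β

/-- All factors of a walk are compatible with the types. -/
def WalkCompatible {n : ℕ} (σ : Fin n → T × Fin q) (l : List (M.Factor n × Fin n)) : Prop :=
  ∀ a ∈ l, M.Compatible (fun v => (σ v).1) a.1

theorem isWalk_ofFn {M : ObservationModel q T F} {n : ℕ} : ∀ {s : ℕ} (u : Fin n)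
    (f : Fin s → M.Factor n × Fin n), M.IsWalk u (List.ofFn f) ↔
      ∀ t : Fin s, (Fin.cons u (fun t => (f t).2) : Fin (s + 1) → Fin n) t.castSucc ∈
        M.verts (f t).1 ∧ (f t).2 ∈ M.verts (f t).1 ∧
        (Fin.cons u (fun t => (f t).2) : Fin (s + 1) → Fin n) t.castSucc ≠ (f t).2 := by
  intro s
  induction s with
  | zero => intro u f; simp [IsWalk]
  | succ s ih =>
    intro u f
    rw [List.ofFn_succ, IsWalk, ih, Fin.forall_fin_succ]
    refine and_congr Iff.rfl (forall_congr' fun t => ?_)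
    have : (Fin.cons u (fun t => (f t).2) : Fin (s + 2) → Fin n) t.succ.castSucc =
        (Fin.cons (f 0).2 (fun t : Fin s => (f t.succ).2) : Fin (s + 1) → Fin n) t.castSucc := by
      rw [← Fin.succ_castSucc, Fin.cons_succ]
      refine Fin.cases ?_ (fun k => ?_) t.castSucc
      · rfl
      · rfl
    rw [this]

theorem isNB_ofFn {M : ObservationModel q T F} {n s : ℕ} (f : Fin s → M.Factor n × Fin n) :
    M.IsNB (List.ofFn f) ↔ ∀ t t' : Fin s, (t' : ℕ) = t + 1 → (f t).1 ≠ (f t').1 := by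
  rw [IsNB, List.isChain_iff_getElem]
  constructor
  · intro h t t' htt'
    have h1 := h t (by rw [List.length_ofFn, ← htt']; exact t'.2)
    simp only [List.getElem_ofFn] at h1
    have e1 : t' = ⟨t + 1, by rw [← htt']; exact t'.2⟩ := Fin.ext htt'
    rw [e1]
    exact h1
  · intro h i hi
    rw [List.length_ofFn] at hi
    simp only [List.getElem_ofFn]
    exact h ⟨i, by omega⟩ ⟨i + 1, hi⟩ rfl

theorem isNBWalk_iff {M : ObservationModel q T F} {n s : ℕ} (σ : Fin n → T × Fin q) (u : Fin n)
    (f : Fin s → M.Factor n × Fin n) :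
    M.IsNBWalk (fun v => (σ v).1) (Fin.cons u (fun t => (f t).2)) (fun t => (f t).1) ↔
      M.IsWalk u (List.ofFn f) ∧ M.IsNB (List.ofFn f) ∧ M.WalkCompatible σ (List.ofFn f) := by
  rw [isWalk_ofFn, isNB_ofFn, IsNBWalk, WalkCompatible]
  simp only [List.forall_mem_ofFn_iff, mem_verts, Set.mem_range, Fin.cons_succ]
  constructor
  · rintro ⟨h1, h2⟩
    exact ⟨fun t => (h1 t).2, h2, fun t => (h1 t).1⟩
  · rintro ⟨h1, h2, h3⟩
    exact ⟨fun t => ⟨h3 t, h1 t⟩, h2⟩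

theorem pathVec_ofFn {n : ℕ} (σ : Fin n → T × Fin q) : ∀ {s : ℕ} (u : Fin n)
    (f : Fin s → M.Factor n × Fin n) (β : Fin q), M.pathVec B σ u (List.ofFn f) β =
      ∑ β', (List.ofFn fun t : Fin s => M.stepMat (f t).1
        ((Fin.cons u (fun t => (f t).2) : Fin (s + 1) → Fin n) t.castSucc) (f t).2).prod β β' *
        testVec B σ ((Fin.cons u (fun t => (f t).2) : Fin (s + 1) → Fin n) (Fin.last s), β') := by
  intro s
  induction s with
  | zero => intro u f β; simp [pathVec, testVec, Matrix.one_apply]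
  | succ s ih =>
    intro u f β
    rw [List.ofFn_succ, pathVec, List.ofFn_succ, List.prod_cons]
    simp only [Matrix.mul_apply, Finset.sum_mul]
    rw [Finset.sum_comm]
    refine Finset.sum_congr rfl fun γ _ => ?_
    rw [ih, Finset.mul_sum]
    refine Finset.sum_congr rfl fun β' _ => ?_
    have e1 : ∀ t : Fin s, (Fin.cons u (fun t => (f t).2) : Fin (s + 2) → Fin n) t.succ.castSucc =
        (Fin.cons (f 0).2 (fun t : Fin s => (f t.succ).2) : Fin (s + 1) → Fin n) t.castSucc := by
      intro t
      rw [← Fin.succ_castSucc, Fin.cons_succ]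
      refine Fin.cases ?_ (fun k => ?_) t.castSucc <;> rfl
    have e2 : (Fin.cons u (fun t => (f t).2) : Fin (s + 2) → Fin n) (Fin.last (s + 1)) =
        (Fin.cons (f 0).2 (fun t : Fin s => (f t.succ).2) : Fin (s + 1) → Fin n) (Fin.last s) := by
      rw [← Fin.succ_last, Fin.cons_succ]
      refine Fin.cases ?_ (fun k => ?_) (Fin.last s) <;> rfl
    simp only [e1, e2, Fin.castSucc_zero, Fin.cons_zero, mul_assoc]

open Classical in
/-- The contribution of a walk to the quadratic form. -/
def walkTerm {n : ℕ} (σ : Fin n → T × Fin q) (G : Finset (M.Factor n)) (v : Fin n)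
    (l : List (M.Factor n × Fin n)) : ℝ :=
  if M.IsWalk v l ∧ M.IsNB l ∧ M.WalkCompatible σ l then M.edgeProd G l * M.walkForm B σ v l
  else 0

theorem quadStat_eq {n : ℕ} (s : ℕ) (ω : M.Outcome n) :
    M.quadStat B s ω = ∑ v, listSum s (M.walkTerm B (M.labels ω) ω.2.2 v) := by
  classical
  set σ := M.labels ω with hσ
  have hτ : ω.1 = fun v => (σ v).1 := rfl
  have h1 : ∀ (u : Fin n) (β : Fin q), (M.nbPower s ω.1 ω.2.2 *ᵥ testVec B σ) (u, β) =
      ∑ f : Fin s → M.Factor n × Fin n,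
        if M.IsWalk u (List.ofFn f) ∧ M.IsNB (List.ofFn f) ∧ M.WalkCompatible σ (List.ofFn f) then
          M.edgeProd ω.2.2 (List.ofFn f) * M.pathVec B σ u (List.ofFn f) β else 0 := by
    intro u β
    have h2 : ∀ p, M.nbPower s ω.1 ω.2.2 (u, β) p = ∑ v : Fin (s + 1) → Fin n,
        ∑ e : Fin s → M.Factor n, if M.IsNBWalk ω.1 v e ∧ v 0 = u ∧ v (Fin.last s) = p.1 then
          M.walkWeight ω.2.2 v e β p.2 else 0 := by
      intro p
      simp only [nbPower, Matrix.of_apply, Matrix.sum_apply]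
      refine Finset.sum_congr rfl fun v _ => Finset.sum_congr rfl fun e _ => ?_
      split_ifs <;> rfl
    -- A sequence of variables and factors is recoded as a start together with pairs (factor, next
    -- variable).
    have h3 : ∀ (H : (Fin (s + 1) → Fin n) → (Fin s → M.Factor n) → ℝ),
        ∑ v : Fin (s + 1) → Fin n, ∑ e : Fin s → M.Factor n, H v e =
        ∑ u : Fin n, ∑ f : Fin s → M.Factor n × Fin n,
          H (Fin.cons u fun t => (f t).2) fun t => (f t).1 := by
      intro H
      rw [← Equiv.sum_comp (Fin.consEquiv fun _ => Fin n), Fintype.sum_prod_type]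
      refine Finset.sum_congr rfl fun u _ => ?_
      rw [← Equiv.sum_comp (Equiv.arrowProdEquivProdArrow (Fin s) (fun _ => M.Factor n)
        (fun _ => Fin n)).symm, Fintype.sum_prod_type, Finset.sum_comm]
      rfl
    simp only [Matrix.mulVec, dotProduct, h2, Finset.sum_mul]
    rw [Finset.sum_comm]
    simp_rw [Finset.sum_comm (s := (Finset.univ : Finset (Fin n × Fin q)))]
    rw [h3, Finset.sum_eq_single u]
    · refine Finset.sum_congr rfl fun f _ => ?_
      rw [hτ, isNBWalk_iff]
      by_cases hw : M.IsWalk u (List.ofFn f) ∧ M.IsNB (List.ofFn f) ∧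
        M.WalkCompatible σ (List.ofFn f)
      swap
      · simp [hw]
      simp only [Fin.cons_zero, hw, true_and]
      rw [Fintype.sum_prod_type, Finset.sum_eq_single
        ((Fin.cons u (fun t => (f t).2) : Fin (s + 1) → Fin n) (Fin.last s)), pathVec_ofFn,
        Finset.mul_sum]
      · refine Finset.sum_congr rfl fun β' _ => ?_
        simp only [if_true, walkWeight, Matrix.smul_apply, smul_eq_mul, edgeProd, List.map_ofFn,
          List.prod_ofFn, Fin.cons_succ, Function.comp_apply]
        ring
      · intro w _ hw
        simp [hw.symm]
      · simp
    · intro u' _ hu'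
      refine Finset.sum_eq_zero fun f _ => Finset.sum_eq_zero fun p _ => ?_
      rw [if_neg, zero_mul]
      rintro ⟨-, h, -⟩
      exact hu' h
    · simp
  rw [quadStat, hInner, Fintype.sum_prod_type, ← hσ]
  refine Finset.sum_congr rfl fun u _ => ?_
  simp only [h1, listSum, Finset.mul_sum]
  rw [Finset.sum_comm]
  refine Finset.sum_congr rfl fun f _ => ?_
  rw [walkTerm]
  split_ifs
  · rw [walkForm, Finset.mul_sum]
    refine Finset.sum_congr rfl fun β _ => ?_
    simp only [testVec, hτ]
    ring
  · simp

end ObservationModel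

namespace ObservationModel

variable {q : ℕ} {T : Type*} [Fintype T] {F : ℕ} (M : ObservationModel q T F)

/-! ### Moments of the edge indicators -/

/-- The moments of a centred edge indicator. -/
def edgeMoment {n : ℕ} (p : M.Factor n → ℝ) (e : M.Factor n) (m : ℕ) : ℝ :=
  p e * (1 - M.nullProb e) ^ m + (1 - p e) * (0 - M.nullProb e) ^ m

theorem edgeMoment_zero {n : ℕ} (p : M.Factor n → ℝ) (e : M.Factor n) :
    M.edgeMoment p e 0 = 1 := by
  simp [edgeMoment]

open Classical in
theorem edgeProd_eq {n : ℕ} (G : Finset (M.Factor n)) (l : List (M.Factor n × Fin n)) :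
    M.edgeProd G l = ∏ e, if e ∈ G then (1 - M.nullProb e) ^ (l.map Prod.fst).count e
      else (0 - M.nullProb e) ^ (l.map Prod.fst).count e := by
  have h1 : M.edgeProd G l =
      ((l.map Prod.fst).map fun e => (if e ∈ G then 1 else 0) - M.nullProb e).prod := by
    rw [edgeProd, List.map_map]; rfl
  rw [h1, Finset.prod_list_map_count]
  rw [Finset.prod_subset (Finset.subset_univ _)]
  · refine Finset.prod_congr rfl fun e _ => ?_
    split_ifs <;> rfl
  · intro e _ he
    rw [List.count_eq_zero_of_not_mem (fun h => he (List.mem_toFinset.2 h)), pow_zero]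

open Classical in
theorem bernExp_edgeProd {n : ℕ} (p : M.Factor n → ℝ) (l : List (M.Factor n × Fin n)) :
    bernExp p (fun G => M.edgeProd G l) =
      ∏ e, M.edgeMoment p e ((l.map Prod.fst).count e) := by
  simp only [edgeProd_eq]
  rw [bernExp_prod]
  rfl

theorem edgeProd_append {n : ℕ} (G : Finset (M.Factor n)) (l l' : List (M.Factor n × Fin n)) :
    M.edgeProd G (l ++ l') = M.edgeProd G l * M.edgeProd G l' := by
  simp [edgeProd]

open Classical in
theorem bernExp_edgeProd_mul {n : ℕ} (p : M.Factor n → ℝ) {l l' : List (M.Factor n × Fin n)}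
    (h : ∀ e, e ∈ l.map Prod.fst → e ∉ l'.map Prod.fst) :
    bernExp p (fun G => M.edgeProd G l * M.edgeProd G l') =
      bernExp p (fun G => M.edgeProd G l) * bernExp p (fun G => M.edgeProd G l') := by
  simp only [← edgeProd_append]
  rw [bernExp_edgeProd, bernExp_edgeProd, bernExp_edgeProd, ← Finset.prod_mul_distrib]
  refine Finset.prod_congr rfl fun e _ => ?_
  rw [List.map_append, List.count_append]
  by_cases he : e ∈ l.map Prod.fst
  · rw [List.count_eq_zero_of_not_mem (h e he), edgeMoment_zero, add_zero, mul_one]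
  · rw [List.count_eq_zero_of_not_mem he, edgeMoment_zero, zero_add, one_mul]

open Classical in
theorem bernExp_edgeProd_of_nodup {n : ℕ} (p : M.Factor n → ℝ)
    {l : List (M.Factor n × Fin n)} (h : (l.map Prod.fst).Nodup) :
    bernExp p (fun G => M.edgeProd G l) = (l.map fun a => p a.1 - M.nullProb a.1).prod := by
  rw [bernExp_edgeProd]
  have h1 : (l.map fun a => p a.1 - M.nullProb a.1).prod =
      ((l.map Prod.fst).map fun e => p e - M.nullProb e).prod := by
    rw [List.map_map]; rfl
  rw [h1, ← List.prod_toFinset _ h, ← Finset.prod_subset (Finset.subset_univ _)]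
  · refine Finset.prod_congr rfl fun e he => ?_
    rw [List.count_eq_one_of_mem h (List.mem_toFinset.1 he), edgeMoment]
    ring
  · intro e _ he
    rw [List.count_eq_zero_of_not_mem (fun h => he (List.mem_toFinset.2 h)), edgeMoment_zero]

/-- A constant that dominates the densities. -/
def densBound : ℝ := 1 + 2 * ∑ i, ∑ c, M.dens i c

theorem one_le_densBound : 1 ≤ M.densBound :=
  le_add_of_nonneg_right (mul_nonneg zero_le_two
    (Finset.sum_nonneg fun _ _ => Finset.sum_nonneg fun _ _ => M.dens_nonneg _ _))

theorem densBound_nonneg : 0 ≤ M.densBound := zero_le_one.trans M.one_le_densBound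

theorem inclProb_le {n : ℕ} (hn : 0 < n) (i : Fin F) (c : Fin (M.arity i) → Fin q) :
    M.inclProb n i c ≤ (M.densBound / 2) / (n : ℝ) ^ (M.arity i - 1) := by
  refine (min_le_right _ _).trans ?_
  have h1 : M.dens i c ≤ ∑ i, ∑ c, M.dens i c :=
    (Finset.single_le_sum (fun c _ => M.dens_nonneg i c) (Finset.mem_univ c)).trans
      (Finset.single_le_sum (f := fun i => ∑ c, M.dens i c)
        (fun i _ => Finset.sum_nonneg fun c _ => M.dens_nonneg i c) (Finset.mem_univ i))
  have h2 : M.dens i c ≤ M.densBound / 2 := by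
    rw [densBound]
    linarith
  gcongr

/-- Presence of the edge contributes at most `p e`; absence contributes at most the null
probability, whatever the exponent `m ≥ 1`. Each is at most half of the weight, hence the factor 2
in `densBound`. -/
theorem abs_edgeMoment_le {n : ℕ} (hn : 0 < n) {p : M.Factor n → ℝ} {e : M.Factor n}
    (h0 : 0 ≤ p e)
    (hp : p e ≤ (M.densBound / 2) / (n : ℝ) ^ (M.arity e.1 - 1)) {m : ℕ} (hm : m ≠ 0) :
    p e * |1 - M.nullProb e| ^ m + (1 - p e) * |0 - M.nullProb e| ^ m ≤
      M.factorWt M.densBound e := by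
  have hν0 := M.nullProb_nonneg e
  have hν1 : M.nullProb e ≤ 1 := M.nullProb_le e (M.inclProb_le_one n e.1)
  have hν := M.nullProb_le e (M.inclProb_le hn e.1)
  have e1 : |1 - M.nullProb e| ^ m ≤ 1 := by
    rw [abs_of_nonneg (by linarith)]
    exact pow_le_one₀ (by linarith) (by linarith)
  have e2 : |0 - M.nullProb e| ^ m ≤ M.nullProb e := by
    rw [zero_sub, abs_neg, abs_of_nonneg hν0]
    exact pow_le_of_le_one hν0 hν1 hm
  have e3 : M.factorWt M.densBound e = (M.densBound / 2) / (n : ℝ) ^ (M.arity e.1 - 1) +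
      (M.densBound / 2) / (n : ℝ) ^ (M.arity e.1 - 1) := by
    rw [factorWt]; ring
  rw [e3]
  have e4 : 0 ≤ |0 - M.nullProb e| ^ m := by positivity
  nlinarith

theorem plantedProb_le {n : ℕ} (hn : 0 < n) (τ : Fin n → T) (c : Fin n → Fin q)
    (e : M.Factor n) :
    M.plantedProb τ c e ≤ (M.densBound / 2) / (n : ℝ) ^ (M.arity e.1 - 1) := by
  unfold plantedProb
  split_ifs
  · exact M.inclProb_le hn _ _
  · have := M.densBound_nonneg
    positivity

open Classical in
theorem bernExp_abs_edgeProd_le {n : ℕ} (hn : 0 < n) (τ : Fin n → T) (c : Fin n → Fin q)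
    (l : List (M.Factor n × Fin n)) :
    bernExp (M.plantedProb τ c) (fun G => |M.edgeProd G l|) ≤
      ∏ e ∈ (l.map Prod.fst).toFinset, M.factorWt M.densBound e := by
  have h1 : ∀ G, |M.edgeProd G l| =
      ∏ e, if e ∈ G then |1 - M.nullProb e| ^ (l.map Prod.fst).count e
        else |0 - M.nullProb e| ^ (l.map Prod.fst).count e := by
    intro G
    rw [edgeProd_eq, Finset.abs_prod]
    refine Finset.prod_congr rfl fun e _ => ?_
    split_ifs <;> rw [abs_pow]
  simp only [h1]
  rw [bernExp_prod, ← Finset.prod_subset (Finset.subset_univ (l.map Prod.fst).toFinset)]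
  · refine Finset.prod_le_prod (fun e _ => ?_) fun e he => ?_
    · have := M.plantedProb_nonneg τ c e
      have := M.plantedProb_le_one τ c e
      have : 0 ≤ 1 - M.plantedProb τ c e := by linarith
      positivity
    · refine M.abs_edgeMoment_le hn (M.plantedProb_nonneg τ c e)
        (M.plantedProb_le hn τ c e) ?_
      exact (List.count_pos_iff.2 (List.mem_toFinset.1 he)).ne'
  · intro e _ he
    rw [List.count_eq_zero_of_not_mem (fun h => he (List.mem_toFinset.2 h))]
    ring

variable (B : Matrix (T × Fin q) (T × Fin q) ℝ)

/-! ### Size of the contribution of a walk -/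

theorem exists_walkForm_bound : ∃ K : ℝ, 1 ≤ K ∧ ∀ (n : ℕ) (σ : Fin n → T × Fin q) (v : Fin n)
    (l : List (M.Factor n × Fin n)), M.IsWalk v l →
      |M.walkForm B σ v l| ≤ K ^ (l.length + 1) := by
  set b : ℝ := ∑ x, ∑ y, |B x y| with hb
  set θ : ℝ := ∑ i, ∑ a, ∑ b, ∑ α, ∑ β, |M.transMat i a b α β| with hθ
  set η : ℝ := ∑ t, ∑ α, (M.hDiag t α)⁻¹ with hη
  have hB : ∀ x y, |B x y| ≤ b := fun x y =>
    (Finset.single_le_sum (f := fun y => |B x y|) (fun _ _ => abs_nonneg _)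
      (Finset.mem_univ y)).trans (Finset.single_le_sum (f := fun x => ∑ y, |B x y|)
        (fun _ _ => Finset.sum_nonneg fun _ _ => abs_nonneg _) (Finset.mem_univ x))
  have hh : ∀ t α, 0 ≤ (M.hDiag t α)⁻¹ := fun t α => (inv_pos.2 (M.hDiag_pos t α)).le
  have hη' : ∀ t α, (M.hDiag t α)⁻¹ ≤ η := fun t α =>
    (Finset.single_le_sum (f := fun α => (M.hDiag t α)⁻¹) (fun _ _ => hh _ _)
      (Finset.mem_univ α)).trans (Finset.single_le_sum (f := fun t => ∑ α, (M.hDiag t α)⁻¹)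
        (fun _ _ => Finset.sum_nonneg fun _ _ => hh _ _) (Finset.mem_univ t))
  have hΘ : ∀ i a b α β, |M.transMat i a b α β| ≤ θ := by
    intro i a b α β
    refine (Finset.single_le_sum (f := fun β => |M.transMat i a b α β|)
      (fun _ _ => abs_nonneg _) (Finset.mem_univ β)).trans ?_
    refine (Finset.single_le_sum (f := fun α => ∑ β, |M.transMat i a b α β|)
      (fun _ _ => by positivity) (Finset.mem_univ α)).trans ?_
    refine (Finset.single_le_sum (f := fun b => ∑ α, ∑ β, |M.transMat i a b α β|)
      (fun _ _ => by positivity) (Finset.mem_univ b)).trans ?_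
    refine (Finset.single_le_sum (f := fun a => ∑ b, ∑ α, ∑ β, |M.transMat i a b α β|)
      (fun _ _ => by positivity) (Finset.mem_univ a)).trans ?_
    exact Finset.single_le_sum (f := fun i => ∑ a, ∑ b, ∑ α, ∑ β, |M.transMat i a b α β|)
      (fun _ _ => by positivity) (Finset.mem_univ i)
  have hb0 : 0 ≤ b := by positivity
  have hθ0 : 0 ≤ θ := by positivity
  have hη0 : 0 ≤ η := Finset.sum_nonneg fun _ _ => Finset.sum_nonneg fun _ _ => hh _ _
  have hvec : ∀ (n : ℕ) (σ : Fin n → T × Fin q) (l : List (M.Factor n × Fin n)) (v : Fin n),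
      M.IsWalk v l → ∀ β, |M.pathVec B σ v l β| ≤ b * (q * θ) ^ l.length := by
    intro n σ l
    induction l with
    | nil => intro v _ β; simpa [pathVec] using hB _ _
    | cons s l ih =>
      intro v hw β
      obtain ⟨a, ha⟩ := mem_verts.1 hw.1.1
      obtain ⟨a', ha'⟩ := mem_verts.1 hw.1.2.1
      rw [pathVec, M.stepMat_eq s.1 ha ha']
      refine (Finset.abs_sum_le_sum_abs _ _).trans ?_
      calc ∑ β', |M.transMat s.1.1 a a' β β' * M.pathVec B σ s.2 l β'|
          ≤ ∑ _β' : Fin q, θ * (b * (q * θ) ^ l.length) := by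
            refine Finset.sum_le_sum fun β' _ => ?_
            rw [abs_mul]
            exact mul_le_mul (hΘ _ _ _ _ _) (ih s.2 hw.2 β') (abs_nonneg _) hθ0
        _ = b * (q * θ) ^ (s :: l).length := by
            rw [Finset.sum_const, Finset.card_univ, Fintype.card_fin, nsmul_eq_mul,
              List.length_cons, pow_succ]
            ring
  -- The summands dominate the cost of the endpoints and of a single step, so one base serves for
  -- all lengths.
  set K : ℝ := 1 + q * (b * η * b) + q * θ with hK
  have hq : (0 : ℝ) ≤ q := Nat.cast_nonneg q
  have hK1 : 1 ≤ K := by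
    have : 0 ≤ q * (b * η * b) := by positivity
    have : 0 ≤ q * θ := by positivity
    linarith
  refine ⟨K, hK1, fun n σ v l hw => ?_⟩
  refine (Finset.abs_sum_le_sum_abs _ _).trans ?_
  calc ∑ β, |B ((σ v).1, β) (σ v) * (M.hDiag (σ v).1 β)⁻¹ * M.pathVec B σ v l β|
      ≤ ∑ _β : Fin q, b * η * (b * (q * θ) ^ l.length) := by
        refine Finset.sum_le_sum fun β _ => ?_
        rw [abs_mul, abs_mul, abs_of_nonneg (hh _ _)]
        exact mul_le_mul (mul_le_mul (hB _ _) (hη' _ _) (hh _ _) hb0) (hvec n σ l v hw β)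
          (abs_nonneg _) (by positivity)
    _ = (q * (b * η * b)) * (q * θ) ^ l.length := by
        rw [Finset.sum_const, Finset.card_univ, Fintype.card_fin, nsmul_eq_mul]
        ring
    _ ≤ K * K ^ l.length := by
        have h1 : q * (b * η * b) ≤ K := by
          have : 0 ≤ q * θ := by positivity
          linarith
        have h2 : q * θ ≤ K := by
          have : 0 ≤ q * (b * η * b) := by positivity
          linarith
        gcongr
    _ = K ^ (l.length + 1) := (pow_succ' K _).symm

open Classical in
/-- The mean of the contribution of a walk to the quadratic form. -/
def termMean {n : ℕ} (v : Fin n) (l : List (M.Factor n × Fin n)) : ℝ :=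
  M.plantedExp n (fun ω => M.walkTerm B (M.labels ω) ω.2.2 v l)

theorem walkTerm_eq {n : ℕ} (σ : Fin n → T × Fin q) (G : Finset (M.Factor n)) (v : Fin n)
    (l : List (M.Factor n × Fin n)) : M.walkTerm B σ G v l =
      (open Classical in if M.IsWalk v l ∧ M.IsNB l ∧ M.WalkCompatible σ l then
        M.walkForm B σ v l else 0) * M.edgeProd G l := by
  rw [walkTerm]
  split_ifs
  · ring
  · ring

theorem abs_walkTerm_le {K : ℝ} (hK1 : 1 ≤ K)
    (hK : ∀ (n : ℕ) (σ : Fin n → T × Fin q) (v : Fin n)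
      (l : List (M.Factor n × Fin n)), M.IsWalk v l → |M.walkForm B σ v l| ≤ K ^ (l.length + 1))
    {n : ℕ} (σ : Fin n → T × Fin q) (G : Finset (M.Factor n)) (v : Fin n)
    (l : List (M.Factor n × Fin n)) :
    |M.walkTerm B σ G v l| ≤ K ^ (l.length + 1) * |M.edgeProd G l| := by
  rw [walkTerm_eq, abs_mul]
  refine mul_le_mul_of_nonneg_right ?_ (abs_nonneg _)
  split_ifs with h
  · exact hK n σ v l h.1
  · rw [abs_zero]; positivity

theorem abs_plantedExp_le {n : ℕ} (f : M.Outcome n → ℝ) :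
    |M.plantedExp n f| ≤ M.plantedExp n fun ω => |f ω| := by
  refine (Finset.abs_sum_le_sum_abs _ _).trans (le_of_eq ?_)
  refine Finset.sum_congr rfl fun ω _ => ?_
  rw [abs_mul, abs_of_nonneg (M.mass_nonneg ω)]

open Classical in
theorem plantedExp_abs_edgeProd_le {n : ℕ} (hn : 0 < n) (l : List (M.Factor n × Fin n)) :
    M.plantedExp n (fun ω => |M.edgeProd ω.2.2 l|) ≤
      ∏ e ∈ (l.map Prod.fst).toFinset, M.factorWt M.densBound e := by
  rw [plantedExp_eq]
  refine (prodExp_mono M.vertexLaw_nonneg fun σ =>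
    M.bernExp_abs_edgeProd_le hn _ _ l).trans_eq ?_
  exact prodExp_const M.vertexLaw_sum _

open Classical in
theorem abs_plantedExp_walkTerm_le {K : ℝ} (hK1 : 1 ≤ K)
    (hK : ∀ (n : ℕ) (σ : Fin n → T × Fin q) (v : Fin n)
      (l : List (M.Factor n × Fin n)), M.IsWalk v l → |M.walkForm B σ v l| ≤ K ^ (l.length + 1))
    {n : ℕ} (v : Fin n) (l : List (M.Factor n × Fin n)) :
    |M.termMean B v l| ≤ K ^ (l.length + 1) *
      ∏ e ∈ (l.map Prod.fst).toFinset, M.factorWt M.densBound e := by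
  refine (M.abs_plantedExp_le _).trans ?_
  refine (M.plantedExp_mono fun ω => M.abs_walkTerm_le B hK1 hK _ _ v l).trans ?_
  rw [plantedExp_mul_left]
  exact mul_le_mul_of_nonneg_left (M.plantedExp_abs_edgeProd_le v.pos l) (by positivity)

open Classical in
theorem abs_plantedExp_walkTerm_mul_le {K : ℝ} (hK1 : 1 ≤ K)
    (hK : ∀ (n : ℕ) (σ : Fin n → T × Fin q) (v : Fin n)
      (l : List (M.Factor n × Fin n)), M.IsWalk v l → |M.walkForm B σ v l| ≤ K ^ (l.length + 1))
    {n : ℕ} (v v' : Fin n) (l l' : List (M.Factor n × Fin n)) :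
    |M.plantedExp n (fun ω => M.walkTerm B (M.labels ω) ω.2.2 v l *
      M.walkTerm B (M.labels ω) ω.2.2 v' l')| ≤ K ^ (l.length + 1) * K ^ (l'.length + 1) *
      ∏ e ∈ (l.map Prod.fst).toFinset ∪ (l'.map Prod.fst).toFinset,
        M.factorWt M.densBound e := by
  refine (M.abs_plantedExp_le _).trans ?_
  have h : ∀ ω : M.Outcome n, |M.walkTerm B (M.labels ω) ω.2.2 v l *
      M.walkTerm B (M.labels ω) ω.2.2 v' l'| ≤
      K ^ (l.length + 1) * K ^ (l'.length + 1) * |M.edgeProd ω.2.2 (l ++ l')| := by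
    intro ω
    rw [abs_mul, edgeProd_append, abs_mul]
    calc _ ≤ (K ^ (l.length + 1) * |M.edgeProd ω.2.2 l|) *
          (K ^ (l'.length + 1) * |M.edgeProd ω.2.2 l'|) :=
          mul_le_mul (M.abs_walkTerm_le B hK1 hK _ _ v l) (M.abs_walkTerm_le B hK1 hK _ _ v' l')
            (abs_nonneg _) (by positivity)
      _ = _ := by ring
  refine (M.plantedExp_mono h).trans ?_
  rw [plantedExp_mul_left]
  refine mul_le_mul_of_nonneg_left ?_ (by positivity)
  refine (M.plantedExp_abs_edgeProd_le v.pos (l ++ l')).trans_eq ?_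
  rw [List.map_append, List.toFinset_append]

/-! ### Walks on disjoint sets of variables are uncorrelated -/

-- Disjoint variable sets force disjoint factor sets, so given the labels the edge products are
-- independent; each conditional mean depends only on labels along its own walk, and these are
-- independent too.
open Classical in
theorem plantedExp_walkTerm_mul {n : ℕ} {v v' : Fin n} {l l' : List (M.Factor n × Fin n)}
    (h : Disjoint (M.walkVerts v l) (M.walkVerts v' l')) :
    M.plantedExp n (fun ω => M.walkTerm B (M.labels ω) ω.2.2 v l *
      M.walkTerm B (M.labels ω) ω.2.2 v' l') = M.termMean B v l * M.termMean B v' l' := by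
  set c : Fin n → List (M.Factor n × Fin n) → (Fin n → T × Fin q) → ℝ := fun v l σ =>
    if M.IsWalk v l ∧ M.IsNB l ∧ M.WalkCompatible σ l then M.walkForm B σ v l else 0 with hc
  set g : List (M.Factor n × Fin n) → (Fin n → T × Fin q) → ℝ := fun l σ =>
    bernExp (M.plantedProb (fun v => (σ v).1) (fun v => (σ v).2)) (fun G => M.edgeProd G l)
    with hg
  have hlab : ∀ (σ : Fin n → T × Fin q) (G : Finset (M.Factor n)),
      M.labels (fun v => (σ v).1, fun v => (σ v).2, G) = σ := fun _ _ => rfl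
  have hd : ∀ v l, DependsOn (fun σ => c v l σ * g l σ) (M.walkVerts v l : Set (Fin n)) := by
    intro v l σ σ' hσ
    have hcomp : ∀ a ∈ l, (M.Compatible (fun v => (σ v).1) a.1 ↔
        M.Compatible (fun v => (σ' v).1) a.1) ∧ ∀ k, σ (a.1.2 k) = σ' (a.1.2 k) := by
      intro a ha
      have h1 : ∀ k, σ (a.1.2 k) = σ' (a.1.2 k) := fun k =>
        hσ _ (M.verts_subset_walkVerts l v a ha (mem_verts.2 ⟨k, rfl⟩))
      exact ⟨by simp only [Compatible, h1], h1⟩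
    have hcl : M.WalkCompatible σ l ↔ M.WalkCompatible σ' l :=
      forall₂_congr fun a ha => (hcomp a ha).1
    have h1 : c v l σ = c v l σ' := by
      have h2 : M.walkForm B σ v l = M.walkForm B σ' v l := by
        simp only [walkForm]
        refine Finset.sum_congr rfl fun β _ => ?_
        have h3 := M.dependsOn_pathVec B l v β hσ
        simp only at h3
        rw [h3, hσ v (M.mem_walkVerts_self v l)]
      simp only [hc, hcl, h2]
    have h4 : g l σ = g l σ' := by
      simp only [hg, bernExp_edgeProd]
      refine Finset.prod_congr rfl fun e _ => ?_
      by_cases he : e ∈ l.map Prod.fst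
      · obtain ⟨a, ha, rfl⟩ := List.mem_map.1 he
        have h5 : M.plantedProb (fun v => (σ v).1) (fun v => (σ v).2) a.1 =
            M.plantedProb (fun v => (σ' v).1) (fun v => (σ' v).2) a.1 := by
          simp only [plantedProb, (hcomp a ha).1, (hcomp a ha).2]
        simp only [edgeMoment, h5]
      · rw [List.count_eq_zero_of_not_mem he, edgeMoment_zero, edgeMoment_zero]
    simp only [h1, h4]
  have e1 : ∀ v l, M.termMean B v l = prodExp M.vertexLaw (fun σ => c v l σ * g l σ) := by
    intro v l
    rw [termMean, plantedExp_eq]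
    simp only [hlab, walkTerm_eq, bernExp_mul_left, hg, hc]
  rw [e1, e1, ← prodExp_mul_of_disjoint M.vertexLaw_sum (hd v l) (hd v' l')
    (by exact_mod_cast h), plantedExp_eq]
  congr 1
  ext σ
  have e2 : ∀ G, M.walkTerm B σ G v l * M.walkTerm B σ G v' l' =
      (c v l σ * c v' l' σ) * (M.edgeProd G l * M.edgeProd G l') := by
    intro G
    rw [walkTerm_eq, walkTerm_eq]
    ring
  simp only [hlab, e2]
  rw [bernExp_mul_left, bernExp_edgeProd_mul]
  · ring
  · intro e he he'
    obtain ⟨a, ha, rfl⟩ := List.mem_map.1 he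
    obtain ⟨a', ha', haa⟩ := List.mem_map.1 he'
    -- A common factor would yield a common variable, because arities are positive.
    have hk : a.1.2 ⟨0, M.arity_pos a.1.1⟩ ∈ M.verts a.1 := mem_verts.2 ⟨_, rfl⟩
    refine Finset.disjoint_left.1 h (M.verts_subset_walkVerts l v a ha hk) ?_
    exact M.verts_subset_walkVerts l' v' a' ha' (haa ▸ hk)

end ObservationModel

namespace ObservationModel

variable {q : ℕ} {T : Type*} [Fintype T] {F : ℕ} (M : ObservationModel q T F)

/-! ### Summing the means of all walks -/

open Classical in
/-- An entry of the conjugation of a `q × q` matrix by a transition matrix, times the mean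
degree. -/
def stepOp (i : Fin F) (a b : Fin (M.arity i)) (t : T) (β α : Fin q)
    (X : Fin q → Fin q → ℝ) : ℝ :=
  if M.cls i a = t then M.meanDegree i t *
    ∑ γ, ∑ δ, M.transMat i a b β γ * X γ δ * M.transMatAdj i a b δ α else 0

theorem stepOp_sum (i : Fin F) (a b : Fin (M.arity i)) (t : T) (β α : Fin q) {κ : Type*}
    (s : Finset κ) (X : κ → Fin q → Fin q → ℝ) :
    M.stepOp i a b t β α (fun γ δ => ∑ k ∈ s, X k γ δ) =
      ∑ k ∈ s, M.stepOp i a b t β α (X k) := by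
  simp only [stepOp]
  split_ifs
  · simp only [Finset.mul_sum, Finset.sum_mul]
    rw [Finset.sum_comm (s := s)]
    refine Finset.sum_congr rfl fun γ _ => ?_
    rw [Finset.sum_comm (s := s)]
  · simp

theorem stepOp_sub (i : Fin F) (a b : Fin (M.arity i)) (t : T) (β α : Fin q)
    (X Y : Fin q → Fin q → ℝ) :
    M.stepOp i a b t β α (fun γ δ => X γ δ - Y γ δ) =
      M.stepOp i a b t β α X - M.stepOp i a b t β α Y := by
  simp only [stepOp]
  split_ifs
  · rw [← mul_sub, ← Finset.sum_sub_distrib]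
    congr 1
    refine Finset.sum_congr rfl fun γ _ => ?_
    rw [← Finset.sum_sub_distrib]
    exact Finset.sum_congr rfl fun δ _ => by ring
  · simp

/-- The operator norm of `stepOp` for the sup norm. -/
def stepCoef (i : Fin F) (a b : Fin (M.arity i)) (β α : Fin q) : ℝ :=
  M.meanDegree i (M.cls i a) * ∑ γ, ∑ δ, |M.transMat i a b β γ| * |M.transMatAdj i a b δ α|

theorem stepCoef_nonneg (i : Fin F) (a b : Fin (M.arity i)) (β α : Fin q) :
    0 ≤ M.stepCoef i a b β α :=
  mul_nonneg (M.meanDegree_nonneg _ _) (by positivity)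

/-- The sum of all coefficients of the influence operator. -/
def coefSum : ℝ := ∑ β, ∑ α, ∑ i, ∑ a, ∑ b, M.stepCoef i a b β α

theorem sum_stepCoef_le (β α : Fin q) :
    ∑ i, ∑ a, ∑ b, M.stepCoef i a b β α ≤ M.coefSum := by
  have h : ∀ β α, 0 ≤ ∑ i, ∑ a, ∑ b, M.stepCoef i a b β α := fun β α =>
    Finset.sum_nonneg fun i _ => Finset.sum_nonneg fun a _ => Finset.sum_nonneg fun b _ =>
      M.stepCoef_nonneg i a b β α
  exact (Finset.single_le_sum (f := fun α => ∑ i, ∑ a, ∑ b, M.stepCoef i a b β α)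
    (fun α _ => h β α) (Finset.mem_univ α)).trans
    (Finset.single_le_sum (f := fun β => ∑ α, ∑ i, ∑ a, ∑ b, M.stepCoef i a b β α)
      (fun β _ => Finset.sum_nonneg fun α _ => h β α) (Finset.mem_univ β))

theorem stepCoef_le (i : Fin F) (a b : Fin (M.arity i)) (β α : Fin q) :
    M.stepCoef i a b β α ≤ M.coefSum := by
  refine le_trans ?_ (M.sum_stepCoef_le β α)
  have h := M.stepCoef_nonneg
  exact ((Finset.single_le_sum (f := fun b => M.stepCoef i a b β α)
    (fun b _ => h i a b β α) (Finset.mem_univ b)).trans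
    (Finset.single_le_sum (f := fun a => ∑ b, M.stepCoef i a b β α)
      (fun a _ => Finset.sum_nonneg fun b _ => h i a b β α) (Finset.mem_univ a))).trans
    (Finset.single_le_sum (f := fun i => ∑ a, ∑ b, M.stepCoef i a b β α)
      (fun i _ => Finset.sum_nonneg fun a _ => Finset.sum_nonneg fun b _ => h i a b β α)
      (Finset.mem_univ i))

theorem coefSum_nonneg : 0 ≤ M.coefSum :=
  Finset.sum_nonneg fun β _ => Finset.sum_nonneg fun α _ => Finset.sum_nonneg fun i _ =>
    Finset.sum_nonneg fun a _ => Finset.sum_nonneg fun b _ => M.stepCoef_nonneg i a b β α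

theorem abs_stepOp_le (i : Fin F) (a b : Fin (M.arity i)) (t : T) (β α : Fin q)
    {X : Fin q → Fin q → ℝ} {x : ℝ} (hX : ∀ γ δ, |X γ δ| ≤ x) :
    |M.stepOp i a b t β α X| ≤ M.stepCoef i a b β α * x := by
  rw [stepOp, stepCoef]
  split_ifs with h
  · subst h
    rw [abs_mul, abs_of_nonneg (M.meanDegree_nonneg _ _), mul_assoc]
    refine mul_le_mul_of_nonneg_left ?_ (M.meanDegree_nonneg _ _)
    rw [Finset.sum_mul]
    refine (Finset.abs_sum_le_sum_abs _ _).trans (Finset.sum_le_sum fun γ _ => ?_)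
    rw [Finset.sum_mul]
    refine (Finset.abs_sum_le_sum_abs _ _).trans (Finset.sum_le_sum fun δ _ => ?_)
    rw [abs_mul, abs_mul]
    calc _ = |M.transMat i a b β γ| * |M.transMatAdj i a b δ α| * |X γ δ| := by ring
      _ ≤ _ := mul_le_mul_of_nonneg_left (hX γ δ) (by positivity)
  · rw [abs_zero]
    have hx : 0 ≤ x := (abs_nonneg _).trans (hX β β)
    have := M.meanDegree_nonneg i (M.cls i a)
    positivity

theorem influenceBlock_apply (X : Matrix (T × Fin q) (T × Fin q) ℝ) (t : T) (β α : Fin q) :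
    M.influenceBlock X t β α = ∑ i, ∑ a, ∑ b, if a ≠ b then
      M.stepOp i a b t β α (fun γ δ => X (M.cls i b, γ) (M.cls i b, δ)) else 0 := by
  classical
  simp only [influenceBlock, Matrix.sum_apply]
  refine Finset.sum_congr rfl fun i _ => Finset.sum_congr rfl fun a _ =>
    Finset.sum_congr rfl fun b _ => ?_
  by_cases hab : a = b
  · simp [hab]
  by_cases h : M.cls i a = t
  · simp only [ne_eq, hab, not_false_eq_true, h, and_self, if_true, stepOp, Matrix.smul_apply,
      smul_eq_mul, Matrix.mul_apply, diagBlock, Matrix.submatrix_apply, Finset.sum_mul]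
    rw [Finset.sum_comm]
  · simp [hab, h, stepOp]

variable (B : Matrix (T × Fin q) (T × Fin q) ℝ)

theorem pathMean_cons {n : ℕ} (v : Fin n) (s : M.Factor n × Fin n)
    (l : List (M.Factor n × Fin n)) (t : T) (β α : Fin q) :
    M.pathMean B v (s :: l) t β α = ∑ a, ∑ b, if s.1.2 a = v ∧ s.1.2 b = s.2 then
      M.stepOp s.1.1 a b t β α (M.pathMean B s.2 l (M.cls s.1.1 b)) /
        (n : ℝ) ^ (M.arity s.1.1 - 1) else 0 := by
  rw [pathMean]
  refine Finset.sum_congr rfl fun a _ => Finset.sum_congr rfl fun b _ => ?_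
  rw [stepOp]
  split_ifs <;> ring

/-- A bound for the entries of `B`. -/
def entryBound : ℝ := ∑ x, ∑ y, |B x y|

theorem abs_le_entryBound (x y : T × Fin q) : |B x y| ≤ entryBound B :=
  (Finset.single_le_sum (f := fun y => |B x y|) (fun _ _ => abs_nonneg _)
    (Finset.mem_univ y)).trans (Finset.single_le_sum (f := fun x => ∑ y, |B x y|)
      (fun _ _ => Finset.sum_nonneg fun _ _ => abs_nonneg _) (Finset.mem_univ x))

theorem entryBound_nonneg : 0 ≤ entryBound B :=
  Finset.sum_nonneg fun _ _ => Finset.sum_nonneg fun _ _ => abs_nonneg _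

theorem abs_pathMean_le {n : ℕ} : ∀ (l : List (M.Factor n × Fin n)) (v : Fin n),
    M.IsWalk v l → ∀ t β α, |M.pathMean B v l t β α| ≤
      entryBound B * M.coefSum ^ l.length * (l.map fun a => M.factorWt 1 a.1).prod := by
  intro l
  induction l with
  | nil => intro v _ t β α; simpa [pathMean] using abs_le_entryBound B _ _
  | cons s l ih =>
    intro v hw t β α
    obtain ⟨a, ha⟩ := mem_verts.1 hw.1.1
    obtain ⟨b, hb⟩ := mem_verts.1 hw.1.2.1
    have hn : (0 : ℝ) < n := by exact_mod_cast v.pos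
    rw [pathMean_cons, M.sum_positions s.1 ha hb, abs_div, abs_of_pos (pow_pos hn _)]
    have h0 : 0 ≤ (l.map fun a => M.factorWt 1 a.1).prod :=
      List.prod_nonneg fun x hx => by
        obtain ⟨a, -, rfl⟩ := List.mem_map.1 hx
        exact M.factorWt_nonneg zero_le_one _
    have h1 := M.abs_stepOp_le s.1.1 a b t β α
      (fun γ δ => ih s.2 hw.2 (M.cls s.1.1 b) γ δ)
    have h2 := entryBound_nonneg B
    have h3 := M.coefSum_nonneg
    have h4 := h1.trans (mul_le_mul_of_nonneg_right (M.stepCoef_le s.1.1 a b β α) (by positivity))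
    rw [List.map_cons, List.prod_cons, List.length_cons, factorWt, div_le_iff₀ (pow_pos hn _)]
    refine h4.trans (le_of_eq ?_)
    have := (pow_pos hn (M.arity s.1.1 - 1)).ne'
    field_simp
    ring

open Classical in
/-- The sum of the means of all walks of length `m` from `v`. -/
def meanSum {n : ℕ} (m : ℕ) (v : Fin n) (t : T) (β α : Fin q) : ℝ :=
  listSum m fun l => if M.IsWalk v l then M.pathMean B v l t β α else 0

-- The recursion has the shape of `influence_pow_succ_apply`, except that an average over the
-- embeddings through `v`, divided by `n^(arity - 1)`, takes the place of a single term.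
open Classical in
theorem meanSum_succ {n : ℕ} (m : ℕ) (v : Fin n) (t : T) (β α : Fin q) :
    M.meanSum B (m + 1) v t β α = ∑ i, ∑ a, ∑ b, if a ≠ b then
      (∑ f : Fin (M.arity i) ↪ Fin n with f a = v,
        M.stepOp i a b t β α (M.meanSum B m (f b) (M.cls i b))) / (n : ℝ) ^ (M.arity i - 1)
      else 0 := by
  rw [meanSum, listSum_succ]
  have h1 : ∀ s : M.Factor n × Fin n,
      (listSum m fun l => if M.IsWalk v (s :: l) then M.pathMean B v (s :: l) t β α else 0) =
      ∑ a, ∑ b, if s.1.2 b = s.2 then (if a ≠ b ∧ s.1.2 a = v then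
        M.stepOp s.1.1 a b t β α (M.meanSum B m s.2 (M.cls s.1.1 b)) /
          (n : ℝ) ^ (M.arity s.1.1 - 1) else 0) else 0 := by
    intro s
    by_cases hs : v ∈ M.verts s.1 ∧ s.2 ∈ M.verts s.1 ∧ v ≠ s.2
    · obtain ⟨a, ha⟩ := mem_verts.1 hs.1
      obtain ⟨b, hb⟩ := mem_verts.1 hs.2.1
      have hab : a ≠ b := fun h => hs.2.2 (by rw [← ha, ← hb, h])
      have e1 : (∑ a, ∑ b, if s.1.2 b = s.2 then (if a ≠ b ∧ s.1.2 a = v then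
          M.stepOp s.1.1 a b t β α (M.meanSum B m s.2 (M.cls s.1.1 b)) /
            (n : ℝ) ^ (M.arity s.1.1 - 1) else 0) else 0) =
          ∑ a, ∑ b, if s.1.2 a = v ∧ s.1.2 b = s.2 then
            (if a ≠ b then M.stepOp s.1.1 a b t β α (M.meanSum B m s.2 (M.cls s.1.1 b)) /
            (n : ℝ) ^ (M.arity s.1.1 - 1) else 0) else 0 := by
        refine Finset.sum_congr rfl fun a _ => Finset.sum_congr rfl fun b _ => ?_
        split_ifs <;> first | rfl | tauto
      rw [e1, M.sum_positions s.1 ha hb, if_pos hab]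
      have e2 : M.meanSum B m s.2 (M.cls s.1.1 b) = fun γ δ =>
          ∑ f : Fin m → M.Factor n × Fin n, if M.IsWalk s.2 (List.ofFn f) then
            M.pathMean B s.2 (List.ofFn f) (M.cls s.1.1 b) γ δ else 0 := rfl
      rw [e2, stepOp_sum, Finset.sum_div, listSum]
      refine Finset.sum_congr rfl fun f _ => ?_
      simp only [IsWalk, hs, true_and, ne_eq, not_false_eq_true, pathMean_cons]
      split_ifs
      · rw [M.sum_positions s.1 ha hb]
      · simp [stepOp]
    · have e1 : ∀ l, ¬ M.IsWalk v (s :: l) := fun l h => hs h.1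
      simp only [e1, if_false, listSum, Finset.sum_const_zero]
      symm
      refine Finset.sum_eq_zero fun a _ => Finset.sum_eq_zero fun b _ => ?_
      split_ifs with h2 h3
      · refine absurd ⟨mem_verts.2 ⟨a, h3.2⟩, mem_verts.2 ⟨b, h2⟩, ?_⟩ hs
        rw [← h2, ← h3.2]
        exact fun h => h3.1 (s.1.2.injective h)
      · rfl
      · rfl
  simp only [h1]
  rw [Fintype.sum_prod_type, Fintype.sum_sigma]
  refine Finset.sum_congr rfl fun i _ => ?_
  have h2 : ∀ f : Fin (M.arity i) ↪ Fin n, (∑ w : Fin n, ∑ a, ∑ b, if f b = w then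
      (if a ≠ b ∧ f a = v then M.stepOp i a b t β α (M.meanSum B m w (M.cls i b)) /
        (n : ℝ) ^ (M.arity i - 1) else 0) else 0) = ∑ a, ∑ b, if a ≠ b ∧ f a = v then
        M.stepOp i a b t β α (M.meanSum B m (f b) (M.cls i b)) /
        (n : ℝ) ^ (M.arity i - 1) else 0 := by
    intro f
    rw [Finset.sum_comm]
    refine Finset.sum_congr rfl fun a _ => ?_
    rw [Finset.sum_comm]
    refine Finset.sum_congr rfl fun b _ => ?_
    simp
  simp only [h2]
  rw [Finset.sum_comm]
  refine Finset.sum_congr rfl fun a _ => ?_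
  rw [Finset.sum_comm]
  refine Finset.sum_congr rfl fun b _ => ?_
  by_cases hab : a = b
  · simp [hab]
  · simp only [ne_eq, hab, not_false_eq_true, true_and, if_true]
    rw [Finset.sum_div, ← Finset.sum_filter]

theorem influence_pow_succ_apply (m : ℕ) (t : T) (β α : Fin q) :
    (M.influence ^ (m + 1)) B (t, β) (t, α) = ∑ i, ∑ a, ∑ b, if a ≠ b then
      M.stepOp i a b t β α (fun γ δ => (M.influence ^ m) B (M.cls i b, γ) (M.cls i b, δ))
      else 0 := by
  rw [← influenceBlock_apply, pow_succ', Module.End.mul_apply]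
  simp [influence]

theorem abs_influence_pow_le (m : ℕ) (t : T) (β α : Fin q) :
    |(M.influence ^ m) B (t, β) (t, α)| ≤ entryBound B * M.coefSum ^ m := by
  induction m generalizing t β α with
  | zero => simpa using abs_le_entryBound B _ _
  | succ m ih =>
    have h0 : 0 ≤ entryBound B * M.coefSum ^ m :=
      mul_nonneg (entryBound_nonneg B) (pow_nonneg M.coefSum_nonneg _)
    rw [influence_pow_succ_apply]
    calc _ ≤ ∑ i, ∑ a, ∑ b, M.stepCoef i a b β α * (entryBound B * M.coefSum ^ m) := by
          refine (Finset.abs_sum_le_sum_abs _ _).trans (Finset.sum_le_sum fun i _ => ?_)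
          refine (Finset.abs_sum_le_sum_abs _ _).trans (Finset.sum_le_sum fun a _ => ?_)
          refine (Finset.abs_sum_le_sum_abs _ _).trans (Finset.sum_le_sum fun b _ => ?_)
          split_ifs
          · exact M.abs_stepOp_le i a b t β α fun γ δ => ih _ γ δ
          · rw [abs_zero]
            exact mul_nonneg (M.stepCoef_nonneg _ _ _ _ _) h0
      _ = (∑ i, ∑ a, ∑ b, M.stepCoef i a b β α) * (entryBound B * M.coefSum ^ m) := by
          simp only [Finset.sum_mul]
      _ ≤ M.coefSum * (entryBound B * M.coefSum ^ m) :=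
          mul_le_mul_of_nonneg_right (M.sum_stepCoef_le β α) h0
      _ = entryBound B * M.coefSum ^ (m + 1) := by ring

/-- The sum of the squared arities. -/
def aritySqSum : ℝ := ∑ i, (M.arity i : ℝ) ^ 2

/-- The number of embeddings through `v` is `n^(arity - 1)` up to a relative error of `arity² / n`.
Each step adds one such error and propagates the old one with operator norm at most `coefSum`. -/
theorem abs_meanSum_sub_le {n : ℕ} (hn : ∀ i, M.arity i ≤ n) (m : ℕ) (v : Fin n) (t : T)
    (β α : Fin q) : |M.meanSum B m v t β α - (M.influence ^ m) B (t, β) (t, α)| ≤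
      m * (M.aritySqSum * entryBound B * M.coefSum ^ m / n) := by
  classical
  have hn0 : (0 : ℝ) < n := by exact_mod_cast v.pos
  induction m generalizing v t β α with
  | zero => simp [meanSum, listSum_zero, IsWalk, pathMean]
  | succ m ih =>
    set Λ : ℝ := entryBound B * M.coefSum ^ m with hΛ
    set ε : ℝ := m * (M.aritySqSum * entryBound B * M.coefSum ^ m / n) with hε
    have hb := entryBound_nonneg B
    have hc := M.coefSum_nonneg
    have hA : 0 ≤ M.aritySqSum := Finset.sum_nonneg fun _ _ => sq_nonneg _
    have hΛ0 : 0 ≤ Λ := by positivity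
    have hε0 : 0 ≤ ε := by positivity
    rw [meanSum_succ, influence_pow_succ_apply]
    simp only [← Finset.sum_sub_distrib]
    calc _ ≤ ∑ i, ∑ a, ∑ b, M.stepCoef i a b β α * (ε + M.aritySqSum / n * Λ) := by
          refine (Finset.abs_sum_le_sum_abs _ _).trans (Finset.sum_le_sum fun i _ => ?_)
          refine (Finset.abs_sum_le_sum_abs _ _).trans (Finset.sum_le_sum fun a _ => ?_)
          refine (Finset.abs_sum_le_sum_abs _ _).trans (Finset.sum_le_sum fun b _ => ?_)
          have hs0 := M.stepCoef_nonneg i a b β α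
          by_cases hab : a = b
          · simp only [hab, ne_eq, not_true_eq_false, if_false, sub_self, abs_zero]
            have := M.stepCoef_nonneg i b b β α
            positivity
          rw [if_pos hab, if_pos hab]
          set X : Fin q → Fin q → ℝ := fun γ δ =>
            (M.influence ^ m) B (M.cls i b, γ) (M.cls i b, δ) with hX
          set c : ℝ := ((Finset.univ.filter fun f : Fin (M.arity i) ↪ Fin n =>
            f a = v).card : ℝ) with hcdef
          set r : ℝ := (n : ℝ) ^ (M.arity i - 1) with hr
          have hr0 : 0 < r := by positivity
          -- Split into the error of the shorter walks and the error of counting embeddings.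
          have e1 : (∑ f : Fin (M.arity i) ↪ Fin n with f a = v,
              M.stepOp i a b t β α (M.meanSum B m (f b) (M.cls i b))) / r -
                M.stepOp i a b t β α X =
              (∑ f : Fin (M.arity i) ↪ Fin n with f a = v, M.stepOp i a b t β α
                (fun γ δ => M.meanSum B m (f b) (M.cls i b) γ δ - X γ δ)) / r +
              (c / r - 1) * M.stepOp i a b t β α X := by
            simp only [stepOp_sub, Finset.sum_sub_distrib, Finset.sum_const, nsmul_eq_mul,
              ← hcdef]
            field_simp
            ring
          rw [e1]
          have h1 : |(∑ f : Fin (M.arity i) ↪ Fin n with f a = v, M.stepOp i a b t β α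
              (fun γ δ => M.meanSum B m (f b) (M.cls i b) γ δ - X γ δ)) / r| ≤
              M.stepCoef i a b β α * ε := by
            rw [abs_div, abs_of_pos hr0, div_le_iff₀ hr0]
            calc _ ≤ ∑ f : Fin (M.arity i) ↪ Fin n with f a = v, M.stepCoef i a b β α * ε :=
                  (Finset.abs_sum_le_sum_abs _ _).trans (Finset.sum_le_sum fun f _ =>
                    M.abs_stepOp_le i a b t β α fun γ δ => ih (f b) _ γ δ)
              _ = c * (M.stepCoef i a b β α * ε) := by
                  rw [Finset.sum_const, nsmul_eq_mul]
              _ ≤ r * (M.stepCoef i a b β α * ε) := by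
                  refine mul_le_mul_of_nonneg_right ?_ (by positivity)
                  rw [hcdef, hr]
                  exact_mod_cast card_embedding_fiber_le a v
              _ = _ := by ring
          have h2 : |(c / r - 1) * M.stepOp i a b t β α X| ≤
              M.stepCoef i a b β α * (M.aritySqSum / n * Λ) := by
            rw [abs_mul]
            have h3 := abs_card_embedding_fiber_div_sub_one_le a v (hn i)
            have h4 : (M.arity i : ℝ) ^ 2 / n ≤ M.aritySqSum / n := by
              refine div_le_div_of_nonneg_right ?_ hn0.le
              exact Finset.single_le_sum (f := fun i => (M.arity i : ℝ) ^ 2)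
                (fun _ _ => sq_nonneg _) (Finset.mem_univ i)
            calc _ ≤ (M.aritySqSum / n) * (M.stepCoef i a b β α * Λ) :=
                  mul_le_mul (h3.trans h4) (M.abs_stepOp_le i a b t β α fun γ δ =>
                    M.abs_influence_pow_le B m _ γ δ) (abs_nonneg _) (by positivity)
              _ = _ := by ring
          refine (abs_add_le _ _).trans ?_
          rw [mul_add]
          exact add_le_add h1 h2
      _ = (∑ i, ∑ a, ∑ b, M.stepCoef i a b β α) * (ε + M.aritySqSum / n * Λ) := by
          simp only [Finset.sum_mul]
      _ ≤ M.coefSum * (ε + M.aritySqSum / n * Λ) :=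
          mul_le_mul_of_nonneg_right (M.sum_stepCoef_le β α) (by positivity)
      _ = _ := by
          rw [hε, hΛ]
          push_cast
          ring

end ObservationModel

namespace ObservationModel

variable {q : ℕ} {T : Type*} [Fintype T] {F : ℕ} (M : ObservationModel q T F)

/-! ### The mean of the quadratic form -/

variable (B : Matrix (T × Fin q) (T × Fin q) ℝ)

/-- The mean of the pairing of the test vector at a variable with a vector that depends linearly
on the type and the colour of the variable. -/
def startForm (X : T → Fin q → Fin q → ℝ) : ℝ :=
  ∑ x : T × Fin q, M.vertexLaw x *
    ∑ β, B (x.1, β) x * (M.hDiag x.1 β)⁻¹ * X x.1 β x.2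

/-- The operator norm of `startForm` for the sup norm. -/
def startCoef : ℝ :=
  ∑ x : T × Fin q, M.vertexLaw x * ∑ β, |B (x.1, β) x| * (M.hDiag x.1 β)⁻¹

theorem startCoef_nonneg : 0 ≤ M.startCoef B :=
  Finset.sum_nonneg fun x _ => mul_nonneg (M.vertexLaw_nonneg x) (Finset.sum_nonneg fun _ _ =>
    mul_nonneg (abs_nonneg _) (inv_pos.2 (M.hDiag_pos _ _)).le)

theorem abs_startForm_le {X : T → Fin q → Fin q → ℝ} {b : ℝ} (hX : ∀ t β α, |X t β α| ≤ b) :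
    |M.startForm B X| ≤ M.startCoef B * b := by
  rw [startForm, startCoef, Finset.sum_mul]
  refine (Finset.abs_sum_le_sum_abs _ _).trans (Finset.sum_le_sum fun x _ => ?_)
  rw [abs_mul, abs_of_nonneg (M.vertexLaw_nonneg x), mul_assoc, Finset.sum_mul]
  refine mul_le_mul_of_nonneg_left ?_ (M.vertexLaw_nonneg x)
  refine (Finset.abs_sum_le_sum_abs _ _).trans (Finset.sum_le_sum fun β _ => ?_)
  have := inv_pos.2 (M.hDiag_pos x.1 β)
  rw [abs_mul, abs_mul, abs_of_pos this]
  exact mul_le_mul_of_nonneg_left (hX _ _ _) (by positivity)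

theorem startForm_sum {κ : Type*} (s : Finset κ) (X : κ → T → Fin q → Fin q → ℝ) :
    M.startForm B (fun t β α => ∑ k ∈ s, X k t β α) = ∑ k ∈ s, M.startForm B (X k) := by
  simp only [startForm, Finset.mul_sum]
  rw [Finset.sum_comm (s := s)]
  refine Finset.sum_congr rfl fun x _ => ?_
  rw [Finset.sum_comm (s := s)]

theorem startForm_sub (X Y : T → Fin q → Fin q → ℝ) :
    M.startForm B (fun t β α => X t β α - Y t β α) = M.startForm B X - M.startForm B Y := by
  simp only [startForm]
  rw [← Finset.sum_sub_distrib]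
  refine Finset.sum_congr rfl fun x _ => ?_
  rw [← mul_sub, ← Finset.sum_sub_distrib]
  congr 1
  exact Finset.sum_congr rfl fun β _ => by ring

theorem startForm_zero : M.startForm B (fun _ _ _ => 0) = 0 := by
  simp [startForm]

/-- `B` is block diagonal and supported on colours of positive probability. -/
def Supported : Prop := ∀ y x, B y x ≠ 0 → y.1 = x.1 ∧ M.InSupp x

/-- Where `B` is nonzero, `typeWt` and `hDiag` are the true masses and their product is `vertexLaw`;
block diagonality removes the other types from the sum. -/
theorem startForm_eq_matForm {B : Matrix (T × Fin q) (T × Fin q) ℝ} (hB : M.Supported B)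
    (Y : Matrix (T × Fin q) (T × Fin q) ℝ) :
    M.startForm B (fun t β α => Y (t, β) (t, α)) = M.matForm B Y := by
  rw [matForm_apply, Finset.sum_comm, startForm]
  refine Finset.sum_congr rfl fun x _ => ?_
  rw [Fintype.sum_prod_type, Finset.sum_eq_single x.1, Finset.mul_sum]
  · refine Finset.sum_congr rfl fun β _ => ?_
    by_cases h : B (x.1, β) x = 0
    · simp [h]
    obtain ⟨h1, h2⟩ := (hB _ _ h).2
    rw [vertexLaw, typeWt, if_pos h1, hDiag, hDiag, if_pos h2]
    ring
  · intro t _ ht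
    refine Finset.sum_eq_zero fun β _ => ?_
    have : B (t, β) x = 0 := by
      by_contra h
      exact ht (hB _ _ h).1
    simp [this]
  · simp

/-- A good walk repeats no factor, so given the labels its edge product has as mean the product of
the centred probabilities; averaging over labels is `prodExp_goodWalk`. -/
theorem termMean_eq_of_goodWalk {M : ObservationModel q T F} (hM : M.DetailedBalance) {n : ℕ}
    (hn : M.Sparse n) {v : Fin n} {l : List (M.Factor n × Fin n)} (hw : M.IsWalk v l)
    (hg : M.GoodWalk {v} v l) : M.termMean B v l = M.startForm B (M.pathMean B v l) := by
  classical
  have hlab : ∀ (σ : Fin n → T × Fin q) (G : Finset (M.Factor n)),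
      M.labels (fun v => (σ v).1, fun v => (σ v).2, G) = σ := fun _ _ => rfl
  have hnd := nodup_of_goodWalk l _ v hw hg
  have hnb : M.IsNB l := by
    rw [IsNB, ← List.isChain_map (R := fun a b => a ≠ b) Prod.fst]
    exact List.Pairwise.isChain hnd
  have h1 : ∀ σ : Fin n → T × Fin q,
      (if M.IsWalk v l ∧ M.IsNB l ∧ M.WalkCompatible σ l then M.walkForm B σ v l else 0) *
        (l.map fun a => M.plantedProb (fun v => (σ v).1) (fun v => (σ v).2) a.1 -
          M.nullProb a.1).prod =
      ∑ x, ∑ β, (B (x.1, β) x * (M.hDiag x.1 β)⁻¹) *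
        (((l.map fun s => M.centredProb σ s.1).prod * M.pathVec B σ v l β) *
          if σ v = x then 1 else 0) := by
    intro σ
    have h2 : (∑ x : T × Fin q, ∑ β, (B (x.1, β) x * (M.hDiag x.1 β)⁻¹) *
        (((l.map fun s => M.centredProb σ s.1).prod * M.pathVec B σ v l β) *
          if σ v = x then 1 else 0)) =
        M.walkForm B σ v l * (l.map fun s => M.centredProb σ s.1).prod := by
      rw [Finset.sum_eq_single (σ v), walkForm, Finset.sum_mul]
      · refine Finset.sum_congr rfl fun β _ => ?_
        rw [if_pos rfl]
        ring
      · intro x _ hx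
        simp [hx.symm]
      · simp
    rw [h2]
    by_cases hc : M.WalkCompatible σ l
    · rw [if_pos ⟨hw, hnb, hc⟩]
      congr 2
      refine List.map_congr_left fun a ha => ?_
      rw [plantedProb, centredProb, if_pos (hc a ha), if_pos (hc a ha)]
    · rw [if_neg fun h => hc h.2.2, zero_mul]
      have : ∃ a ∈ l, ¬ M.Compatible (fun v => (σ v).1) a.1 := by
        simpa [WalkCompatible] using hc
      obtain ⟨a, ha, hca⟩ := this
      rw [List.prod_eq_zero, mul_zero]
      exact List.mem_map.2 ⟨a, ha, by rw [centredProb, if_neg hca]⟩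
  rw [termMean, plantedExp_eq]
  simp only [hlab, walkTerm_eq, bernExp_mul_left]
  simp_rw [M.bernExp_edgeProd_of_nodup _ hnd]
  have h3 : (fun σ : Fin n → T × Fin q =>
      (if M.IsWalk v l ∧ M.IsNB l ∧ M.WalkCompatible σ l then M.walkForm B σ v l else 0) *
        (l.map fun a => M.plantedProb (fun v => (σ v).1) (fun v => (σ v).2) a.1 -
          M.nullProb a.1).prod) = _ := funext h1
  rw [h3, prodExp_sum, startForm]
  refine Finset.sum_congr rfl fun x _ => ?_
  rw [prodExp_sum, Finset.mul_sum]
  refine Finset.sum_congr rfl fun β _ => ?_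
  rw [prodExp_mul_left, prodExp_goodWalk B hM hn l {v} v hw hg (by simp)]
  ring

/-- A bound for the number of variables that two walks of length `m` visit. -/
def walkBound (m : ℕ) : ℝ := (M.aritySum + 2) * (2 * m + 3)

theorem walkBound_nonneg (m : ℕ) : 0 ≤ M.walkBound m := by
  have := M.aritySum_nonneg
  rw [walkBound]
  positivity

theorem stateBound_singleton {n : ℕ} (m : ℕ) (v : Fin n) :
    M.StateBound (M.walkBound m) m ({v}, ∅, v) := by
  have h := M.aritySum_nonneg
  have hm : (0 : ℝ) ≤ m := Nat.cast_nonneg m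
  constructor
  · simp only [Finset.card_empty, Nat.cast_zero, walkBound]
    nlinarith
  · simp only [Finset.card_singleton, Nat.cast_one, walkBound]
    nlinarith

/-- `stepBound` for walks of length `m`. -/
def walkStep (m : ℕ) : ℝ := M.stepBound M.densBound (M.walkBound m)

/-- `defectBound` for walks of length `m`. -/
def walkDefect (m : ℕ) : ℝ := M.defectBound M.densBound (M.walkBound m)

theorem one_le_walkStep (m : ℕ) : 1 ≤ M.walkStep m :=
  M.stepBound_ge_one M.densBound_nonneg (M.walkBound_nonneg m)

theorem walkDefect_nonneg (m : ℕ) : 0 ≤ M.walkDefect m :=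
  M.defectBound_nonneg M.densBound_nonneg (M.walkBound_nonneg m)

theorem factorWt_mono {D D' : ℝ} (h : D ≤ D') {n : ℕ} (e : M.Factor n) :
    M.factorWt D e ≤ M.factorWt D' e := by
  rw [factorWt, factorWt]
  gcongr

/-- A bound for the error in the mean of the quadratic form. -/
def meanError (K : ℝ) (m : ℕ) : ℝ :=
  (K ^ (m + 1) + M.startCoef B * (entryBound B * M.coefSum ^ m)) *
      (m * (M.walkStep m ^ m * M.walkDefect m)) +
    M.startCoef B * (m * (M.aritySqSum * entryBound B * M.coefSum ^ m))

-- Both quantities agree on good walks, so the error consists of the two values on the others. The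
-- true mean vanishes on backtracking walks and otherwise needs a defect of distinct factors. The
-- idealised mean runs over all walks, backtracking ones included, and is bounded by the product
-- over all steps.
open Classical in
theorem abs_termMean_sub_le {M : ObservationModel q T F} (hM : M.DetailedBalance) {K : ℝ}
    (hK1 : 1 ≤ K)
    (hK : ∀ (n : ℕ) (σ : Fin n → T × Fin q) (v : Fin n)
      (l : List (M.Factor n × Fin n)), M.IsWalk v l → |M.walkForm B σ v l| ≤ K ^ (l.length + 1))
    {n : ℕ} (hn : M.Sparse n) (v : Fin n) (l : List (M.Factor n × Fin n)) :
    |M.termMean B v l - if M.IsWalk v l then M.startForm B (M.pathMean B v l) else 0| ≤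
      K ^ (l.length + 1) * (if SeqBad M.nextState M.IsDefect ({v}, ∅, v) l then
        seqWeight (M.newWt M.densBound) M.nextState ({v}, ∅, v) l else 0) +
      M.startCoef B * (entryBound B * M.coefSum ^ l.length) *
        (if SeqBad M.nextState (fun x a => ∃ u ∈ M.verts a.1, u ∈ x.1 ∧ u ≠ x.2.2)
          ({v}, ∅, v) l then
          seqWeight (M.fullWt M.densBound) M.nextState ({v}, ∅, v) l else 0) := by
  have hD := M.densBound_nonneg
  have hwt : ∀ e : M.Factor n, 0 ≤ M.factorWt M.densBound e := fun e => M.factorWt_nonneg hD e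
  have hprod : 0 ≤ (l.map fun a => M.factorWt M.densBound a.1).prod :=
    List.prod_nonneg fun x hx => by
      obtain ⟨a, -, rfl⟩ := List.mem_map.1 hx
      exact hwt _
  have hnew : 0 ≤ (if SeqBad M.nextState M.IsDefect ({v}, ∅, v) l then
      seqWeight (M.newWt M.densBound) M.nextState ({v}, ∅, v) l else 0) := by
    rw [seqWeight_newWt]
    split_ifs
    · exact Finset.prod_nonneg fun e _ => hwt e
    · exact le_rfl
    · exact le_rfl
  have hfull : 0 ≤ (if SeqBad M.nextState (fun x a => ∃ u ∈ M.verts a.1, u ∈ x.1 ∧ u ≠ x.2.2)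
      ({v}, ∅, v) l then seqWeight (M.fullWt M.densBound) M.nextState ({v}, ∅, v) l else 0) := by
    rw [seqWeight_fullWt]
    split_ifs
    · exact hprod
    · exact le_rfl
    · exact le_rfl
  have hc := M.startCoef_nonneg B
  have hb := entryBound_nonneg B
  have hcs := M.coefSum_nonneg
  have hK0 : 0 ≤ K := zero_le_one.trans hK1
  by_cases hw : M.IsWalk v l
  swap
  · have : M.termMean B v l = 0 := by
      simp [termMean, walkTerm, hw, plantedExp]
    rw [this, if_neg hw, sub_self, abs_zero]
    positivity
  rw [if_pos hw]
  by_cases hg : M.GoodWalk {v} v l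
  · rw [termMean_eq_of_goodWalk B hM hn hw hg, sub_self, abs_zero]
    positivity
  refine (abs_sub _ _).trans (add_le_add ?_ ?_)
  · by_cases hnb : M.IsNB l
    · have hbad : SeqBad M.nextState M.IsDefect ({v}, ∅, v) l := by
        by_contra h
        exact hg (goodWalk_of_not_defect l {v} ∅ v hw hnb (by simp) (by simp) h)
      rw [if_pos hbad, seqWeight_newWt, if_pos hw, Finset.sdiff_empty]
      exact M.abs_plantedExp_walkTerm_le B hK1 hK v l
    · have : M.termMean B v l = 0 := by
        simp [termMean, walkTerm, hnb, plantedExp]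
      rw [this, abs_zero]
      positivity
  · have hbad : SeqBad M.nextState (fun x a => ∃ u ∈ M.verts a.1, u ∈ x.1 ∧ u ≠ x.2.2)
        ({v}, ∅, v) l := by
      by_contra h
      exact hg ((goodWalk_iff_not_seqBad l {v} ∅ v).1 h)
    rw [if_pos hbad, seqWeight_fullWt, if_pos hw, mul_assoc]
    refine M.abs_startForm_le B fun t β α => (M.abs_pathMean_le B l v hw t β α).trans ?_
    refine mul_le_mul_of_nonneg_left ?_ (by positivity)
    refine List.prod_map_le_prod_map₀ _ _ (fun a _ => M.factorWt_nonneg zero_le_one _)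
      fun a _ => M.factorWt_mono M.one_le_densBound _

theorem abs_sum_termMean_sub_le {M : ObservationModel q T F} (hM : M.DetailedBalance)
    {K : ℝ} (hK1 : 1 ≤ K)
    (hK : ∀ (n : ℕ) (σ : Fin n → T × Fin q) (v : Fin n)
      (l : List (M.Factor n × Fin n)), M.IsWalk v l → |M.walkForm B σ v l| ≤ K ^ (l.length + 1))
    {n : ℕ} (hn : M.Sparse n) (ha : ∀ i, M.arity i ≤ n) (hB : M.Supported B) (m : ℕ) :
    |(∑ v : Fin n, listSum m (M.termMean B v)) - n * M.matForm B ((M.influence ^ m) B)| ≤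
      M.meanError B K m := by
  classical
  rcases Nat.eq_zero_or_pos n with rfl | hn0
  · have h1 := M.startCoef_nonneg B
    have h2 := entryBound_nonneg B
    have h3 := M.coefSum_nonneg
    have h4 := zero_le_one.trans (M.one_le_walkStep m)
    have h5 := M.walkDefect_nonneg m
    have h6 : 0 ≤ M.aritySqSum := Finset.sum_nonneg fun _ _ => sq_nonneg _
    have h7 := zero_le_one.trans hK1
    simp only [Finset.univ_eq_empty, Finset.sum_empty, Nat.cast_zero, zero_mul, sub_self,
      abs_zero, meanError]
    positivity
  have hnr : (0 : ℝ) < n := by exact_mod_cast hn0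
  rw [← M.startForm_eq_matForm hB]
  have hv : ∀ v : Fin n, |listSum m (M.termMean B v) -
      M.startForm B (fun t β α => (M.influence ^ m) B (t, β) (t, α))| ≤
      M.meanError B K m / n := by
    intro v
    have hst := M.stateBound_singleton m v
    have e1 : M.startForm B (M.meanSum B m v) = listSum m fun l =>
        if M.IsWalk v l then M.startForm B (M.pathMean B v l) else 0 := by
      have : M.meanSum B m v = fun t β α => ∑ f : Fin m → M.Factor n × Fin n,
          if M.IsWalk v (List.ofFn f) then M.pathMean B v (List.ofFn f) t β α else 0 := rfl
      rw [this, startForm_sum, listSum]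
      refine Finset.sum_congr rfl fun f _ => ?_
      split_ifs
      · rfl
      · exact M.startForm_zero B
    have h1 : |listSum m (M.termMean B v) - M.startForm B (M.meanSum B m v)| ≤
        K ^ (m + 1) * (m * (M.walkStep m ^ m * (M.walkDefect m / n))) +
        M.startCoef B * (entryBound B * M.coefSum ^ m) *
          (m * (M.walkStep m ^ m * (M.walkDefect m / n))) := by
      rw [e1, listSum, listSum, ← Finset.sum_sub_distrib]
      refine (Finset.abs_sum_le_sum_abs _ _).trans ?_
      refine (Finset.sum_le_sum fun f _ =>
        abs_termMean_sub_le B hM hK1 hK hn v (List.ofFn f)).trans ?_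
      simp only [List.length_ofFn]
      rw [Finset.sum_add_distrib, ← Finset.mul_sum, ← Finset.mul_sum]
      have h2 := M.startCoef_nonneg B
      have h3 := entryBound_nonneg B
      have h4 := M.coefSum_nonneg
      refine add_le_add (mul_le_mul_of_nonneg_left ?_ (pow_nonneg (zero_le_one.trans hK1) _))
        (mul_le_mul_of_nonneg_left ?_ (by positivity))
      · exact (M.listSum_newWt_le M.densBound_nonneg (M.walkBound_nonneg m) hst).2
      · exact M.listSum_fullWt_le M.densBound_nonneg (M.walkBound_nonneg m) hst
    have h2 : |M.startForm B (M.meanSum B m v) -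
        M.startForm B (fun t β α => (M.influence ^ m) B (t, β) (t, α))| ≤
        M.startCoef B * (m * (M.aritySqSum * entryBound B * M.coefSum ^ m / n)) := by
      rw [← startForm_sub]
      exact M.abs_startForm_le B fun t β α => M.abs_meanSum_sub_le B ha m v t β α
    refine (abs_sub_le _ _ _).trans ((add_le_add h1 h2).trans (le_of_eq ?_))
    rw [meanError]
    field_simp
  have e2 : (n : ℝ) * M.startForm B (fun t β α => (M.influence ^ m) B (t, β) (t, α)) =
      ∑ _v : Fin n, M.startForm B (fun t β α => (M.influence ^ m) B (t, β) (t, α)) := by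
    rw [Finset.sum_const, Finset.card_univ, Fintype.card_fin, nsmul_eq_mul]
  rw [e2, ← Finset.sum_sub_distrib]
  refine (Finset.abs_sum_le_sum_abs _ _).trans ((Finset.sum_le_sum fun v _ => hv v).trans_eq ?_)
  rw [Finset.sum_const, Finset.card_univ, Fintype.card_fin, nsmul_eq_mul]
  field_simp

theorem plantedExp_quadStat {n : ℕ} (m : ℕ) :
    M.plantedExp n (M.quadStat B m) = ∑ v : Fin n, listSum m (M.termMean B v) := by
  classical
  have h : M.quadStat (n := n) B m = fun ω => ∑ v : Fin n, listSum m
      (M.walkTerm B (M.labels ω) ω.2.2 v) := funext fun ω => M.quadStat_eq B m ω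
  rw [h, plantedExp_sum]
  refine Finset.sum_congr rfl fun v _ => ?_
  simp only [listSum]
  rw [plantedExp_sum]
  rfl

end ObservationModel

namespace ObservationModel

variable {q : ℕ} {T : Type*} [Fintype T] {F : ℕ} (M : ObservationModel q T F)

/-! ### The variance of the quadratic form -/

theorem card_walkVerts_le {n : ℕ} : ∀ (l : List (M.Factor n × Fin n)) (v : Fin n),
    ((M.walkVerts v l).card : ℝ) ≤ 1 + l.length * (M.aritySum + 1) := by
  intro l
  induction l with
  | nil => intro v; simp [walkVerts]
  | cons a l ih =>
    intro v
    have h1 : (M.walkVerts v (a :: l)).card ≤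
        (M.verts a.1).card + (M.walkVerts a.2 l).card + 1 :=
      (Finset.card_insert_le _ _).trans (Nat.add_le_add_right (Finset.card_union_le _ _) 1)
    have h2 : ((M.walkVerts v (a :: l)).card : ℝ) ≤
        (M.verts a.1).card + (M.walkVerts a.2 l).card + 1 := by exact_mod_cast h1
    have h3 := M.card_verts_le a.1
    have h4 := ih a.2
    rw [List.length_cons]
    push_cast
    linarith

theorem two_le_arity_of_isWalk {M : ObservationModel q T F} {n : ℕ} :
    ∀ (l : List (M.Factor n × Fin n)) (v : Fin n),
      M.IsWalk v l → ∀ a ∈ l, 2 ≤ M.arity a.1.1 := by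
  intro l
  induction l with
  | nil => simp
  | cons b l ih =>
    intro v hw a ha
    rcases List.mem_cons.1 ha with rfl | ha
    · obtain ⟨j, hj⟩ := mem_verts.1 hw.1.1
      obtain ⟨k, hk⟩ := mem_verts.1 hw.1.2.1
      have hjk : (j : ℕ) ≠ k := fun h => hw.1.2.2 (by rw [← hj, ← hk, Fin.ext h])
      have := j.2
      have := k.2
      omega
    · exact ih _ hw.2 a ha

theorem factorWt_le_one {n : ℕ} {D : ℝ} (hD : D ≤ n) (hn : 0 < n) {e : M.Factor n}
    (he : 2 ≤ M.arity e.1) : M.factorWt D e ≤ 1 := by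
  have hn1 : (1 : ℝ) ≤ n := by exact_mod_cast hn
  rw [factorWt, div_le_one (by positivity)]
  exact hD.trans (le_self_pow₀ hn1 (by omega))

variable (B : Matrix (T × Fin q) (T × Fin q) ℝ)

/-- The covariance of the contributions of two walks. -/
def termCov {n : ℕ} (v v' : Fin n) (l l' : List (M.Factor n × Fin n)) : ℝ :=
  M.plantedExp n (fun ω => M.walkTerm B (M.labels ω) ω.2.2 v l *
      M.walkTerm B (M.labels ω) ω.2.2 v' l') - M.termMean B v l * M.termMean B v' l'

-- Meeting walks are bounded by one weight per distinct factor of their union: those of the first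
-- walk, then the new ones of the second. The product of the means obeys the same bound because
-- weights of factors of a walk are at most one, which explains the hypothesis `densBound ≤ n`.
open Classical in
theorem termCov_le {K : ℝ} (hK1 : 1 ≤ K)
    (hK : ∀ (n : ℕ) (σ : Fin n → T × Fin q) (v : Fin n)
      (l : List (M.Factor n × Fin n)), M.IsWalk v l → |M.walkForm B σ v l| ≤ K ^ (l.length + 1))
    {n : ℕ} (hn : M.densBound ≤ n) (v v' : Fin n) (l l' : List (M.Factor n × Fin n)) :
    M.termCov B v v' l l' ≤ 2 * K ^ (l.length + 1) * K ^ (l'.length + 1) *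
      (seqWeight (M.newWt M.densBound) M.nextState ({v}, ∅, v) l *
        if Disjoint (M.walkVerts v l) (M.walkVerts v' l') then 0 else
          seqWeight (M.newWt M.densBound) M.nextState
            (insert v' (M.walkVerts v l), (l.map Prod.fst).toFinset, v') l') := by
  have hK0 : 0 ≤ K := zero_le_one.trans hK1
  have hwt : ∀ e : M.Factor n, 0 ≤ M.factorWt M.densBound e := fun e =>
    M.factorWt_nonneg M.densBound_nonneg e
  rw [seqWeight_newWt, seqWeight_newWt, termCov]
  by_cases hd : Disjoint (M.walkVerts v l) (M.walkVerts v' l')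
  · rw [M.plantedExp_walkTerm_mul B hd, if_pos hd]
    simp
  rw [if_neg hd]
  by_cases hw : M.IsWalk v l
  swap
  · simp [hw, termMean, walkTerm, plantedExp]
  by_cases hw' : M.IsWalk v' l'
  swap
  · simp [hw', termMean, walkTerm, plantedExp]
  rw [if_pos hw, if_pos hw', Finset.sdiff_empty]
  set D := (l.map Prod.fst).toFinset
  set D' := (l'.map Prod.fst).toFinset
  have h1 := (le_abs_self _).trans (M.abs_plantedExp_walkTerm_mul_le B hK1 hK v v' l l')
  have h2 := M.abs_plantedExp_walkTerm_le B hK1 hK v l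
  have h3 := M.abs_plantedExp_walkTerm_le B hK1 hK v' l'
  have e1 : ∏ e ∈ D ∪ D', M.factorWt M.densBound e =
      (∏ e ∈ D, M.factorWt M.densBound e) * ∏ e ∈ D' \ D, M.factorWt M.densBound e := by
    rw [← Finset.prod_union Finset.disjoint_sdiff, Finset.union_sdiff_self_eq_union]
  have e2 : ∏ e ∈ D', M.factorWt M.densBound e ≤ ∏ e ∈ D' \ D, M.factorWt M.densBound e := by
    rw [← Finset.prod_sdiff (Finset.sdiff_subset : D' \ D ⊆ D')]
    refine mul_le_of_le_one_left (Finset.prod_nonneg fun e _ => hwt e)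
      (Finset.prod_le_one (fun e _ => hwt e) fun e he => ?_)
    obtain ⟨a, ha, rfl⟩ := List.mem_map.1 (List.mem_toFinset.1 (Finset.mem_sdiff.1 he).1)
    exact M.factorWt_le_one hn v.pos (two_le_arity_of_isWalk l' v' hw' a ha)
  have p1 : 0 ≤ ∏ e ∈ D, M.factorWt M.densBound e := Finset.prod_nonneg fun e _ => hwt e
  have p2 : 0 ≤ ∏ e ∈ D', M.factorWt M.densBound e := Finset.prod_nonneg fun e _ => hwt e
  have h4 : -(M.termMean B v l * M.termMean B v' l') ≤
      (K ^ (l.length + 1) * ∏ e ∈ D, M.factorWt M.densBound e) *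
        (K ^ (l'.length + 1) * ∏ e ∈ D' \ D, M.factorWt M.densBound e) := by
    refine (neg_le_abs _).trans ?_
    rw [abs_mul]
    refine mul_le_mul h2 (h3.trans ?_) (abs_nonneg _) (by positivity)
    exact mul_le_mul_of_nonneg_left e2 (by positivity)
  rw [e1] at h1
  rw [sub_eq_add_neg]
  refine (add_le_add h1 h4).trans (le_of_eq ?_)
  ring

/-- A bound for the variance of the quadratic form, divided by `n`. -/
def varBound (K : ℝ) (m : ℕ) : ℝ :=
  2 * K ^ (m + 1) * K ^ (m + 1) * (M.walkStep m ^ m *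
    (M.walkStep m ^ m * (M.walkBound m + m * M.walkDefect m)))

-- A second walk that meets the first either starts on it, with at most `walkBound m` choices of
-- start, or starts elsewhere and has a defect, whose cost `walkDefect m / n` offsets the `n`
-- possible starts.
open Classical in
theorem sum_meeting_le {n m : ℕ} (v : Fin n) {l : List (M.Factor n × Fin n)}
    (hl : l.length = m) :
    (∑ v' : Fin n, listSum m fun l' =>
      if Disjoint (M.walkVerts v l) (M.walkVerts v' l') then 0 else
        seqWeight (M.newWt M.densBound) M.nextState
          (insert v' (M.walkVerts v l), (l.map Prod.fst).toFinset, v') l') ≤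
      M.walkStep m ^ m * (M.walkBound m + m * M.walkDefect m) := by
  have hn : (0 : ℝ) < n := by exact_mod_cast v.pos
  have hD := M.densBound_nonneg
  have hA := M.aritySum_nonneg
  have hm : (0 : ℝ) ≤ m := Nat.cast_nonneg m
  have hR : 0 ≤ M.walkStep m := zero_le_one.trans (M.one_le_walkStep m)
  have hr := M.walkDefect_nonneg m
  have hcard := M.card_walkVerts_le l v
  rw [hl] at hcard
  have hst : ∀ v' : Fin n, M.StateBound (M.walkBound m) m
      (insert v' (M.walkVerts v l), (l.map Prod.fst).toFinset, v') := by
    intro v'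
    constructor
    · have h1 : (((l.map Prod.fst).toFinset.card : ℕ) : ℝ) ≤ m := by
        have := List.toFinset_card_le (l.map Prod.fst)
        rw [List.length_map, hl] at this
        exact_mod_cast this
      simp only [walkBound]
      nlinarith
    · have h1 : (((insert v' (M.walkVerts v l)).card : ℕ) : ℝ) ≤ (M.walkVerts v l).card + 1 := by
        exact_mod_cast Finset.card_insert_le _ _
      simp only [walkBound]
      nlinarith
  have hnn : ∀ (v' : Fin n) l', 0 ≤ seqWeight (M.newWt M.densBound) M.nextState
      (insert v' (M.walkVerts v l), (l.map Prod.fst).toFinset, v') l' := by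
    intro v' l'
    rw [seqWeight_newWt]
    split_ifs
    · exact Finset.prod_nonneg fun e _ => M.factorWt_nonneg hD e
    · exact le_rfl
  have hv : ∀ v' : Fin n, (listSum m fun l' =>
      if Disjoint (M.walkVerts v l) (M.walkVerts v' l') then 0 else
        seqWeight (M.newWt M.densBound) M.nextState
          (insert v' (M.walkVerts v l), (l.map Prod.fst).toFinset, v') l') ≤
      (if v' ∈ M.walkVerts v l then M.walkStep m ^ m else 0) +
        m * (M.walkStep m ^ m * (M.walkDefect m / n)) := by
    intro v'
    obtain ⟨h1, h2⟩ := M.listSum_newWt_le hD (M.walkBound_nonneg m) (hst v')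
    have h3 : 0 ≤ m * (M.walkStep m ^ m * (M.walkDefect m / n)) := by positivity
    by_cases hv' : v' ∈ M.walkVerts v l
    · rw [if_pos hv']
      refine le_trans ((listSum_mono fun l' _ => ?_).trans h1)
        (le_add_of_nonneg_right h3)
      split_ifs
      · exact hnn v' l'
      · exact le_rfl
    · rw [if_neg hv', zero_add]
      refine le_trans (listSum_mono fun l' _ => ?_) h2
      by_cases hd : Disjoint (M.walkVerts v l) (M.walkVerts v' l')
      · rw [if_pos hd]
        split_ifs
        · exact hnn v' l'
        · exact le_rfl
      rw [if_neg hd]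
      by_cases hw : M.IsWalk v' l'
      · rw [if_pos]
        obtain ⟨u, hu, hu'⟩ := Finset.not_disjoint_iff.1 hd
        refine seqBad_of_meets (M.walkVerts v l) l' _ _ v' hw (Finset.subset_insert _ _) hv' ?_
          ⟨u, hu', hu⟩
        intro e he
        obtain ⟨a, ha, rfl⟩ := List.mem_map.1 (List.mem_toFinset.1 he)
        exact Or.inl (M.verts_subset_walkVerts l v a ha)
      · rw [seqWeight_newWt, if_neg hw]
        split_ifs <;> exact le_rfl
  refine (Finset.sum_le_sum fun v' _ => hv v').trans ?_
  rw [Finset.sum_add_distrib, Finset.sum_ite_mem, Finset.univ_inter, Finset.sum_const,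
    Finset.sum_const, Finset.card_univ, Fintype.card_fin, nsmul_eq_mul, nsmul_eq_mul]
  have e1 : (n : ℝ) * (m * (M.walkStep m ^ m * (M.walkDefect m / n))) =
      M.walkStep m ^ m * (m * M.walkDefect m) := by
    field_simp
  rw [e1, mul_add, mul_comm ((M.walkVerts v l).card : ℝ)]
  refine add_le_add (mul_le_mul_of_nonneg_left ?_ (by positivity)) le_rfl
  refine hcard.trans ?_
  rw [walkBound]
  nlinarith

/-- The variance is the double sum of covariances. The inner sum over the second walk is controlled
by `sum_meeting_le`, the outer one by the weighted count of walks; the only free factor `n` is the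
start of the first walk. -/
theorem variance_quadStat_le {K : ℝ} (hK1 : 1 ≤ K)
    (hK : ∀ (n : ℕ) (σ : Fin n → T × Fin q) (v : Fin n)
      (l : List (M.Factor n × Fin n)), M.IsWalk v l → |M.walkForm B σ v l| ≤ K ^ (l.length + 1))
    {n : ℕ} (hn : M.densBound ≤ n) (m : ℕ) :
    M.plantedExp n (fun ω => M.quadStat B m ω * M.quadStat B m ω) -
      M.plantedExp n (M.quadStat B m) * M.plantedExp n (M.quadStat B m) ≤
      n * M.varBound K m := by
  classical
  have hK0 : 0 ≤ K := zero_le_one.trans hK1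
  have h1 : M.plantedExp n (fun ω => M.quadStat B m ω * M.quadStat B m ω) -
      M.plantedExp n (M.quadStat B m) * M.plantedExp n (M.quadStat B m) =
      ∑ v : Fin n, listSum m fun l => ∑ v' : Fin n, listSum m fun l' =>
        M.termCov B v v' l l' := by
    rw [plantedExp_quadStat]
    simp only [quadStat_eq, listSum, Finset.sum_mul_sum, plantedExp_sum, termCov,
      Finset.sum_sub_distrib]
    congr 1
    · refine Finset.sum_congr rfl fun v _ => ?_
      rw [Finset.sum_comm]
    · refine Finset.sum_congr rfl fun v _ => ?_
      rw [Finset.sum_comm]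
  rw [h1]
  have hR : 0 ≤ M.walkStep m := zero_le_one.trans (M.one_le_walkStep m)
  have hr := M.walkDefect_nonneg m
  have hN := M.walkBound_nonneg m
  set Q : ℝ := M.walkStep m ^ m * (M.walkBound m + m * M.walkDefect m) with hQ
  have hQ0 : 0 ≤ Q := by positivity
  have h2 : ∀ (v : Fin n) (l : List (M.Factor n × Fin n)), l.length = m →
      (∑ v' : Fin n, listSum m fun l' => M.termCov B v v' l l') ≤
      2 * K ^ (m + 1) * K ^ (m + 1) * Q *
        seqWeight (M.newWt M.densBound) M.nextState ({v}, ∅, v) l := by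
    intro v l hl
    have hw : 0 ≤ seqWeight (M.newWt M.densBound) M.nextState ({v}, ∅, v) l := by
      rw [seqWeight_newWt]
      split_ifs
      · exact Finset.prod_nonneg fun e _ => M.factorWt_nonneg M.densBound_nonneg e
      · exact le_rfl
    calc _ ≤ ∑ v' : Fin n, listSum m fun l' => 2 * K ^ (m + 1) * K ^ (m + 1) *
          seqWeight (M.newWt M.densBound) M.nextState ({v}, ∅, v) l *
          (if Disjoint (M.walkVerts v l) (M.walkVerts v' l') then 0 else
            seqWeight (M.newWt M.densBound) M.nextState
              (insert v' (M.walkVerts v l), (l.map Prod.fst).toFinset, v') l') := by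
          refine Finset.sum_le_sum fun v' _ => listSum_mono fun l' hl' => ?_
          have := M.termCov_le B hK1 hK hn v v' l l'
          rw [hl, hl'] at this
          refine this.trans_eq ?_
          ring
      _ = 2 * K ^ (m + 1) * K ^ (m + 1) *
          seqWeight (M.newWt M.densBound) M.nextState ({v}, ∅, v) l *
          ∑ v' : Fin n, listSum m fun l' =>
          (if Disjoint (M.walkVerts v l) (M.walkVerts v' l') then 0 else
            seqWeight (M.newWt M.densBound) M.nextState
              (insert v' (M.walkVerts v l), (l.map Prod.fst).toFinset, v') l') := by
          rw [Finset.mul_sum]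
          exact Finset.sum_congr rfl fun v' _ => listSum_mul_left _ _ _
      _ ≤ 2 * K ^ (m + 1) * K ^ (m + 1) *
          seqWeight (M.newWt M.densBound) M.nextState ({v}, ∅, v) l * Q :=
          mul_le_mul_of_nonneg_left (M.sum_meeting_le v hl) (by positivity)
      _ = _ := by ring
  calc _ ≤ ∑ v : Fin n, listSum m fun l => 2 * K ^ (m + 1) * K ^ (m + 1) * Q *
        seqWeight (M.newWt M.densBound) M.nextState ({v}, ∅, v) l :=
        Finset.sum_le_sum fun v _ => listSum_mono fun l hl => h2 v l hl
    _ = ∑ v : Fin n, 2 * K ^ (m + 1) * K ^ (m + 1) * Q *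
        listSum m (seqWeight (M.newWt M.densBound) M.nextState ({v}, ∅, v)) :=
        Finset.sum_congr rfl fun v _ => listSum_mul_left _ _ _
    _ ≤ ∑ _v : Fin n, 2 * K ^ (m + 1) * K ^ (m + 1) * Q * M.walkStep m ^ m := by
        refine Finset.sum_le_sum fun v _ => mul_le_mul_of_nonneg_left ?_ (by positivity)
        exact (M.listSum_newWt_le M.densBound_nonneg (M.walkBound_nonneg m)
          (M.stateBound_singleton m v)).1
    _ = n * M.varBound K m := by
        rw [Finset.sum_const, Finset.card_univ, Fintype.card_fin, nsmul_eq_mul, varBound, hQ]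
        ring

end ObservationModel

/-! ### Quantities of at most factorial growth -/

/-- Growth of at most a power of the factorial. -/
def FactorialGrowth (f : ℕ → ℝ) : Prop :=
  ∃ (C : ℝ) (c : ℕ), 1 ≤ C ∧ ∀ m : ℕ, |f m| ≤ (C * (m + 1)) ^ (c * (m + 1))

theorem one_le_mul_succ {C : ℝ} (hC : 1 ≤ C) (m : ℕ) : 1 ≤ C * (m + 1) :=
  one_le_mul_of_one_le_of_one_le hC (by linarith [(Nat.cast_nonneg m : (0 : ℝ) ≤ m)])

namespace FactorialGrowth

variable {f g : ℕ → ℝ}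

theorem of_abs_le (hg : FactorialGrowth g) (h : ∀ m, |f m| ≤ |g m|) : FactorialGrowth f := by
  obtain ⟨C, c, hC, hb⟩ := hg
  exact ⟨C, c, hC, fun m => (h m).trans (hb m)⟩

theorem mul (hf : FactorialGrowth f) (hg : FactorialGrowth g) :
    FactorialGrowth fun m => f m * g m := by
  obtain ⟨C, c, hC, hb⟩ := hf
  obtain ⟨C', c', hC', hb'⟩ := hg
  refine ⟨max C C', c + c', hC.trans (le_max_left _ _), fun m => ?_⟩
  have h0 : (0 : ℝ) ≤ m := Nat.cast_nonneg m
  rw [abs_mul, add_mul, pow_add]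
  refine mul_le_mul ((hb m).trans ?_) ((hb' m).trans ?_) (abs_nonneg _) (by positivity)
  · exact pow_le_pow_left₀ (by positivity)
      (mul_le_mul_of_nonneg_right (le_max_left _ _) (by positivity)) _
  · exact pow_le_pow_left₀ (by positivity)
      (mul_le_mul_of_nonneg_right (le_max_right _ _) (by positivity)) _

theorem const (a : ℝ) : FactorialGrowth fun _ => a := by
  refine ⟨1 + |a|, 1, by linarith [abs_nonneg a], fun m => ?_⟩
  have h1 := one_le_mul_succ (show 1 ≤ 1 + |a| by linarith [abs_nonneg a]) m
  have h0 : (0 : ℝ) ≤ m := Nat.cast_nonneg m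
  have h2 : |a| ≤ (1 + |a|) * (m + 1) := by nlinarith [abs_nonneg a]
  exact h2.trans (le_self_pow₀ h1 (by omega))

theorem add (hf : FactorialGrowth f) (hg : FactorialGrowth g) :
    FactorialGrowth fun m => f m + g m := by
  obtain ⟨C, c, hC, hb⟩ := hf
  obtain ⟨C', c', hC', hb'⟩ := hg
  have hF : FactorialGrowth fun m : ℕ => (C * (m + 1)) ^ (c * (m + 1)) :=
    ⟨C, c, hC, fun m => (abs_of_nonneg (by positivity)).le⟩
  have hG : FactorialGrowth fun m : ℕ => (C' * (m + 1)) ^ (c' * (m + 1)) :=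
    ⟨C', c', hC', fun m => (abs_of_nonneg (by positivity)).le⟩
  -- Both majorants are at least one, so their sum is at most twice their product.
  refine ((const 2).mul (hF.mul hG)).of_abs_le fun m => ?_
  have h1 := one_le_pow₀ (one_le_mul_succ hC m) (n := c * (m + 1))
  have h2 := one_le_pow₀ (one_le_mul_succ hC' m) (n := c' * (m + 1))
  have h3 := hb m
  have h4 := hb' m
  rw [abs_of_nonneg (a := 2 * _) (by positivity)]
  refine (abs_add_le _ _).trans ?_
  nlinarith

theorem affine_pow (a b : ℝ) (k : ℕ) : FactorialGrowth fun m => (a + b * m) ^ (m + k) := by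
  refine ⟨1 + |a| + |b|, 1 + k, by linarith [abs_nonneg a, abs_nonneg b], fun m => ?_⟩
  have h0 : (0 : ℝ) ≤ m := Nat.cast_nonneg m
  have h1 := one_le_mul_succ (show 1 ≤ 1 + |a| + |b| by linarith [abs_nonneg a, abs_nonneg b]) m
  have h2 : |a + b * m| ≤ (1 + |a| + |b|) * (m + 1) := by
    refine (abs_add_le _ _).trans ?_
    rw [abs_mul, abs_of_nonneg h0]
    nlinarith [abs_nonneg a, abs_nonneg b]
  rw [abs_pow]
  refine (pow_le_pow_left₀ (abs_nonneg _) h2 _).trans (pow_le_pow_right₀ h1 ?_)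
  nlinarith

theorem affine (a b : ℝ) : FactorialGrowth fun m => a + b * m := by
  refine ⟨1 + |a| + |b|, 1, by linarith [abs_nonneg a, abs_nonneg b], fun m => ?_⟩
  have h0 : (0 : ℝ) ≤ m := Nat.cast_nonneg m
  have h1 := one_le_mul_succ (show 1 ≤ 1 + |a| + |b| by linarith [abs_nonneg a, abs_nonneg b]) m
  have h2 : |a + b * m| ≤ (1 + |a| + |b|) * (m + 1) := by
    refine (abs_add_le _ _).trans ?_
    rw [abs_mul, abs_of_nonneg h0]
    nlinarith [abs_nonneg a, abs_nonneg b]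
  exact h2.trans (le_self_pow₀ h1 (by omega))

theorem pow (K : ℝ) (k : ℕ) : FactorialGrowth fun m => K ^ (m + k) := by
  simpa using affine_pow K 0 k

end FactorialGrowth

theorem tendsto_log_log_natCast :
    Tendsto (fun n : ℕ => Real.log (Real.log n)) atTop atTop :=
  Real.tendsto_log_atTop.comp (Real.tendsto_log_atTop.comp tendsto_natCast_atTop_atTop)

/-- Quantities of factorial growth in `log n / (log log n) ^ 2` are sublinear in `n`. -/
theorem FactorialGrowth.tendsto_div {f : ℕ → ℝ} (hf : FactorialGrowth f) {s : ℕ → ℕ}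
    (hs : ∀ᶠ n : ℕ in atTop, (s n : ℝ) ≤ Real.log n / (Real.log (Real.log n)) ^ 2) :
    Tendsto (fun n : ℕ => f (s n) / n) atTop (𝓝 0) := by
  obtain ⟨C, c, hC, hb⟩ := hf
  have hL : Tendsto (fun n : ℕ => Real.log n) atTop atTop :=
    Real.tendsto_log_atTop.comp tendsto_natCast_atTop_atTop
  have hlo : ∀ᶠ n : ℕ in atTop, 4 * (c + 1) * Real.log (Real.log n) ≤ Real.log n := by
    have h1 := (Real.isLittleO_log_id_atTop.bound
      (show (0 : ℝ) < 1 / (4 * (c + 1)) by positivity))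
    filter_upwards [hL.eventually h1, hL.eventually_ge_atTop 1] with n hn hn1
    simp only [id, Real.norm_eq_abs] at hn
    rw [abs_of_nonneg (Real.log_nonneg hn1), abs_of_nonneg (by linarith), div_mul_eq_mul_div,
      one_mul, le_div_iff₀ (by positivity)] at hn
    linarith
  -- The target is `|f (s n)| ≤ √n` eventually.
  have hlim : Tendsto (fun n : ℕ => (n : ℝ) ^ (-(1 / 2) : ℝ)) atTop (𝓝 0) :=
    (tendsto_rpow_neg_atTop (by norm_num)).comp tendsto_natCast_atTop_atTop
  refine squeeze_zero_norm' ?_ hlim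
  filter_upwards [hs, hlo, hL.eventually_ge_atTop (2 * C), eventually_gt_atTop 0,
    tendsto_log_log_natCast.eventually_ge_atTop (4 * (c + 1)),
    tendsto_log_log_natCast.eventually_ge_atTop (2 * C)] with n hn h1 h2 h3 h4 h5
  set L := Real.log n with hLdef
  set ℓ := Real.log L with hℓ
  have hn0 : (0 : ℝ) < n := by exact_mod_cast h3
  have hc : (0 : ℝ) ≤ c := Nat.cast_nonneg c
  have hℓ0 : 1 ≤ ℓ := by linarith
  have hL0 : 0 < L := by linarith
  have hs0 : (0 : ℝ) ≤ s n := Nat.cast_nonneg _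
  rw [le_div_iff₀ (by positivity)] at hn
  -- The base is at most `log n`, so its logarithm costs one factor `log log n`; the second such
  -- factor in the bound on `s` beats the constant in the exponent.
  have hbase : C * (s n + 1) ≤ L := by
    have : 2 * C * s n ≤ L := by
      calc 2 * C * s n ≤ ℓ ^ 2 * s n := by
            refine mul_le_mul_of_nonneg_right ?_ hs0
            nlinarith
        _ ≤ L := by linarith
    linarith
  have hexp : c * (s n + 1) * ℓ ≤ L * (1 / 2) := by
    have : 4 * (c + 1) * (s n * ℓ) ≤ L := by
      calc 4 * (c + 1) * (s n * ℓ) ≤ ℓ * (s n * ℓ) :=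
            mul_le_mul_of_nonneg_right h4 (by positivity)
        _ ≤ L := by linarith
    have h6 : 0 ≤ s n * ℓ := by positivity
    nlinarith
  rw [norm_div, Real.norm_eq_abs, Real.norm_eq_abs, abs_of_pos hn0, div_le_iff₀ hn0]
  refine (hb (s n)).trans ?_
  calc (C * ((s n : ℝ) + 1)) ^ (c * (s n + 1)) ≤ L ^ (c * (s n + 1)) :=
        pow_le_pow_left₀ (by positivity) hbase _
    _ = Real.exp (c * (s n + 1) * ℓ) := by
        rw [← Real.exp_log (pow_pos hL0 _), Real.log_pow, ← hℓ]
        push_cast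
        rfl
    _ ≤ Real.exp (L * (1 / 2)) := Real.exp_le_exp.2 hexp
    _ = (n : ℝ) ^ (1 / 2 : ℝ) := by rw [Real.rpow_def_of_pos hn0]
    _ = (n : ℝ) ^ (-(1 / 2) : ℝ) * n := by
        nth_rewrite 3 [← Real.rpow_one (n : ℝ)]
        rw [← Real.rpow_add hn0]
        norm_num

namespace ObservationModel

variable {q : ℕ} {T : Type*} [Fintype T] {F : ℕ} (M : ObservationModel q T F)

/-! ### Concentration of the quadratic form -/

variable (B : Matrix (T × Fin q) (T × Fin q) ℝ)

theorem walkBound_eq (m : ℕ) :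
    M.walkBound m = (M.aritySum + 2) * 3 + (M.aritySum + 2) * 2 * m := by
  rw [walkBound]
  ring

theorem walkStep_eq (m : ℕ) : M.walkStep m =
    (M.aritySum * ((M.aritySum + 2) * 3 + M.densBound * M.aritySum) + 1) +
      M.aritySum * ((M.aritySum + 2) * 2) * m := by
  rw [walkStep, stepBound, walkBound_eq]
  ring

theorem walkDefect_eq (m : ℕ) : M.walkDefect m =
    M.aritySum * (M.densBound * (∑ i, (M.arity i : ℝ) ^ 2) * ((M.aritySum + 2) * 3)) +
      M.aritySum * (M.densBound * (∑ i, (M.arity i : ℝ) ^ 2) * ((M.aritySum + 2) * 2)) * m := by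
  rw [walkDefect, defectBound, walkBound_eq]
  ring

theorem factorialGrowth_walkStep : FactorialGrowth fun m => M.walkStep m ^ m := by
  simp only [walkStep_eq]
  simpa using FactorialGrowth.affine_pow
    (M.aritySum * ((M.aritySum + 2) * 3 + M.densBound * M.aritySum) + 1)
    (M.aritySum * ((M.aritySum + 2) * 2)) 0

theorem factorialGrowth_walkDefect : FactorialGrowth M.walkDefect := by
  have : M.walkDefect = _ := funext M.walkDefect_eq
  rw [this]
  exact FactorialGrowth.affine _ _

theorem factorialGrowth_walkBound : FactorialGrowth M.walkBound := by
  have : M.walkBound = _ := funext M.walkBound_eq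
  rw [this]
  exact FactorialGrowth.affine _ _

theorem factorialGrowth_natCast : FactorialGrowth fun m => (m : ℝ) := by
  simpa using FactorialGrowth.affine 0 1

theorem factorialGrowth_meanError (K : ℝ) : FactorialGrowth (M.meanError B K) := by
  have hcs : FactorialGrowth fun m => M.coefSum ^ m := by
    simpa using FactorialGrowth.pow M.coefSum 0
  have hc := FactorialGrowth.const
  exact ((((FactorialGrowth.pow K 1).add ((hc (M.startCoef B)).mul ((hc (entryBound B)).mul
    hcs))).mul (factorialGrowth_natCast.mul (M.factorialGrowth_walkStep.mul
      M.factorialGrowth_walkDefect))).add ((hc (M.startCoef B)).mul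
        (factorialGrowth_natCast.mul ((hc (M.aritySqSum * entryBound B)).mul hcs))))

theorem factorialGrowth_varBound (K : ℝ) : FactorialGrowth (M.varBound K) := by
  have hc := FactorialGrowth.const
  exact (((hc 2).mul (FactorialGrowth.pow K 1)).mul (FactorialGrowth.pow K 1)).mul
    (M.factorialGrowth_walkStep.mul (M.factorialGrowth_walkStep.mul
      (M.factorialGrowth_walkBound.add (factorialGrowth_natCast.mul
        M.factorialGrowth_walkDefect))))

theorem sparse_of_densBound_le {n : ℕ} (hn0 : 0 < n) (hn : M.densBound ≤ n) : M.Sparse n := by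
  intro i c h2
  have hn1 : (1 : ℝ) ≤ n := by exact_mod_cast hn0
  refine min_eq_right ?_
  rw [div_le_one (by positivity)]
  have h1 : M.dens i c ≤ ∑ i, ∑ c, M.dens i c :=
    (Finset.single_le_sum (fun c _ => M.dens_nonneg i c) (Finset.mem_univ c)).trans
      (Finset.single_le_sum (f := fun i => ∑ c, M.dens i c)
        (fun i _ => Finset.sum_nonneg fun c _ => M.dens_nonneg i c) (Finset.mem_univ i))
  have h3 : M.dens i c ≤ M.densBound := by
    have := M.dens_nonneg i c
    rw [densBound]
    linarith
  exact (h3.trans hn).trans (le_self_pow₀ hn1 (by omega))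

/-- Chebyshev around the idealised mean: relative to the squared window, the variance is of order
`varBound * lamL^(-2s) / n` and the squared bias smaller by a further `1/n`. Both are quantities of
factorial growth divided by a power of `n`. -/
theorem tendsto_plantedPr_quadStat {M : ObservationModel q T F} (hM : M.DetailedBalance)
    (hl : 0 < M.lamL) {B : Matrix (T × Fin q) (T × Fin q) ℝ} (hB : M.Supported B) {s : ℕ → ℕ}
    (hs : ∀ᶠ n : ℕ in atTop, (s n : ℝ) ≤ Real.log n / (Real.log (Real.log n)) ^ 2)
    {ε : ℝ} (hε : 0 < ε) :
    Tendsto (fun n => M.plantedPr n {ω |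
      |M.quadStat B (s n) ω - n * M.matForm B ((M.influence ^ s n) B)| ≤
        ε * (n * M.lamL ^ s n)}) atTop (𝓝 1) := by
  obtain ⟨K, hK1, hK⟩ := M.exists_walkForm_bound B
  -- When `lamL < 1` the window shrinks geometrically, which is again absorbed by factorial growth.
  have hinv : FactorialGrowth fun m => (M.lamL⁻¹ ^ 2) ^ m :=
    FactorialGrowth.pow (M.lamL⁻¹ ^ 2) 0
  have h1 := ((M.factorialGrowth_varBound K).mul hinv).tendsto_div hs
  have h2 := (((M.factorialGrowth_meanError B K).mul (M.factorialGrowth_meanError B K)).mul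
    hinv).tendsto_div hs
  have h3 : Tendsto (fun n : ℕ => (n : ℝ)⁻¹) atTop (𝓝 0) := tendsto_inv_atTop_nhds_zero_nat
  have hlim : Tendsto (fun n : ℕ => 1 - ((M.varBound K (s n) * (M.lamL⁻¹ ^ 2) ^ s n / n) +
      (M.meanError B K (s n) * M.meanError B K (s n) * (M.lamL⁻¹ ^ 2) ^ s n / n) *
        (n : ℝ)⁻¹) / ε ^ 2) atTop (𝓝 1) := by
    have := tendsto_const_nhds (x := (1 : ℝ)).sub ((h1.add (h2.mul h3)).div_const (ε ^ 2))
    simpa using this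
  refine tendsto_of_tendsto_of_tendsto_of_le_of_le' hlim tendsto_const_nhds ?_
    (Eventually.of_forall fun n => M.plantedPr_le_one _)
  have hd : ∀ᶠ n : ℕ in atTop, M.densBound ≤ n :=
    tendsto_natCast_atTop_atTop.eventually_ge_atTop _
  have ha : ∀ᶠ n : ℕ in atTop, ∀ i, M.arity i ≤ n :=
    eventually_all.2 fun i => eventually_ge_atTop _
  filter_upwards [hd, ha, eventually_gt_atTop 0] with n hdn han hn0
  have hn : (0 : ℝ) < n := by exact_mod_cast hn0
  have hlp : 0 < M.lamL ^ s n := pow_pos hl _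
  have hδ : 0 < ε * (n * M.lamL ^ s n) := by positivity
  refine le_trans ?_ (M.one_sub_le_plantedPr (M.quadStat B (s n))
    (n * M.matForm B ((M.influence ^ s n) B)) hδ)
  have hv := M.variance_quadStat_le B hK1 hK hdn (s n)
  have hm := abs_sum_termMean_sub_le B hM hK1 hK (M.sparse_of_densBound_le hn0 hdn) han hB (s n)
  rw [← plantedExp_quadStat] at hm
  have hm2 : (M.plantedExp n (M.quadStat B (s n)) -
      n * M.matForm B ((M.influence ^ s n) B)) ^ 2 ≤ M.meanError B K (s n) ^ 2 :=
    sq_le_sq' (abs_le.1 hm).1 (abs_le.1 hm).2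
  have e1 : ((M.varBound K (s n) * (M.lamL⁻¹ ^ 2) ^ s n / n) +
      (M.meanError B K (s n) * M.meanError B K (s n) * (M.lamL⁻¹ ^ 2) ^ s n / n) *
        (n : ℝ)⁻¹) / ε ^ 2 =
      (n * M.varBound K (s n) + M.meanError B K (s n) ^ 2) / (ε * (n * M.lamL ^ s n)) ^ 2 := by
    rw [← pow_mul, inv_pow, mul_comm 2 (s n), pow_mul]
    field_simp
  rw [e1]
  exact sub_le_sub_left (div_le_div_of_nonneg_right (add_le_add hv hm2) (by positivity)) _

end ObservationModel

namespace ObservationModel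

variable {q : ℕ} {T : Type*} [Fintype T] {F : ℕ} (M : ObservationModel q T F)

/-! ### Eigenvalues of the centred nonbacktracking power -/

/-- The inner product on vectors as a bilinear form. -/
def hForm {n : ℕ} (τ : Fin n → T) :
    (Fin n × Fin q → ℝ) →ₗ[ℝ] (Fin n × Fin q → ℝ) →ₗ[ℝ] ℝ :=
  LinearMap.mk₂ ℝ (M.hInner τ)
    (fun x x' y => by
      simp only [hInner, Pi.add_apply, add_mul, Finset.sum_add_distrib])
    (fun r x y => by
      simp only [hInner, Pi.smul_apply, smul_eq_mul, Finset.mul_sum, mul_assoc])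
    (fun x y y' => by
      simp only [hInner, Pi.add_apply, mul_add, Finset.sum_add_distrib])
    (fun r x y => by
      simp only [hInner, Pi.smul_apply, smul_eq_mul, Finset.mul_sum]
      exact Finset.sum_congr rfl fun p _ => by ring)

theorem hInner_self_pos {n : ℕ} (τ : Fin n → T) {x : Fin n × Fin q → ℝ} (hx : x ≠ 0) :
    0 < M.hInner τ x x := by
  obtain ⟨p, hp⟩ := Function.ne_iff.1 hx
  have h : ∀ p : Fin n × Fin q, 0 < (M.hDiag (τ p.1) p.2)⁻¹ := fun p => inv_pos.2 (M.hDiag_pos _ _)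
  have h1 : ∀ p : Fin n × Fin q, x p * (M.hDiag (τ p.1) p.2)⁻¹ * x p =
      (M.hDiag (τ p.1) p.2)⁻¹ * x p ^ 2 := fun p => by ring
  simp only [hInner, h1]
  exact Finset.sum_pos' (fun p _ => mul_nonneg (h p).le (sq_nonneg _))
    ⟨p, Finset.mem_univ p, mul_pos (h p) (by simpa using pow_pos (abs_pos.2 hp) 2)⟩

theorem exists_isGreatest_eigenvalue {M : ObservationModel q T F} (hM : M.DetailedBalance)
    {n : ℕ} (hn : 0 < n) (s : ℕ) (τ : Fin n → T) (G : Finset (M.Factor n)) :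
    ∃ Λ : ℝ, IsGreatest {μ : ℝ | Module.End.HasEigenvalue
        (Matrix.toLin' (M.nbPower s τ G)) μ} Λ ∧
      ∀ x, M.hInner τ x (M.nbPower s τ G *ᵥ x) ≤ Λ * M.hInner τ x x := by
  obtain ⟨z, -⟩ := M.exists_inSupp
  have : Nonempty (Fin n × Fin q) := ⟨(⟨0, hn⟩, z.2)⟩
  obtain ⟨b, μ, hb, ho⟩ := exists_orthonormal_eigenbasis (M.hForm τ)
    (fun x y => Finset.sum_congr rfl fun p _ => by ring)
    (fun x hx => M.hInner_self_pos τ hx) (Matrix.toLin' (M.nbPower s τ G))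
    (fun x y => (hInner_nbPower_mulVec hM τ G x y).symm)
  have : Nonempty (Fin (Module.finrank ℝ (Fin n × Fin q → ℝ))) := ⟨⟨0, Module.finrank_pos⟩⟩
  exact exists_eigenvalue_ge hb ho

theorem nbPower_zero {n : ℕ} (τ : Fin n → T) (G : Finset (M.Factor n)) :
    M.nbPower 0 τ G = 1 := by
  ext x y
  rw [nbPower, Matrix.of_apply, Finset.sum_eq_single (fun _ => x.1)]
  · simp only [IsNBWalk, IsEmpty.forall_iff, true_and, and_true, walkWeight, Finset.univ_eq_empty,
      Finset.prod_empty, List.ofFn_zero, List.prod_nil, one_smul, Finset.univ_unique,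
      Finset.sum_singleton]
    by_cases h : x.1 = y.1
    · rw [if_pos h, Matrix.one_apply, Matrix.one_apply]
      simp [Prod.ext_iff, h]
    · rw [if_neg h, Matrix.one_apply_ne (fun h' => h (congrArg Prod.fst h')), Matrix.zero_apply]
  · intro v _ hv
    refine Finset.sum_eq_zero fun e _ => if_neg fun h => hv ?_
    funext t
    rw [Fin.fin_one_eq_zero t, h.2.1]
  · simp

theorem quadStat_zero (B : Matrix (T × Fin q) (T × Fin q) ℝ) {n : ℕ} (ω : M.Outcome n) :
    M.quadStat B 0 ω = M.hInner ω.1 (testVec B (M.labels ω)) (testVec B (M.labels ω)) := by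
  rw [quadStat, nbPower_zero, Matrix.one_mulVec]

/-! ### Outcomes of positive probability -/

theorem inSupp_labels_of_mass_pos {n : ℕ} {ω : M.Outcome n} (h : 0 < M.mass ω) (v : Fin n) :
    M.InSupp (M.labels ω v) := by
  rw [mass] at h
  have h1 := left_ne_zero_of_mul h.ne'
  exact ⟨(M.typeDist_nonneg _).lt_of_ne'
      (Finset.prod_ne_zero_iff.1 (left_ne_zero_of_mul h1) v (Finset.mem_univ v)),
    (M.prior_nonneg _ _).lt_of_ne'
      (Finset.prod_ne_zero_iff.1 (right_ne_zero_of_mul h1) v (Finset.mem_univ v))⟩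

/-- On outcomes of positive mass all labels lie in the support, where the columns of `suppOne` are
colour indicators; this identifies the statistic of the theorem with `quadStat`. -/
theorem testVec_suppOne {n : ℕ} {ω : M.Outcome n} (h : 0 < M.mass ω) :
    testVec M.suppOne (M.labels ω) = colorVec ω.2.1 := by
  funext p
  have h1 := M.inSupp_labels_of_mass_pos h p.1
  simp only [testVec, suppOne, Matrix.of_apply, colorVec]
  by_cases hp : ω.2.1 p.1 = p.2
  · have h2 : ((M.labels ω p.1).1, p.2) = M.labels ω p.1 := by rw [← hp]; rfl
    rw [h2, if_pos ⟨rfl, h1⟩, if_pos hp]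
  · rw [if_neg hp, if_neg]
    rintro ⟨h2, -⟩
    exact hp (congrArg Prod.snd h2).symm

theorem localStat_eq {n : ℕ} (s : ℕ) {ω : M.Outcome n} (h : 0 < M.mass ω) :
    M.localStat s ω = M.quadStat M.suppOne s ω / M.quadStat M.suppOne 0 ω := by
  rw [localStat, quadStat_zero, quadStat, M.testVec_suppOne h]

theorem hInner_colorVec_pos {n : ℕ} (hn : 0 < n) (τ : Fin n → T) (c : Fin n → Fin q) :
    0 < M.hInner τ (colorVec c) (colorVec c) := by
  refine M.hInner_self_pos τ fun h => ?_
  have := congrFun h (⟨0, hn⟩, c ⟨0, hn⟩)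
  simp [colorVec] at this

theorem nbPower_eq_zero {M : ObservationModel q T F} (hM : M.DetailedBalance)
    (hL : M.influence = 0) {n s : ℕ} (hs : s ≠ 0) {τ : Fin n → T}
    (hτ : ∀ v, 0 < M.typeDist (τ v)) (G : Finset (M.Factor n)) : M.nbPower s τ G = 0 := by
  obtain ⟨r, rfl⟩ := Nat.exists_eq_succ_of_ne_zero hs
  ext x y
  rw [nbPower, Matrix.of_apply, Finset.sum_eq_zero]
  · rfl
  intro v _
  refine Finset.sum_eq_zero fun e _ => ?_
  split_ifs with h
  swap
  · rfl
  obtain ⟨hc, -, -, hne⟩ := h.1.1 0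
  have h0 : M.stepMat (e 0) (v (Fin.castSucc 0)) (v (Fin.succ 0)) = 0 := by
    refine Finset.sum_eq_zero fun a _ => Finset.sum_eq_zero fun b _ => ?_
    split_ifs with hab
    · refine transMat_eq_zero_of_influence hM hL (fun h' => hne ?_) fun k => hc k ▸ hτ _
      rw [← hab.1, ← hab.2, h']
    · rfl
  rw [walkWeight, List.prod_eq_zero, smul_zero]
  exact List.mem_ofFn.2 ⟨0, h0⟩

theorem localStat_of_lamL_eq_zero {M : ObservationModel q T F} (hM : M.DetailedBalance)
    (hl : M.lamL = 0) {n : ℕ} (hn : 0 < n) (s : ℕ) {ω : M.Outcome n} (h : 0 < M.mass ω) :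
    M.localStat s ω = M.lamL ^ s := by
  rcases eq_or_ne s 0 with rfl | hs
  · rw [localStat, nbPower_zero, Matrix.one_mulVec, pow_zero,
      div_self (M.hInner_colorVec_pos hn _ _).ne']
  · have h0 := nbPower_eq_zero hM (influence_eq_zero_of_lamL hM hl) hs
      (τ := ω.1) (fun v => (M.inSupp_labels_of_mass_pos h v).1) ω.2.2
    rw [localStat, h0, hl, zero_pow hs, Matrix.zero_mulVec]
    simp [hInner]

theorem plantedPr_eq_one {n : ℕ} {A : Set (M.Outcome n)} (h : ∀ ω, 0 < M.mass ω → ω ∈ A) :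
    M.plantedPr n A = 1 := by
  refine le_antisymm (M.plantedPr_le_one A) ?_
  have h1 : M.plantedPr n Set.univ = 1 := by
    rw [plantedPr_eq]
    simpa using M.plantedExp_one n
  rw [← h1]
  exact M.plantedPr_mono fun ω hω _ => h ω hω

theorem tendsto_plantedPr_of_inter {A B C : (n : ℕ) → Set (M.Outcome n)}
    (hA : Tendsto (fun n => M.plantedPr n (A n)) atTop (𝓝 1))
    (hB : Tendsto (fun n => M.plantedPr n (B n)) atTop (𝓝 1))
    (h : ∀ n, 0 < n → ∀ ω, 0 < M.mass ω → ω ∈ A n → ω ∈ B n → ω ∈ C n) :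
    Tendsto (fun n => M.plantedPr n (C n)) atTop (𝓝 1) := by
  have hlim : Tendsto (fun n => M.plantedPr n (A n) + M.plantedPr n (B n) - 1) atTop (𝓝 1) := by
    simpa using (hA.add hB).sub_const 1
  refine tendsto_of_tendsto_of_tendsto_of_le_of_le' hlim tendsto_const_nhds ?_
    (Eventually.of_forall fun n => M.plantedPr_le_one _)
  filter_upwards [eventually_gt_atTop 0] with n hn
  exact (M.plantedPr_inter_ge _ _).trans
    (M.plantedPr_mono fun ω hω hAB => h n hn ω hω hAB.1 hAB.2)

/-! ### The two conclusions for a positive spectral radius -/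

theorem eventually_zero_le_log_div :
    ∀ᶠ n : ℕ in atTop, (((fun _ => 0 : ℕ → ℕ) n : ℕ) : ℝ) ≤
      Real.log n / (Real.log (Real.log n)) ^ 2 :=
  Eventually.of_forall fun n => by
    have := Real.log_natCast_nonneg n
    simp only [Nat.cast_zero]
    positivity

theorem supported_suppOne : M.Supported M.suppOne := by
  intro y x h
  simp only [suppOne, Matrix.of_apply, ne_eq, ite_eq_right_iff, one_ne_zero, imp_false,
    not_not] at h
  obtain ⟨rfl, h⟩ := h
  exact ⟨rfl, h⟩

/-- Since `lamL` is nonzero, the eigenvector lies in the range of `L`, whose elements are block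
diagonal and supported on positive probability. -/
theorem supported_of_eigenvector {M : ObservationModel q T F} (hM : M.DetailedBalance)
    (hl : 0 < M.lamL) {V : Matrix (T × Fin q) (T × Fin q) ℝ}
    (hV : M.influence V = M.lamL • V) : M.Supported V := by
  intro y x h
  have h1 : M.influence V y x ≠ 0 := by
    rw [hV, Matrix.smul_apply, smul_eq_mul]
    exact mul_ne_zero hl.ne' h
  refine ⟨?_, by_contra fun hx => h1 (influence_eq_zero_of_not_inSupp hM V hx)⟩
  by_contra hyx
  exact h1 (if_neg hyx)

theorem influence_pow_eigenvector {V : Matrix (T × Fin q) (T × Fin q) ℝ}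
    (hV : M.influence V = M.lamL • V) (s : ℕ) : (M.influence ^ s) V = M.lamL ^ s • V := by
  induction s with
  | zero => simp
  | succ s ih => rw [pow_succ', Module.End.mul_apply, ih, map_smul, hV, smul_smul, pow_succ]

/-- Numerator and denominator concentrate separately, the denominator being the case `s = 0`; the
uniform lower bound on `γ_s` turns the additive window into a relative one. -/
theorem tendsto_plantedPr_localStat {M : ObservationModel q T F} (hM : M.DetailedBalance)
    (hl : 0 < M.lamL) {s : ℕ → ℕ}
    (hs : ∀ᶠ n : ℕ in atTop, (s n : ℝ) ≤ Real.log n / (Real.log (Real.log n)) ^ 2)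
    {ε : ℝ} (hε : 0 < ε) :
    Tendsto (fun n => M.plantedPr n {ω | |M.localStat (s n) ω - M.gam (s n) * M.lamL ^ s n| ≤
      ε * (M.gam (s n) * M.lamL ^ s n)}) atTop (𝓝 1) := by
  obtain ⟨⟨c, hc, hcγ⟩, -, -⟩ := gam_properties hM hl
  set a := M.matForm M.suppOne M.suppOne with ha
  have ha0 : 0 < a := M.matForm_self_pos _ M.suppOne_ne_zero
  -- The first bound keeps the denominator above `n a / 2`; the second makes the combined error fit
  -- into `ε`.
  set δ := min (a / 2) (ε * a / (2 * (1 / c + 1))) with hδ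
  have hδ0 : 0 < δ := lt_min (by positivity) (by positivity)
  refine M.tendsto_plantedPr_of_inter
    (tendsto_plantedPr_quadStat hM hl M.supported_suppOne hs hδ0)
    (tendsto_plantedPr_quadStat hM hl M.supported_suppOne eventually_zero_le_log_div hδ0)
    fun n hn ω hω h1 h2 => ?_
  have hnr : (0 : ℝ) < n := by exact_mod_cast hn
  simp only [Set.mem_ofPred_eq, pow_zero, Module.End.one_apply, mul_one, ← ha] at h1 h2 ⊢
  rw [M.localStat_eq _ hω]
  set Q := M.quadStat M.suppOne (s n) ω
  set N := M.quadStat M.suppOne 0 ω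
  set l := M.lamL ^ s n
  set γ := M.gam (s n) with hγ
  have hl0 : 0 < l := pow_pos hl _
  have hγc : c ≤ γ := hcγ _
  have hγ0 : 0 < γ := hc.trans_le hγc
  have e1 : M.matForm M.suppOne ((M.influence ^ s n) M.suppOne) = γ * (a * l) := by
    rw [hγ, gam, ← ha, div_mul_cancel₀ _ (mul_pos ha0 hl0).ne']
  rw [e1] at h1
  have hN : n * (a / 2) ≤ N := by
    have h3 := (abs_le.1 h2).1
    have h4 : δ * n ≤ a / 2 * n := mul_le_mul_of_nonneg_right (min_le_left _ _) hnr.le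
    linarith
  have hN0 : 0 < N := lt_of_lt_of_le (by positivity) hN
  have e2 : Q / N - γ * l = (Q - γ * l * N) / N := by
    field_simp
  rw [e2, abs_div, abs_of_pos hN0, div_le_iff₀ hN0]
  have h3 : |Q - γ * l * N| ≤ δ * (n * l) + γ * l * (δ * n) := by
    have e3 : Q - γ * l * N = (Q - n * (γ * (a * l))) - γ * l * (N - n * a) := by ring
    rw [e3]
    refine (abs_sub _ _).trans (add_le_add h1 ?_)
    rw [abs_mul, abs_of_pos (mul_pos hγ0 hl0)]
    exact mul_le_mul_of_nonneg_left h2 (by positivity)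
  have h4 : δ * (1 / c + 1) ≤ ε * (a / 2) := by
    have : δ ≤ ε * a / (2 * (1 / c + 1)) := min_le_right _ _
    rw [le_div_iff₀ (by positivity)] at this
    linarith
  -- The numerator error carries no factor `γ`; one is inserted at the price of `1 / c`.
  have h5 : δ * 1 ≤ δ * (γ * (1 / c)) := by
    refine mul_le_mul_of_nonneg_left ?_ hδ0.le
    rw [mul_one_div, le_div_iff₀ hc]
    linarith
  calc _ ≤ δ * (n * l) + γ * l * (δ * n) := h3
    _ = n * l * (δ * 1 + γ * δ) := by ring
    _ ≤ n * l * (δ * (γ * (1 / c)) + γ * δ) := by gcongr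
    _ = n * l * γ * (δ * (1 / c + 1)) := by ring
    _ ≤ n * l * γ * (ε * (a / 2)) := mul_le_mul_of_nonneg_left h4 (by positivity)
    _ = ε * (γ * l) * (n * (a / 2)) := by ring
    _ ≤ ε * (γ * l) * N := mul_le_mul_of_nonneg_left hN (by positivity)

/-- An eigenvector of `L` gives a test vector whose Rayleigh quotient concentrates at `lamL ^ s`,
without the constants `γ_s`. -/
theorem tendsto_plantedPr_eigenvalue {M : ObservationModel q T F} (hM : M.DetailedBalance)
    (hl : 0 < M.lamL) {s : ℕ → ℕ}
    (hs : ∀ᶠ n : ℕ in atTop, (s n : ℝ) ≤ Real.log n / (Real.log (Real.log n)) ^ 2) :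
    Tendsto (fun n => M.plantedPr n {ω | ∃ Λ : ℝ, IsGreatest {μ : ℝ |
      Module.End.HasEigenvalue (Matrix.toLin' (M.nbPower (s n) ω.1 ω.2.2)) μ} Λ ∧
        M.lamL ^ s n / q ≤ Λ}) atTop (𝓝 1) := by
  obtain ⟨-, -, V, hV0, hV⟩ := gam_properties hM hl
  have hsupp := supported_of_eigenvector hM hl hV
  set a := M.matForm V V with ha
  have ha0 : 0 < a := M.matForm_self_pos V hV0
  -- An error of one third in numerator and denominator leaves the ratio `(2/3) / (4/3) = 1/2`.
  have hδ0 : 0 < a / 3 := by positivity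
  refine M.tendsto_plantedPr_of_inter (tendsto_plantedPr_quadStat hM hl hsupp hs hδ0)
    (tendsto_plantedPr_quadStat hM hl hsupp eventually_zero_le_log_div hδ0)
    fun n hn ω hω h1 h2 => ?_
  have hnr : (0 : ℝ) < n := by exact_mod_cast hn
  obtain ⟨Λ, hΛ, hray⟩ := exists_isGreatest_eigenvalue hM hn (s n) ω.1 ω.2.2
  refine ⟨Λ, hΛ, ?_⟩
  have h3 := hray (testVec V (M.labels ω))
  rw [← quadStat_zero] at h3
  simp only [Set.mem_ofPred_eq, pow_zero, Module.End.one_apply, mul_one, ← ha,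
    M.influence_pow_eigenvector hV, map_smul, smul_eq_mul] at h1 h2
  change M.quadStat V (s n) ω ≤ _ at h3
  set Q := M.quadStat V (s n) ω
  set N := M.quadStat V 0 ω
  set l := M.lamL ^ s n
  have hl0 : 0 < l := pow_pos hl _
  have hQ : n * l * (2 * a / 3) ≤ Q := by
    have := (abs_le.1 h1).1
    linarith
  have hN1 : N ≤ n * (4 * a / 3) := by
    have := (abs_le.1 h2).2
    linarith
  have hN0 : 0 < N := by
    have := (abs_le.1 h2).1
    have h4 : 0 < n * a := by positivity
    linarith
  have hΛ2 : l / 2 ≤ Λ := by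
    refine le_of_mul_le_mul_right (le_trans ?_ h3) hN0
    calc l / 2 * N ≤ l / 2 * (n * (4 * a / 3)) := mul_le_mul_of_nonneg_left hN1 (by positivity)
      _ = n * l * (2 * a / 3) := by ring
      _ ≤ Q := hQ
  refine le_trans ?_ hΛ2
  have hq : (2 : ℝ) ≤ q := by exact_mod_cast two_le_of_lamL_pos hM hl
  exact div_le_div_of_nonneg_left hl0.le two_pos hq

end ObservationModel

end

/-! ### Assembly of the theorem from the cases of zero and positive spectral radius -/

theorem mainTheorem4 {q F : ℕ} {T : Type*} [Fintype T] (M : ObservationModel q T F)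
    (hM : M.DetailedBalance) :
    -- `A^{(s)}` is self-adjoint for the inner product `⟨·,·⟩_H`
    (∀ (n s : ℕ) (ω : M.Outcome n) (x y : Fin n × Fin q → ℝ),
      M.hInner ω.1 x (M.nbPower s ω.1 ω.2.2 *ᵥ y) =
        M.hInner ω.1 (M.nbPower s ω.1 ω.2.2 *ᵥ x) y) ∧
    -- the constants, which depend only on the model and on `s`
    ∃ γ : ℕ → ℝ, (∀ s, 0 < γ s) ∧
      (∃ γ₀ γ₁ : ℝ, 0 < γ₀ ∧ 0 < γ₁ ∧
        Tendsto (fun k => γ (2 * k)) atTop (𝓝 γ₀) ∧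
        Tendsto (fun k => γ (2 * k + 1)) atTop (𝓝 γ₁) ∧
        (¬ Module.End.HasEigenvalue M.influence (-M.lamL) → γ₀ = γ₁)) ∧
      ∀ s : ℕ → ℕ,
        (∀ᶠ n : ℕ in atTop, (s n : ℝ) ≤ Real.log n / (Real.log (Real.log n)) ^ 2) →
        -- concentration of the normalised quadratic form
        (∀ ε : ℝ, 0 < ε →
          Tendsto (fun n => M.plantedPr n
            {ω | |M.localStat (s n) ω - γ (s n) * M.lamL ^ (s n)| ≤
              ε * (γ (s n) * M.lamL ^ (s n))}) atTop (𝓝 1)) ∧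
        -- lower bound on the largest eigenvalue
        Tendsto (fun n => M.plantedPr n
          {ω | ∃ Λ : ℝ,
            IsGreatest {μ : ℝ | Module.End.HasEigenvalue
              (Matrix.toLin' (M.nbPower (s n) ω.1 ω.2.2)) μ} Λ ∧
            M.lamL ^ (s n) / q ≤ Λ}) atTop (𝓝 1) := by
  refine ⟨fun n s ω x y => ObservationModel.hInner_nbPower_mulVec hM ω.1 ω.2.2 x y, ?_⟩
  rcases M.lamL_nonneg.eq_or_lt with hl | hl
  -- For `lamL = 0` the statistic equals `0 ^ s` with probability one for `n > 0`, including the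
  -- value `1` at `s = 0`, so constant `γ` suffices.
  · refine ⟨fun _ => 1, fun _ => one_pos, ⟨1, 1, one_pos, one_pos, tendsto_const_nhds,
      tendsto_const_nhds, fun _ => rfl⟩, fun s _ => ⟨fun ε hε => ?_, ?_⟩⟩
    · refine tendsto_const_nhds.congr' ?_
      filter_upwards [eventually_gt_atTop 0] with n hn
      refine (M.plantedPr_eq_one fun ω hω => ?_).symm
      rw [Set.mem_ofPred_eq, ObservationModel.localStat_of_lamL_eq_zero hM hl.symm hn _ hω, one_mul,
        sub_self, abs_zero]
      exact mul_nonneg hε.le (pow_nonneg M.lamL_nonneg _)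
    · refine tendsto_const_nhds.congr' ?_
      filter_upwards [eventually_gt_atTop 0] with n hn
      refine (M.plantedPr_eq_one fun ω hω => ?_).symm
      obtain ⟨Λ, hΛ, hray⟩ :=
        ObservationModel.exists_isGreatest_eigenvalue hM hn (s n) ω.1 ω.2.2
      refine ⟨Λ, hΛ, ?_⟩
      -- The statistic is the Rayleigh quotient at the colour indicator, hence a lower bound for the
      -- largest eigenvalue.
      have h1 := (div_le_iff₀ (M.hInner_colorVec_pos hn ω.1 ω.2.1)).2
        (hray (ObservationModel.colorVec ω.2.1))
      change M.localStat (s n) ω ≤ Λ at h1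
      rw [ObservationModel.localStat_of_lamL_eq_zero hM hl.symm hn _ hω] at h1
      obtain ⟨z, -⟩ := M.exists_inSupp
      have hq : (1 : ℝ) ≤ q := by exact_mod_cast z.2.pos
      exact (div_le_self (pow_nonneg M.lamL_nonneg _) hq).trans h1
  · obtain ⟨⟨c, hc, hcγ⟩, hlim, -⟩ := ObservationModel.gam_properties hM hl
    exact ⟨M.gam, fun s => hc.trans_le (hcγ s), hlim, fun s hs =>
      ⟨fun ε hε => ObservationModel.tendsto_plantedPr_localStat hM hl hs hε,
        ObservationModel.tendsto_plantedPr_eigenvalue hM hl hs⟩⟩
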